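/- Let $\mathbb K$ be $\mathbb R$ or $\mathbb C$, let indices run over $1,\dots,n$, $n\ge 1$, and sum over repeated upper and lower indices. **Frobenius data.** Let $F$ be a smooth solution of the WDVV equations with specified variable $v^{\epsilon}$ on a non-empty connected open set of $\mathbb K^n$: $\eta_{\alpha\beta}=\partial_{\epsilon}\partial_\alpha\partial_\beta F$ is a constant nondegenerate matrix, $c^\alpha_{\beta\gamma}=\eta^{\alpha\nu}\partial_\nu\partial_\beta\partial_\gamma F$ are the structure constants of an associative algebra, and $\partial_EF=(3-d)F+\frac12A_{\alpha\beta}v^\alpha v^\beta+B_\alpha v^\alpha+C$ with constants $A_{\alpha\beta}=A_{\beta\alpha},B_\alpha,C$ and $E=\sum_\alpha\big((1-\frac d2-\mu_\alpha)v^\alpha+r_\alpha\big)\partial_\alpha$, $\mu_{\epsilon}=-\frac d2$. A *calibration* of $F$ consists of smooth functions $\theta_{\alpha,p}$ ($p\ge0$), $\theta_\alpha(z)=\sum_p\theta_{\alpha,p}z^p$, and constant matrices $R_k$ ($k\ge1$) with $$\partial_\alpha\partial_\beta\theta_\nu(z)=z\,c^\gamma_{\alpha\beta}\partial_\gamma\theta_\nu(z),\qquad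 \partial_E\partial_\beta\theta_{\alpha,p}=(p+\mu_\alpha+\mu_\beta)\partial_\beta\theta_{\alpha,p}+\sum_{k=1}^p(R_k)^\varepsilon_\alpha\,\partial_\beta\theta_{\varepsilon,p-k},$$ $$\theta_{\alpha,0}=\eta_{\alpha\gamma}v^\gamma,\qquad \partial_\gamma\theta_\alpha(z)\,\eta^{\gamma\nu}\,\partial_\nu\theta_\beta(-z)=\eta_{\alpha\beta},\qquad \partial_{\epsilon}\theta_{\alpha,p+1}=\theta_{\alpha,p},$$ $(R_k)^\alpha_\beta\ne0$ only if $\mu_\alpha-\mu_\beta=k$, and $\eta_{\alpha\gamma}(R_k)^\gamma_\beta=(-1)^{k+1}\eta_{\beta\gamma}(R_k)^\gamma_\alpha$. Let $\Omega_{\alpha,p;\beta,q}$ be defined by $\sum\Omega_{\alpha,p;\beta,q}z^pw^q=\dfrac{\partial_\gamma\theta_\alpha(z)\eta^{\gamma\xi}\partial_\xi\theta_\beta(w)-\eta_{\alpha\beta}}{z+w}$. **Tau functions.** Times $t=(t^{\alpha,p})_{p\ge0}$ have finitely many nonzero entries; a set of times is open, and a function on it smooth, if this holds on all finite-dimensional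 affine subspaces. The spatial variable is $x=t^{\epsilon,0}$. A tau function of the principal hierarchy of $F$ is $\tau=e^{\log\tau}$ with $\log\tau$ smooth on an open set, such that for a smooth solution $v(t)$ of $$\frac{\partial v^\alpha}{\partial t^{\beta,q}}=\eta^{\alpha\gamma}\partial_x\Big(\frac{\partial\theta_{\beta,q+1}}{\partial v^\gamma}\Big)$$ (with values in the domain of $F$) one has $\dfrac{\partial^2\log\tau}{\partial x\,\partial t^{\alpha,p}}=\theta_{\alpha,p}(v(t))$ and $\dfrac{\partial^2\log\tau}{\partial t^{\alpha,p}\partial t^{\beta,q}}=\Omega_{\alpha,p;\beta,q}(v(t))$. **Virasoro symmetries.** Put $R=\sum_kR_k$, $\mu=\mathrm{diag}(\mu_\alpha)$, and for $m\ge-1$, $k\in\mathbb Z$, $$P_m(\mu-k,R)=\Big[e^{R\partial_y}\prod_{j=0}^m\big(y+\mu-k+j-\tfrac12\big)\Big]_{y=0}\quad(R\text{ to the left of }\mu),\qquad P_{-1}=1;$$ let $[P]_q$ be the matrix of those entries $P^\alpha_\beta$ with $\mu_\alpha-\mu_\beta=q$, and $\langle a,b\rangle=\eta_{\alpha\beta}a^\alpha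 b^\beta$. Let $a_k^\alpha=\eta^{\alpha\beta}\frac{\partial\log\tau}{\partial t^{\beta,k}}$ for $k\ge0$ and $a_k^\alpha=(-1)^{k+1}t^{\alpha,-k-1}$ for $k<0$. The right-hand side of the $m$-th Virasoro symmetry $\partial\log\tau/\partial s_m$ is $$A_m(t;\tau)=\tfrac12\sum_{k,l\in\mathbb Z}(-1)^{k+1}\big\langle a_l,[P_m(\mu-k,R)]_{m-1-l-k}\,a_k\big\rangle ,$$ a quadratic expression $\sum a\,\frac{\partial\log\tau}{\partial t}\frac{\partial\log\tau}{\partial t}+\sum b\,t\,\frac{\partial\log\tau}{\partial t}+\sum c\,t\,t$ in which only finitely many terms are nonzero. For a finitely supported family of constants $c^{\alpha,p}$, $A_m(t-c;\tau)$ is obtained by replacing $t^{\alpha,p}$ by $t^{\alpha,p}-c^{\alpha,p}$ in the coefficients, the derivatives $\partial\log\tau/\partial t^{\beta,q}$ being taken at $t$. Now let $F$, with $\epsilon=1$, be such a solution with calibration $(\theta,R)$, and let $\tau(t)$ be a tau function of its principal hierarchy on an open set $\mathcal T$, with solution $v(t)$. **Type 1.** Let $1\le\kappa\le n$ be such that $(c^\alpha_{\beta\kappa})$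 is invertible, $v\mapsto\hat v$, $\hat v^\alpha=\eta^{\alpha\gamma}\partial_\gamma\partial_\kappa F$, is injective, and $\partial_\kappa\theta_{\alpha,1}=\partial_\kappa\partial_\alpha F$. Let $\hat F(\hat v)$ be a smooth function on the image with $\partial^2\hat F/\partial\hat v^\alpha\partial\hat v^\beta=\partial^2F/\partial v^\alpha\partial v^\beta$. Put $\hat\eta=\eta$, $\hat d=-2\mu_\kappa$, $\hat\mu=\mu$, $\hat r_\alpha=A_{\kappa\xi}\eta^{\xi\alpha}$, $\hat R_k=R_k$, $\hat\theta_{\alpha,p}(\hat v)=\partial_\kappa\theta_{\alpha,p+1}(v)$, $\hat t=t$ (so $\hat x=t^{\kappa,0}$), $\hat\tau(\hat t)=\tau(t)$. Then $\hat F$ with these constants solves the WDVV equations with specified variable $\hat v^\kappa$, $(\hat\theta,\hat R)$ is a calibration of it, $\hat\tau$ is a tau function of its principal hierarchy with solution $\hat v(v(t))$, and, with $\hat A_m$ built from $(\hat\eta,\hat\mu,\hat R)$, $$\hat A_m(\hat t;\hat\tau)=A_m(t;\tau),\qquad m\ge-1.$$ If moreover $A_m(t-c;\tau)=0$ on $\mathcal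 T$ for all $m\ge-1$, with $c^{\alpha,p}=\delta^\alpha_1\delta^p_1$, then $\hat A_m(\hat t-\hat c;\hat\tau)=0$ for all $m\ge-1$, with $\hat c^{\alpha,p}=\delta^\alpha_1\delta^p_1$. **Type 2.** Let $n\ge2$, $\eta_{\alpha\beta}=\delta_{\alpha+\beta,n+1}$, $r_\alpha=0$, $v^n\ne0$ on the domain of $F$, and $\theta_{1,1}=\partial F/\partial v^1=\frac12\eta_{\alpha\beta}v^\alpha v^\beta$. Put $$\hat v^1=-\tfrac12\frac{\eta_{\sigma\gamma}v^\sigma v^\gamma}{v^n},\quad\hat v^\alpha=\frac{v^\alpha}{v^n}\ (\alpha\ne1,n),\quad\hat v^n=\frac1{v^n},\quad\hat F(\hat v)=(v^n)^{-2}\big(-F(v)+\tfrac12\eta_{\sigma\gamma}v^1v^\sigma v^\gamma\big),$$ $\hat\eta=\eta$, $\hat d=2-d$, $\hat r_\alpha=0$, $\hat\mu_1=\mu_n-1$, $\hat\mu_n=\mu_1+1$, $\hat\mu_\alpha=\mu_\alpha$ ($\alpha\ne1,n$), $$\hat\theta_{1,0}=\tfrac1{v^n},\quad\hat\theta_{1,p}=(-1)^p\tfrac{\theta_{n,p-1}}{v^n}\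 (p\ge1),\quad\hat\theta_{n,p}=(-1)^{p+1}\tfrac{\theta_{1,p+1}}{v^n},\quad\hat\theta_{\alpha,p}=(-1)^p\tfrac{\theta_{\alpha,p}}{v^n}\ (\alpha\ne1,n),$$ and, for $k\ge1$, $(\hat R_k)^\alpha_\beta=(-1)^{k+\delta^\alpha_n+\delta^n_\beta}\big(R_{k+\delta(\alpha)-\delta(\beta)}\big)^{\alpha+(n-1)\delta(\alpha)}_{\beta+(n-1)\delta(\beta)}$ with $\delta(\alpha)=\delta^1_\alpha-\delta^n_\alpha$ and $R_l=0$ for $l\le0$. Then $\hat F$ with these constants solves the WDVV equations with specified variable $\hat v^1$ and $(\hat\theta,\hat R)$ is a calibration of it. Let further $$\hat t^{1,0}=\hat x=-\frac{\partial\log\tau}{\partial x},\quad\hat t^{1,p}=(-1)^pt^{n,p-1}\ (p\ge1),\quad\hat t^{n,p}=(-1)^{p+1}t^{1,p+1},\quad\hat t^{\alpha,p}=(-1)^pt^{\alpha,p}\ (\alpha\ne1,n),$$ suppose that $t\mapsto\hat t$ is injective on $\mathcal T$, and put $\log\hat\tau(\hat t)=x\,\frac{\partial\log\tau}{\partial x}-\log\tau$.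 Then $\hat\tau$ is a tau function of the principal hierarchy of $\hat F$ on the image of $\mathcal T$, with solution $\hat v(v(t))$, and $$\hat A_m(\hat t;\hat\tau)=(-1)^{m+1}A_m(t;\tau),\qquad m\ge-1.$$ If moreover $A_m(t-c;\tau)=0$ on $\mathcal T$ for all $m\ge-1$, with $c^{\alpha,p}=\delta^\alpha_1\delta^p_1$, then $\hat A_m(\hat t-\hat c;\hat\tau)=0$ for all $m\ge-1$, with $\hat c^{\alpha,p}=-\delta^\alpha_n\delta^p_0$. -/

import Mathlib

open scoped ContDiff Matrix

noncomputable section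

/-- Sequences of times `t^{α,p}` (`α` an index, `p ≥ 0`), only finitely many of which are nonzero. -/
abbrev Times (𝕜 : Type*) [RCLike 𝕜] (n : ℕ) : Type _ := (Fin n × ℕ) →₀ 𝕜

section Calculus

variable {𝕜 : Type*} [RCLike 𝕜] {n : ℕ}

/-- The partial derivative `∂_α f = ∂f/∂v^α` of a function of `v = (v^1, …, v^n)`. -/
def pd (α : Fin n) (f : (Fin n → 𝕜) → 𝕜) (v : Fin n → 𝕜) : 𝕜 :=
  lineDeriv 𝕜 f v (Pi.single α 1)

/-- The partial derivative `∂f/∂t^{α,p}`, `i = (α,p)`, of a function of the times. -/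
def td (i : Fin n × ℕ) (f : Times 𝕜 n → 𝕜) (t : Times 𝕜 n) : 𝕜 :=
  lineDeriv 𝕜 f t (Finsupp.single i 1)

/-- A set of times is open when its trace on every finite-dimensional affine subspace is open. -/
def TimesOpen (Ω : Set (Times 𝕜 n)) : Prop :=
  ∀ (k : ℕ) (t : Times 𝕜 n) (φ : (Fin k → 𝕜) →ₗ[𝕜] Times 𝕜 n), IsOpen {s | t + φ s ∈ Ω}

/-- A function of the times is smooth on `Ω` when it is so along every finite-dimensional affine
subspace. -/
def TimesSmoothOn {V : Type*} [NormedAddCommGroup V] [NormedSpace 𝕜 V]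
    (f : Times 𝕜 n → V) (Ω : Set (Times 𝕜 n)) : Prop :=
  ∀ (k : ℕ) (t : Times 𝕜 n) (φ : (Fin k → 𝕜) →ₗ[𝕜] Times 𝕜 n),
    ContDiffOn 𝕜 ∞ (fun s => f (t + φ s)) {s | t + φ s ∈ Ω}

end Calculus

/-- The data of a solution of the WDVV equations together with a choice of the densities
`θ_{α,p}` and of the constant matrices `R_k`. The equations are imposed by `IsWDVV` and
`IsCalibration` below. -/
structure FrobeniusData (𝕜 : Type*) [RCLike 𝕜] (n : ℕ) where
  /-- the domain of the flat coordinates -/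
  dom : Set (Fin n → 𝕜)
  /-- the potential -/
  F : (Fin n → 𝕜) → 𝕜
  /-- the index of the specified variable (the unit vector field is `∂/∂v^unit`) -/
  unit : Fin n
  /-- the matrix `η_{αβ}` -/
  η : Matrix (Fin n) (Fin n) 𝕜
  /-- the charge -/
  d : 𝕜
  /-- the constants `μ_α` of the Euler vector field -/
  μ : Fin n → 𝕜
  /-- the constants `r_α` of the Euler vector field -/
  r : Fin n → 𝕜
  /-- the functions `θ_{α,p}` -/
  θ : Fin n → ℕ → (Fin n → 𝕜) → 𝕜
  /-- the matrices `R_k`; `R k α β` is `(R_k)^α_β` -/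
  R : ℕ → Matrix (Fin n) (Fin n) 𝕜

namespace FrobeniusData

variable {𝕜 : Type*} [RCLike 𝕜] {n : ℕ} (D : FrobeniusData 𝕜 n)

/-- The structure functions `c^α_{βγ} = η^{αν} ∂_ν ∂_β ∂_γ F`. -/
def c (α β γ : Fin n) (v : Fin n → 𝕜) : 𝕜 :=
  ∑ ν, D.η⁻¹ α ν * pd ν (pd β (pd γ D.F)) v

/-- The Euler vector field `E^α = (1 - d/2 - μ_α) v^α + r_α`. -/
def euler (v : Fin n → 𝕜) : Fin n → 𝕜 := fun α => (1 - D.d / 2 - D.μ α) * v α + D.r α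

/-- The derivative `∂_E f` along the Euler vector field. -/
def eulerDeriv (f : (Fin n → 𝕜) → 𝕜) (v : Fin n → 𝕜) : 𝕜 := lineDeriv 𝕜 f v (D.euler v)

/-- The quasi-homogeneity `∂_E F = (3 - d) F + ½ A_{αβ} v^α v^β + B_α v^α + C`. -/
def IsQuasiHomogeneous (A : Matrix (Fin n) (Fin n) 𝕜) (B : Fin n → 𝕜) (C : 𝕜) : Prop :=
  A.IsSymm ∧ ∀ v ∈ D.dom, D.eulerDeriv D.F v =
    (3 - D.d) * D.F v + 1 / 2 * ∑ α, ∑ β, A α β * v α * v β + ∑ α, B α * v α + C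

/-- `F` is a smooth solution of the WDVV equations with specified variable `v^unit`. -/
structure IsWDVV : Prop where
  isOpen : IsOpen D.dom
  isConnected : IsConnected D.dom
  smooth : ContDiffOn 𝕜 ∞ D.F D.dom
  metric : ∀ v ∈ D.dom, ∀ α β, pd D.unit (pd α (pd β D.F)) v = D.η α β
  nondegenerate : D.η.det ≠ 0
  assoc : ∀ v ∈ D.dom, ∀ α β γ ν,
    ∑ l, D.c l α β v * D.c ν l γ v = ∑ l, D.c l γ β v * D.c ν l α v
  charge : D.μ D.unit = -(D.d / 2)
  quasi : ∃ A B C, D.IsQuasiHomogeneous A B C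

/-- The pairing `⟨∇f, ∇g⟩ = ∂_γ f η^{γξ} ∂_ξ g`. -/
def gradPair (f g : (Fin n → 𝕜) → 𝕜) (v : Fin n → 𝕜) : 𝕜 :=
  ∑ γ, ∑ ξ, pd γ f v * D.η⁻¹ γ ξ * pd ξ g v

/-- The `θ_{α,p}` are densities of the Hamiltonians (coefficients of `z^p` of deformed flat
coordinates) and the `R_k` are the associated constant matrices. -/
structure IsCalibration : Prop where
  smooth : ∀ α p, ContDiffOn 𝕜 ∞ (D.θ α p) D.dom
  /-- `∂_α ∂_β θ_ν(z) = z c^γ_{αβ} ∂_γ θ_ν(z)`, coefficient of `z^{p+1}`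
  (that of `z^0` follows from `theta_zero`) -/
  flat : ∀ v ∈ D.dom, ∀ α β ν p,
    pd α (pd β (D.θ ν (p + 1))) v = ∑ γ, D.c γ α β v * pd γ (D.θ ν p) v
  homogeneous : ∀ v ∈ D.dom, ∀ α β p,
    D.eulerDeriv (pd β (D.θ α p)) v = ((p : 𝕜) + D.μ α + D.μ β) * pd β (D.θ α p) v
      + ∑ k ∈ Finset.Icc 1 p, ∑ ε, pd β (D.θ ε (p - k)) v * D.R k ε α
  theta_zero : ∀ v ∈ D.dom, ∀ α, D.θ α 0 v = ∑ γ, D.η α γ * v γ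
  /-- `⟨∇θ_α(z), ∇θ_β(-z)⟩ = η_{αβ}`, coefficient of `z^p` -/
  orthogonal : ∀ v ∈ D.dom, ∀ α β p,
    ∑ i ∈ Finset.range (p + 1), (-1) ^ (p - i) * D.gradPair (D.θ α i) (D.θ β (p - i)) v
      = if p = 0 then D.η α β else 0
  /-- the normalization `∂_1 θ_{α,p+1} = θ_{α,p}` of the additive constants -/
  unit_deriv : ∀ v ∈ D.dom, ∀ α p, pd D.unit (D.θ α (p + 1)) v = D.θ α p v
  R_zero : D.R 0 = 0
  R_graded : ∀ k α β, D.R k α β ≠ 0 → D.μ α - D.μ β = k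
  R_symm : ∀ k, 1 ≤ k → ∀ α β,
    ∑ γ, D.η α γ * D.R k γ β = (-1) ^ (k + 1) * ∑ γ, D.η β γ * D.R k γ α

/-- The functions `Ω_{α,p;β,q}`, the coefficients of
`∑ Ω_{α,p;β,q} z^p w^q = (⟨∇θ_α(z), ∇θ_β(w)⟩ - η_{αβ}) / (z + w)`. -/
def twoPoint (α : Fin n) (p : ℕ) (β : Fin n) (q : ℕ) (v : Fin n → 𝕜) : 𝕜 :=
  ∑ i ∈ Finset.range (q + 1), (-1) ^ i * D.gradPair (D.θ α (p + 1 + i)) (D.θ β (q - i)) v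

/-- The coefficients of `z^{p+1} w^0` and `z^{p+1} w^{q+1}` in the defining identity
`(z + w) ∑ Ω_{α,p;β,q} z^p w^q = ⟨∇θ_α(z), ∇θ_β(w)⟩ - η_{αβ}`. -/
theorem twoPoint_spec (α : Fin n) (p : ℕ) (β : Fin n) (q : ℕ) (v : Fin n → 𝕜) :
    D.twoPoint α p β 0 v = D.gradPair (D.θ α (p + 1)) (D.θ β 0) v ∧
    D.twoPoint α p β (q + 1) v + D.twoPoint α (p + 1) β q v
      = D.gradPair (D.θ α (p + 1)) (D.θ β (q + 1)) v := by
  constructor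
  · simp [twoPoint]
  · simp only [twoPoint]
    rw [Finset.sum_range_succ']
    have h : ∀ i ∈ Finset.range (q + 1),
        (-1 : 𝕜) ^ (i + 1) * D.gradPair (D.θ α (p + 1 + (i + 1))) (D.θ β (q + 1 - (i + 1))) v
        = -((-1) ^ i * D.gradPair (D.θ α (p + 1 + 1 + i)) (D.θ β (q - i)) v) := by
      intro i _
      rw [show p + 1 + (i + 1) = p + 1 + 1 + i by ring, show q + 1 - (i + 1) = q - i by omega]
      ring
    rw [Finset.sum_congr rfl h]
    simp

/-- The coefficients of `z^0 w^0` and `z^0 w^{q+1}` in the same identity. -/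
theorem twoPoint_spec_zero (h : D.IsCalibration) (α β : Fin n) (q : ℕ) (v : Fin n → 𝕜)
    (hv : v ∈ D.dom) :
    D.gradPair (D.θ α 0) (D.θ β 0) v - D.η α β = 0 ∧
    D.twoPoint α 0 β q v = D.gradPair (D.θ α 0) (D.θ β (q + 1)) v := by
  constructor
  · have := h.orthogonal v hv α β 0
    simpa [sub_eq_zero] using this
  · have := h.orthogonal v hv α β (q + 1)
    rw [Finset.sum_range_succ'] at this
    have h2 : (-1 : 𝕜) ^ (q + 1) * (∑ i ∈ Finset.range (q + 1), (-1) ^ (q + 1 - (i + 1)) *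
        D.gradPair (D.θ α (i + 1)) (D.θ β (q + 1 - (i + 1))) v) =
        - D.twoPoint α 0 β q v := by
      rw [twoPoint, Finset.mul_sum, ← Finset.sum_neg_distrib]
      refine Finset.sum_congr rfl fun i hi => ?_
      obtain ⟨j, rfl⟩ : ∃ j, q = i + j := ⟨q - i, by have := Finset.mem_range.1 hi; omega⟩
      rw [show i + j + 1 - (i + 1) = j by omega, show i + j - i = j by omega,
        show 0 + 1 + i = i + 1 by ring]
      have : ((-1 : 𝕜) ^ j) * (-1) ^ j = 1 := by rw [← mul_pow]; simp
      linear_combination (-(-1 : 𝕜) ^ i * D.gradPair (D.θ α (i + 1)) (D.θ β j) v) * this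
    have h3 : ((-1 : 𝕜) ^ (q + 1)) * (-1) ^ (q + 1) = 1 := by rw [← mul_pow]; simp
    simp only [Nat.sub_zero, Nat.add_eq_zero_iff, one_ne_zero, and_false, if_false] at this
    linear_combination h2 - (-1 : 𝕜) ^ (q + 1) * this
      + D.gradPair (D.θ α 0) (D.θ β (q + 1)) v * h3

/-- `v = v(t)` is a solution of the principal hierarchy of `D` on `Ω`, the spatial variable being
`x = t^{unit,0}`, and `logτ` is the logarithm of a tau function of this solution. -/
structure IsTau (Ω : Set (Times 𝕜 n)) (v : Times 𝕜 n → Fin n → 𝕜) (logτ : Times 𝕜 n → 𝕜) :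
    Prop where
  isOpen : TimesOpen Ω
  smooth_v : TimesSmoothOn v Ω
  smooth_logτ : TimesSmoothOn logτ Ω
  mapsTo : ∀ t ∈ Ω, v t ∈ D.dom
  hierarchy : ∀ t ∈ Ω, ∀ α β q, td (β, q) (fun s => v s α) t =
    ∑ γ, D.η⁻¹ α γ * td (D.unit, 0) (fun s => pd γ (D.θ β (q + 1)) (v s)) t
  tau_x : ∀ t ∈ Ω, ∀ α p, td (D.unit, 0) (td (α, p) logτ) t = D.θ α p (v t)
  tau : ∀ t ∈ Ω, ∀ α p β q, td (α, p) (td (β, q) logτ) t = D.twoPoint α p β q (v t)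

/-! ### The Virasoro symmetries -/

/-- The nilpotent matrix `R = R_1 + R_2 + ⋯` (a finite sum by the grading of the `R_k`). -/
def totalR : Matrix (Fin n) (Fin n) 𝕜 := Matrix.of fun α β => ∑ᶠ k, D.R k α β

/-- The matrix `P_m(μ - k, R) = [exp(R ∂_x) ∏_{j=0}^m (x + μ - k + j - 1/2)]_{x=0}`, where powers of
`R` stand to the left of those of `μ`; it is the identity for `m = -1`. The derivative
`∂_x^s / s!` at `x = 0` is the `s`-th coefficient. -/
def virP (m k : ℤ) : Matrix (Fin n) (Fin n) 𝕜 :=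
  ∑ s ∈ Finset.range ((m + 1).toNat + 1), D.totalR ^ s * Matrix.diagonal fun β =>
    (∏ j ∈ Finset.range (m + 1).toNat,
      (Polynomial.X + Polynomial.C (D.μ β - k + j - 1 / 2))).coeff s

open Classical in
/-- The part `[P]_q` of a matrix that raises the eigenvalue of `μ` by `q`. -/
def degPart (q : ℤ) (P : Matrix (Fin n) (Fin n) 𝕜) : Matrix (Fin n) (Fin n) 𝕜 :=
  Matrix.of fun α β => if D.μ α - D.μ β = q then P α β else 0

/-- The vector `a_k`, `k ∈ ℤ`, with components `a_k^α = η^{αβ} p_{β,k}` for `k ≥ 0` and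
`a_k^α = (-1)^{k+1} t^{α,-k-1}` for `k < 0`; here `p_{β,k}` stands for `∂ log τ / ∂t^{β,k}`. -/
def mode (t : Times 𝕜 n) (p : Fin n × ℕ → 𝕜) (k : ℤ) : Fin n → 𝕜 := fun α =>
  if 0 ≤ k then ∑ β, D.η⁻¹ α β * p (β, k.toNat) else (-1) ^ (k + 1) * t (α, (-k - 1).toNat)

/-- The quadratic expression
`½ ∑_{k,l} (-1)^{k+1} ⟨a_l, [P_m(μ - k, R)]_{m-1-l-k} a_k⟩
  = ∑ a_m^{α,p;β,q} p_{α,p} p_{β,q} + ∑ b_{m;α,p}^{β,q} t^{α,p} p_{β,q}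
    + ∑ c_{m;α,p;β,q} t^{α,p} t^{β,q}`
of the Virasoro symmetries. Only finitely many terms are nonzero. -/
def virasoroForm (m : ℤ) (t : Times 𝕜 n) (p : Fin n × ℕ → 𝕜) : 𝕜 :=
  ∑ᶠ kl : ℤ × ℤ, 1 / 2 * (-1) ^ (kl.1 + 1) *
    (D.mode t p kl.2 ⬝ᵥ
      ((D.η * D.degPart (m - 1 - kl.2 - kl.1) (D.virP m kl.1)) *ᵥ D.mode t p kl.1))

/-- `A_m(t; τ)`, the right-hand side of the `m`-th Virasoro symmetry `∂ log τ / ∂s_m`. -/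
def virasoroA (m : ℤ) (logτ : Times 𝕜 n → 𝕜) (t : Times 𝕜 n) : 𝕜 :=
  D.virasoroForm m t fun i => td i logτ t

/-- The Virasoro constraints `A_m(t - c; τ) = 0`, `m ≥ -1`, for all `t ∈ Ω`: the variables
`t^{α,p}` in the coefficients are shifted by the constants `c^{α,p}`. -/
def VirasoroConstraints (c : Times 𝕜 n) (logτ : Times 𝕜 n → 𝕜) (Ω : Set (Times 𝕜 n)) : Prop :=
  ∀ m : ℤ, -1 ≤ m → ∀ t ∈ Ω, D.virasoroForm m (t - c) (fun i => td i logτ t) = 0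

/-! ### Symmetries of type 1 -/

/-- The new coordinates `v̂^α = η^{αγ} ∂_γ ∂_κ F(v)`. -/
def type1Coord (κ : Fin n) (v : Fin n → 𝕜) : Fin n → 𝕜 := fun α =>
  ∑ γ, D.η⁻¹ α γ * pd γ (pd κ D.F) v

/-- `D'` is obtained from `D` by the type-1 symmetry with index `κ`. -/
structure IsType1 (κ : Fin n) (D' : FrobeniusData 𝕜 n) : Prop where
  /-- the matrix `(c^α_{βκ})` is invertible -/
  invertible : ∀ v ∈ D.dom, (Matrix.of fun α β => D.c α β κ v).det ≠ 0
  /-- the `v̂^α` are coordinates on the domain of `F` -/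
  injective : Set.InjOn (D.type1Coord κ) D.dom
  /-- the quadratic terms of `F` are normalized by `∂_κ θ_{α,1} = ∂_κ ∂_α F` -/
  normalized : ∀ v ∈ D.dom, ∀ α, pd κ (D.θ α 1) v = pd κ (pd α D.F) v
  dom : D'.dom = D.type1Coord κ '' D.dom
  smooth : ContDiffOn 𝕜 ∞ D'.F D'.dom
  potential : ∀ v ∈ D.dom, ∀ α β,
    pd α (pd β D'.F) (D.type1Coord κ v) = pd α (pd β D.F) v
  unit : D'.unit = κ
  η : D'.η = D.η
  d : D'.d = -2 * D.μ κ
  μ : D'.μ = D.μ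
  /-- `r̂_α = A_{κξ} η^{ξα}` -/
  r : ∃ A B C, D.IsQuasiHomogeneous A B C ∧ ∀ α, D'.r α = ∑ ξ, A κ ξ * D.η⁻¹ ξ α
  /-- the functions determined by `∂θ̂_{α,p}/∂v̂^β = ∂θ_{α,p}/∂v^β`, `θ̂_{α,0} = η_{αγ} v̂^γ`
  and `∂θ̂_{α,p+1}/∂v̂^κ = θ̂_{α,p}` -/
  θ : ∀ v ∈ D.dom, ∀ α p, D'.θ α p (D.type1Coord κ v) = pd κ (D.θ α (p + 1)) v
  R : D'.R = D.R

/-! ### Symmetries of type 2. The first index `1` is `0 : Fin n`, the last index `n` is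
`Fin.rev 0`. -/

section Type2

variable [NeZero n]

/-- The quadratic form `η_{σγ} v^σ v^γ`. -/
def sqNorm (v : Fin n → 𝕜) : 𝕜 := ∑ σ, ∑ γ, D.η σ γ * v σ * v γ

/-- The assumptions under which the type-2 symmetry is applied. -/
structure IsType2Normalized : Prop where
  two_le : 2 ≤ n
  unit : D.unit = 0
  /-- `η_{αβ} = δ_{α+β,n+1}` -/
  η : ∀ α β, D.η α β = if β = α.rev then 1 else 0
  r : D.r = 0
  last_ne_zero : ∀ v ∈ D.dom, v (Fin.rev 0) ≠ 0
  /-- `∂F/∂v^1 = ½ η_{αβ} v^α v^β` -/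
  potential : ∀ v ∈ D.dom, pd 0 D.F v = 1 / 2 * D.sqNorm v
  /-- `θ_{1,1} = ½ η_{αβ} v^α v^β` -/
  theta_one : ∀ v ∈ D.dom, D.θ 0 1 v = 1 / 2 * D.sqNorm v

/-- The new coordinates `v̂^1 = -½ η_{σγ} v^σ v^γ / v^n`, `v̂^α = v^α / v^n`, `v̂^n = 1 / v^n`. -/
def type2Coord (v : Fin n → 𝕜) : Fin n → 𝕜 := fun α =>
  if α = 0 then -(1 / 2) * D.sqNorm v / v (Fin.rev 0)
  else if α = Fin.rev 0 then 1 / v (Fin.rev 0)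
  else v α / v (Fin.rev 0)

/-- `δ(α) = δ^1_α - δ^n_α`. -/
def delta (α : Fin n) : ℤ := (if α = 0 then 1 else 0) - (if α = Fin.rev 0 then 1 else 0)

/-- The index `α + (n-1) δ(α)`: the indices `1` and `n` are exchanged, the others are kept. -/
def flip (α : Fin n) : Fin n := Equiv.swap 0 (Fin.rev 0) α

/-- `D'` is obtained from `D` by the type-2 symmetry. -/
structure IsType2 (D' : FrobeniusData 𝕜 n) : Prop where
  dom : D'.dom = D.type2Coord '' D.dom
  potential : ∀ v ∈ D.dom, D'.F (D.type2Coord v) =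
    (v (Fin.rev 0) ^ 2)⁻¹ * (-D.F v + 1 / 2 * (v 0 * D.sqNorm v))
  unit : D'.unit = 0
  η : D'.η = D.η
  d : D'.d = 2 - D.d
  /-- `μ̂_1 = μ_n - 1`, `μ̂_n = μ_1 + 1`, and `μ̂_α = μ_α` otherwise -/
  μ : ∀ α, D'.μ α = D.μ (flip α) - delta α
  r : D'.r = 0
  θ_first_zero : ∀ v ∈ D.dom, D'.θ 0 0 (D.type2Coord v) = 1 / v (Fin.rev 0)
  θ_first : ∀ v ∈ D.dom, ∀ p, D'.θ 0 (p + 1) (D.type2Coord v) =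
    (-1) ^ (p + 1) * D.θ (Fin.rev 0) p v / v (Fin.rev 0)
  θ_last : ∀ v ∈ D.dom, ∀ p, D'.θ (Fin.rev 0) p (D.type2Coord v) =
    (-1) ^ (p + 1) * D.θ 0 (p + 1) v / v (Fin.rev 0)
  θ_other : ∀ v ∈ D.dom, ∀ α, α ≠ 0 → α ≠ Fin.rev 0 → ∀ p,
    D'.θ α p (D.type2Coord v) = (-1) ^ p * D.θ α p v / v (Fin.rev 0)
  R_zero : D'.R 0 = 0
  /-- `(R̂_k)^α_β = (-1)^{k+δ^α_n+δ^n_β} (R_{k+δ(α)-δ(β)})^{α+(n-1)δ(α)}_{β+(n-1)δ(β)}`,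
  where `R_l = 0` for `l ≤ 0` -/
  R : ∀ k : ℕ, 1 ≤ k → ∀ α β, D'.R k α β =
    (-1) ^ (k + (if α = Fin.rev 0 then 1 else 0) + (if β = Fin.rev 0 then 1 else 0)) *
      (if 0 < (k : ℤ) + delta α - delta β
        then D.R ((k : ℤ) + delta α - delta β).toNat (flip α) (flip β) else 0)

/-- The new times as a function of `(α,p)`: `t̂^{1,0} = x̂ = -∂ log τ/∂x`,
`t̂^{1,p} = (-1)^p t^{n,p-1}` for `p ≥ 1`, `t̂^{n,p} = (-1)^{p+1} t^{1,p+1}`, and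
`t̂^{α,p} = (-1)^p t^{α,p}` for `α ≠ 1, n`. -/
def type2TimeFun (logτ : Times 𝕜 n → 𝕜) (t : Times 𝕜 n) (i : Fin n × ℕ) : 𝕜 :=
  if i.1 = 0 then
    (if i.2 = 0 then -td (0, 0) logτ t else (-1) ^ i.2 * t (Fin.rev 0, i.2 - 1))
  else if i.1 = Fin.rev 0 then (-1) ^ (i.2 + 1) * t (0, i.2 + 1)
  else (-1) ^ i.2 * t i

theorem type2TimeFun_finite (logτ : Times 𝕜 n → 𝕜) (t : Times 𝕜 n) :
    (Function.support (type2TimeFun logτ t)).Finite := by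
  obtain ⟨N, hN⟩ : ∃ N : ℕ, ∀ i ∈ t.support, i.2 < N :=
    ⟨t.support.sup (fun i => i.2) + 1, fun i hi =>
      Nat.lt_succ_of_le (Finset.le_sup (f := fun i : Fin n × ℕ => i.2) hi)⟩
  have hz : ∀ (α : Fin n) (p : ℕ), N ≤ p → t (α, p) = 0 := by
    intro α p hp
    by_contra h
    exact absurd (hN (α, p) (Finsupp.mem_support_iff.2 h)) (not_lt.2 hp)
  refine Set.Finite.subset (Finset.finite_toSet (Finset.univ ×ˢ Finset.range (N + 1))) ?_
  rintro ⟨α, p⟩ h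
  by_contra hp
  have hp : N + 1 ≤ p := by simpa using hp
  apply h
  simp only [type2TimeFun]
  split_ifs with h1 h2 h3
  · omega
  · rw [hz _ _ (by omega), mul_zero]
  · rw [hz _ _ (by omega), mul_zero]
  · rw [hz _ _ (by omega), mul_zero]

/-- The new times `t̂ = t̂(t)` of the type-2 symmetry. -/
def type2Time (logτ : Times 𝕜 n → 𝕜) (t : Times 𝕜 n) : Times 𝕜 n :=
  Finsupp.ofSupportFinite (type2TimeFun logτ t) (type2TimeFun_finite logτ t)

end Type2

end FrobeniusData

end

/-! Both symmetries are changes of the flat coordinates, and every new equation is pulled back to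
the old coordinates. Openness of the image and smoothness on it come from the inverse function
theorem, so only a nonvanishing Jacobian matters.

Type 1. The Jacobian of v̂ is the matrix of multiplication by ∂_κ. The Hessian of the potential is
kept, so third derivatives acquire a single inverse Jacobian, and associativity of the new product
reduces to that of the old one. Flatness of θ gives ∂θ̂_{α,p}/∂v̂^β = ∂θ_{α,p}/∂v^β
(`IsType1.pd_θ`); hence everything built from gradients, Ω included, is unchanged, and the Virasoro
form sees only η, μ and R.

Type 2. The coordinate change is an inversion, conformal for η: its inverse Jacobian is v^n M with M
an η-orthogonal matrix (`inversionMatrix`, `transpose_mul_eta_mul`). Every new density is a quotient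
Φ_{α,p}/v^n, where Φ_{1,0} = 1 and any other Φ_i is ε_i θ_{σ(i)} for a sign ε_i and an involution σ
of the remaining indices (`type2Density`, `type2Index`). Derivatives of quotients φ/v^n are
therefore computed once (`pd_of_div`, `pd_pd_of_div`, `gradPair_of_div`, `eulerDeriv_of_div`) and
applied to the Φ_i and to the gradient of F̂. In Ω̂ the correction terms telescope, and
`twoPoint_eq` finds Ω̂_{ij} = Φ_iΦ_j/v^n − ε_iε_jΩ_{σ(i)σ(j)}.

This is the formula for the second derivatives of a Legendre transform in x, which is nondegenerate
since ∂²log τ/∂x² = v^n does not vanish. The first derivatives of log τ̂ at t̂ are −x and −ε_i ∂log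
τ/∂t^{σ(i)} (`td_zero_logτ`, `td_logτ`). For both types `IsTau.of_twoPoint` reduces the tau function
property to the second derivatives.

On the modes a_k the Legendre transformation is a signed permutation of components together with the
shift k ↦ k + δ(α) (`mode_eq`). The matrix R̂ is R conjugated by that permutation, with signs: the
normalization of θ_{1,1} kills exactly the entries of R that would land in nonpositive degree
(`intR_flip_eq_zero`). The change of μ compensates the shift of k in P_m (`virP_eq`), so the terms
of the two quadratic forms correspond one to one up to the factor (−1)^{m+1}. Since t̂^{n,0} =
−t^{1,1}, the shift of t^{1,1} by 1 becomes a shift of t̂^{n,0} by −1. -/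

noncomputable section

/-! ### Calculus of partial derivatives on open sets. -/

section PartialDerivatives

variable {𝕜 : Type*} [RCLike 𝕜] {n : ℕ} {f g : (Fin n → 𝕜) → 𝕜} {U : Set (Fin n → 𝕜)}
  {v : Fin n → 𝕜}

theorem ContDiffOn.differentiableAt_of_isOpen {E G : Type*} [NormedAddCommGroup E]
    [NormedSpace 𝕜 E] [NormedAddCommGroup G] [NormedSpace 𝕜 G] {f : E → G} {U : Set E} {v : E}
    (hf : ContDiffOn 𝕜 ∞ f U) (hU : IsOpen U) (hv : v ∈ U) : DifferentiableAt 𝕜 f v :=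
  (hf.contDiffAt (hU.mem_nhds hv)).differentiableAt (by simp)

theorem pd_eq_fderiv (hf : DifferentiableAt 𝕜 f v) (α : Fin n) :
    pd α f v = fderiv 𝕜 f v (Pi.single α 1) := hf.lineDeriv_eq_fderiv

theorem fderiv_eq_sum_pd (hf : DifferentiableAt 𝕜 f v) (w : Fin n → 𝕜) :
    fderiv 𝕜 f v w = ∑ α, w α * pd α f v := by
  conv_lhs => rw [pi_eq_sum_univ' w]
  rw [map_sum]
  refine Finset.sum_congr rfl fun α _ => ?_
  rw [map_smul, smul_eq_mul, pd_eq_fderiv hf]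

theorem lineDeriv_eq_sum_pd (hf : DifferentiableAt 𝕜 f v) (w : Fin n → 𝕜) :
    lineDeriv 𝕜 f v w = ∑ α, w α * pd α f v := by
  rw [hf.lineDeriv_eq_fderiv, fderiv_eq_sum_pd hf]

/-- A line derivative depends only on the germ. The equations of a Frobenius structure hold on its
domain alone, so differentiating them passes through this lemma or its analogues for ∂_E and for the
times. -/
theorem pd_congr (hU : IsOpen U) (h : ∀ w ∈ U, f w = g w) (hv : v ∈ U) (α : Fin n) :
    pd α f v = pd α g v :=
  Filter.EventuallyEq.lineDeriv_eq (Filter.eventuallyEq_of_mem (hU.mem_nhds hv) h)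

theorem ContDiffOn.pd (hf : ContDiffOn 𝕜 ∞ f U) (hU : IsOpen U) (α : Fin n) :
    ContDiffOn 𝕜 ∞ (pd α f) U := by
  have h : ContDiffOn 𝕜 ∞ (fun w => fderiv 𝕜 f w (Pi.single α 1)) U :=
    (hf.fderiv_of_isOpen hU (by simp)).clm_apply contDiffOn_const
  exact h.congr fun w hw => pd_eq_fderiv (hf.differentiableAt_of_isOpen hU hw) α

theorem pd_comm (hf : ContDiffOn 𝕜 ∞ f U) (hU : IsOpen U) (hv : v ∈ U) (α β : Fin n) :
    pd α (pd β f) v = pd β (pd α f) v := by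
  have hd : DifferentiableAt 𝕜 (fderiv 𝕜 f) v :=
    (hf.fderiv_of_isOpen hU (m := ∞) (by simp)).differentiableAt_of_isOpen hU hv
  have key : ∀ α β : Fin n, pd α (pd β f) v =
      fderiv 𝕜 (fderiv 𝕜 f) v (Pi.single α 1) (Pi.single β 1) := by
    intro α β
    rw [pd_congr hU (fun w hw => pd_eq_fderiv (hf.differentiableAt_of_isOpen hU hw) β) hv,
      pd_eq_fderiv (by fun_prop), fderiv_clm_apply hd (by fun_prop)]
    simp
  rw [key, key]
  have hs : IsSymmSndFDerivAt 𝕜 f v :=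
    (hf.contDiffAt (hU.mem_nhds hv)).isSymmSndFDerivAt
      (by rw [minSmoothness_of_isRCLikeNormedField]; exact ENat.LEInfty.out)
  exact hs _ _

theorem pd_const (c : 𝕜) (α : Fin n) : pd α (fun _ => c) v = 0 := by
  rw [pd_eq_fderiv (by fun_prop)]; simp

theorem pd_coord (α β : Fin n) : pd α (fun w : Fin n → 𝕜 => w β) v = if α = β then 1 else 0 := by
  rw [pd_eq_fderiv (by fun_prop),
    show (fun w : Fin n → 𝕜 => w β) = ContinuousLinearMap.proj (R := 𝕜) β from rfl,
    ContinuousLinearMap.fderiv]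
  simp [Pi.single_apply, eq_comm]

theorem pd_add (hf : DifferentiableAt 𝕜 f v) (hg : DifferentiableAt 𝕜 g v) (α : Fin n) :
    pd α (fun w => f w + g w) v = pd α f v + pd α g v := by
  rw [pd_eq_fderiv (by fun_prop), pd_eq_fderiv hf, pd_eq_fderiv hg, fderiv_fun_add hf hg]
  simp

theorem pd_sub (hf : DifferentiableAt 𝕜 f v) (hg : DifferentiableAt 𝕜 g v) (α : Fin n) :
    pd α (fun w => f w - g w) v = pd α f v - pd α g v := by
  rw [pd_eq_fderiv (by fun_prop), pd_eq_fderiv hf, pd_eq_fderiv hg, fderiv_fun_sub hf hg]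
  simp

theorem pd_neg (hf : DifferentiableAt 𝕜 f v) (α : Fin n) :
    pd α (fun w => -f w) v = -pd α f v := by
  rw [pd_eq_fderiv (by fun_prop), pd_eq_fderiv hf, fderiv_fun_neg]
  simp

theorem pd_mul (hf : DifferentiableAt 𝕜 f v) (hg : DifferentiableAt 𝕜 g v) (α : Fin n) :
    pd α (fun w => f w * g w) v = pd α f v * g v + f v * pd α g v := by
  rw [pd_eq_fderiv (by fun_prop), pd_eq_fderiv hf, pd_eq_fderiv hg, fderiv_fun_mul hf hg]
  simp; ring

theorem pd_const_mul (c : 𝕜) (hf : DifferentiableAt 𝕜 f v) (α : Fin n) :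
    pd α (fun w => c * f w) v = c * pd α f v := by
  rw [pd_mul (by fun_prop) hf, pd_const]; ring

theorem pd_inv (hf : DifferentiableAt 𝕜 f v) (h0 : f v ≠ 0) (α : Fin n) :
    pd α (fun w => (f w)⁻¹) v = -pd α f v / f v ^ 2 := by
  have h := ((hasDerivAt_inv h0).comp_hasFDerivAt v hf.hasFDerivAt).hasLineDerivAt (Pi.single α 1)
  rw [pd_eq_fderiv hf]
  refine h.lineDeriv.trans ?_
  simp [div_eq_mul_inv, mul_comm]

theorem pd_div (hf : DifferentiableAt 𝕜 f v) (hg : DifferentiableAt 𝕜 g v) (h0 : g v ≠ 0)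
    (α : Fin n) :
    pd α (fun w => f w / g w) v = (pd α f v * g v - f v * pd α g v) / g v ^ 2 := by
  simp only [div_eq_mul_inv]
  rw [pd_mul (g := fun w => (g w)⁻¹) hf (hg.inv h0), pd_inv hg h0]
  field_simp
  ring

theorem pd_sum {ι : Type*} (s : Finset ι) {f : ι → (Fin n → 𝕜) → 𝕜}
    (hf : ∀ i ∈ s, DifferentiableAt 𝕜 (f i) v) (α : Fin n) :
    pd α (fun w => ∑ i ∈ s, f i w) v = ∑ i ∈ s, pd α (f i) v := by
  rw [pd_eq_fderiv (DifferentiableAt.fun_sum hf), fderiv_fun_sum hf]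
  simp only [FunLike.coe_sum, Finset.sum_apply]
  exact Finset.sum_congr rfl fun i hi => (pd_eq_fderiv (hf i hi) α).symm

/-- On a connected open set a function with vanishing partial derivatives is constant. -/
theorem exists_eq_const_of_pd_eq_zero (hU : IsOpen U) (hc : IsPreconnected U)
    (hf : ContDiffOn 𝕜 ∞ f U) (h : ∀ v ∈ U, ∀ α, pd α f v = 0) : ∃ c, ∀ v ∈ U, f v = c := by
  refine hU.exists_is_const_of_fderiv_eq_zero hc (hf.differentiableOn (by simp)) fun v hv => ?_
  ext w
  rw [fderiv_eq_sum_pd (hf.differentiableAt_of_isOpen hU hv)]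
  simp [h v hv]

theorem pd_linear (B : Fin n → 𝕜) (γ : Fin n) : pd γ (fun w => ∑ α, B α * w α) v = B γ := by
  rw [pd_sum _ fun α _ => by fun_prop, Finset.sum_congr rfl fun α _ =>
    (pd_const_mul (B α) (f := fun w : Fin n → 𝕜 => w α) (by fun_prop) γ).trans
      (by rw [pd_coord])]
  simp

theorem pd_quadratic (A : Matrix (Fin n) (Fin n) 𝕜) (γ : Fin n) :
    pd γ (fun w => ∑ α, ∑ β, A α β * w α * w β) v = ∑ β, (A γ β + A β γ) * v β := by
  have h : ∀ α, pd γ (fun w : Fin n → 𝕜 => w α * ∑ β, A α β * w β) v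
      = (if γ = α then 1 else 0) * ∑ β, A α β * v β + v α * A α γ := fun α => by
    rw [pd_mul (f := fun w : Fin n → 𝕜 => w α) (by fun_prop) (by fun_prop), pd_coord, pd_linear]
  have e : (fun w : Fin n → 𝕜 => ∑ α, ∑ β, A α β * w α * w β)
      = fun w => ∑ α, w α * ∑ β, A α β * w β := by
    ext w
    refine Finset.sum_congr rfl fun α _ => ?_
    rw [Finset.mul_sum]
    exact Finset.sum_congr rfl fun β _ => by ring
  rw [e, pd_sum _ fun α _ => by fun_prop, Finset.sum_congr rfl fun α _ => h α]
  simp [Finset.sum_add_distrib, mul_add, mul_comm]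

/-- A function with constant Hessian is a quadratic polynomial. -/
theorem exists_quadratic_of_hessian_const (hU : IsOpen U) (hc : IsPreconnected U)
    (hf : ContDiffOn 𝕜 ∞ f U) (A : Matrix (Fin n) (Fin n) 𝕜) (hA : A.IsSymm)
    (h : ∀ v ∈ U, ∀ α β, pd α (pd β f) v = A α β) :
    ∃ (B : Fin n → 𝕜) (C : 𝕜), ∀ v ∈ U,
      f v = 1 / 2 * ∑ α, ∑ β, A α β * v α * v β + ∑ α, B α * v α + C := by
  -- First integration: ∂_β f minus the linear function with the same gradient is constant. The
  -- second integration does the same for f minus the candidate polynomial.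
  have h1 : ∀ β, ∃ b, ∀ v ∈ U, pd β f v - ∑ γ, A γ β * v γ = b := by
    intro β
    refine exists_eq_const_of_pd_eq_zero hU hc
      ((hf.pd hU β).sub (by fun_prop)) fun v hv α => ?_
    have := (hf.pd hU β).differentiableAt_of_isOpen hU hv
    rw [pd_sub this (by fun_prop), h v hv, pd_linear, sub_self]
  choose B hB using h1
  obtain ⟨C, hC⟩ := exists_eq_const_of_pd_eq_zero (f := fun v => f v -
    (1 / 2 * ∑ α, ∑ β, A α β * v α * v β + ∑ α, B α * v α)) hU hc
      (hf.sub (by fun_prop)) (by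
    intro v hv γ
    have := hf.differentiableAt_of_isOpen hU hv
    rw [pd_sub this (by fun_prop), pd_add (by fun_prop) (by fun_prop),
      pd_const_mul _ (by fun_prop), pd_quadratic, pd_linear]
    have hb := hB γ v hv
    have e : ∀ β, A γ β = A β γ := fun β => (hA.apply γ β).symm
    simp only [e, ← two_mul, mul_assoc, ← Finset.mul_sum]
    linear_combination hb)
  refine ⟨B, C, fun v hv => ?_⟩
  have := hC v hv
  linear_combination this

/-! ### Changes of coordinates and the inverse function theorem. -/

/-- If `g ∘ Φ` is smooth and `Φ` is a local diffeomorphism, then `g` is smooth. -/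
theorem contDiffAt_of_comp_of_equiv {E E' G : Type*} [NormedAddCommGroup E] [NormedSpace 𝕜 E]
    [CompleteSpace E] [NormedAddCommGroup E'] [NormedSpace 𝕜 E'] [NormedAddCommGroup G]
    [NormedSpace 𝕜 G] {Φ : E → E'} {g : E' → G} {a : E} {Φ' : E ≃L[𝕜] E'}
    (hΦ : ContDiffAt 𝕜 ∞ Φ a) (h' : HasFDerivAt Φ (Φ' : E →L[𝕜] E') a)
    (hg : ContDiffAt 𝕜 ∞ (fun x => g (Φ x)) a) : ContDiffAt 𝕜 ∞ g (Φ a) := by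
  have hn : (∞ : WithTop ℕ∞) ≠ 0 := by simp
  have hs := hΦ.hasStrictFDerivAt' h' hn
  have hψ := hΦ.to_localInverse h' hn
  have ha := hΦ.localInverse_apply_image h' hn
  -- Near Φ a the function g is (g ∘ Φ) composed with the local inverse of Φ.
  have hc : ContDiffAt 𝕜 ∞ (fun y => g (Φ (hΦ.localInverse h' hn y))) (Φ a) :=
    ContDiffAt.comp (g := fun x => g (Φ x)) (Φ a) (by rw [ha]; exact hg) hψ
  refine hc.congr_of_eventuallyEq ?_
  filter_upwards [hs.eventually_right_inverse] with y hy
  exact congrArg g hy.symm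

theorem image_mem_nhds_of_equiv {E E' : Type*} [NormedAddCommGroup E] [NormedSpace 𝕜 E]
    [CompleteSpace E] [NormedAddCommGroup E'] [NormedSpace 𝕜 E'] {Φ : E → E'} {a : E}
    {Φ' : E ≃L[𝕜] E'} (hΦ : ContDiffAt 𝕜 ∞ Φ a) (h' : HasFDerivAt Φ (Φ' : E →L[𝕜] E') a)
    {U : Set E} (hU : U ∈ nhds a) : Φ '' U ∈ nhds (Φ a) := by
  have hs := hΦ.hasStrictFDerivAt' h' (by simp)
  rw [← hs.map_nhds_eq_of_equiv]
  exact Filter.image_mem_map hU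

/-- The Jacobian matrix `∂Φ^α/∂v^β`. -/
def jacobian (Φ : (Fin n → 𝕜) → Fin n → 𝕜) (v : Fin n → 𝕜) : Matrix (Fin n) (Fin n) 𝕜 :=
  Matrix.of fun α β => pd β (fun w => Φ w α) v

/-- `Φ` is a smooth change of coordinates on the open set `U`. -/
structure IsCoordChange (Φ : (Fin n → 𝕜) → Fin n → 𝕜) (U : Set (Fin n → 𝕜)) : Prop where
  isOpen : IsOpen U
  smooth : ContDiffOn 𝕜 ∞ Φ U
  det_ne_zero : ∀ v ∈ U, (jacobian Φ v).det ≠ 0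

namespace IsCoordChange

variable {Φ : (Fin n → 𝕜) → Fin n → 𝕜}

theorem contDiffOn_coord (h : IsCoordChange Φ U) (α : Fin n) :
    ContDiffOn 𝕜 ∞ (fun w => Φ w α) U := contDiffOn_pi.1 h.smooth α

theorem fderiv_eq_sum_jacobian (h : IsCoordChange Φ U) (hv : v ∈ U) (w : Fin n → 𝕜) (α : Fin n) :
    fderiv 𝕜 Φ v w α = ∑ β, w β * jacobian Φ v α β := by
  have hd := h.smooth.differentiableAt_of_isOpen h.isOpen hv
  have h2 := (h.contDiffOn_coord α).differentiableAt_of_isOpen h.isOpen hv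
  simp only [jacobian, Matrix.of_apply]
  rw [← fderiv_eq_sum_pd h2, fderiv_apply hd α]
  rfl

/-- A nonzero determinant makes the derivative injective, hence an isomorphism in finite dimension.
-/
theorem exists_equiv (h : IsCoordChange Φ U) (hv : v ∈ U) :
    ∃ Φ' : (Fin n → 𝕜) ≃L[𝕜] (Fin n → 𝕜), HasFDerivAt Φ (Φ' : (Fin n → 𝕜) →L[𝕜] _) v := by
  have hd := h.smooth.differentiableAt_of_isOpen h.isOpen hv
  have hi : Function.Injective (fderiv 𝕜 Φ v : (Fin n → 𝕜) →ₗ[𝕜] (Fin n → 𝕜)) := by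
    rw [← LinearMap.ker_eq_bot, LinearMap.ker_eq_bot']
    intro w hw
    refine Matrix.eq_zero_of_mulVec_eq_zero (h.det_ne_zero v hv) ?_
    ext α
    rw [Matrix.mulVec, dotProduct]
    simp_rw [mul_comm (jacobian Φ v α _)]
    rw [← h.fderiv_eq_sum_jacobian hv]
    exact congrFun hw α
  refine ⟨(LinearEquiv.ofInjectiveEndo _ hi).toContinuousLinearEquiv, ?_⟩
  exact hd.hasFDerivAt.congr_fderiv (by ext; rfl)

theorem isOpen_image (h : IsCoordChange Φ U) : IsOpen (Φ '' U) := by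
  rw [isOpen_iff_mem_nhds]
  rintro _ ⟨v, hv, rfl⟩
  obtain ⟨Φ', hΦ'⟩ := h.exists_equiv hv
  exact image_mem_nhds_of_equiv (h.smooth.contDiffAt (h.isOpen.mem_nhds hv)) hΦ'
    (h.isOpen.mem_nhds hv)

/-- Smoothness at Φ v is tested at the one preimage v through a local inverse, so local
invertibility is enough. -/
theorem contDiffOn_image (h : IsCoordChange Φ U)
    (hf : ContDiffOn 𝕜 ∞ (fun w => f (Φ w)) U) : ContDiffOn 𝕜 ∞ f (Φ '' U) := by
  rintro _ ⟨v, hv, rfl⟩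
  obtain ⟨Φ', hΦ'⟩ := h.exists_equiv hv
  exact (contDiffAt_of_comp_of_equiv (h.smooth.contDiffAt (h.isOpen.mem_nhds hv)) hΦ'
    (hf.contDiffAt (h.isOpen.mem_nhds hv))).contDiffWithinAt

theorem isConnected_image (h : IsCoordChange Φ U) (hc : IsConnected U) : IsConnected (Φ '' U) :=
  hc.image _ h.smooth.continuousOn

/-- The chain rule. -/
theorem pd_comp (h : IsCoordChange Φ U) (hf : ContDiffOn 𝕜 ∞ f (Φ '' U)) (hv : v ∈ U)
    (β : Fin n) :
    pd β (fun w => f (Φ w)) v = ∑ α, jacobian Φ v α β * pd α f (Φ v) := by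
  have hd := h.smooth.differentiableAt_of_isOpen h.isOpen hv
  have hf' := hf.differentiableAt_of_isOpen h.isOpen_image (Set.mem_image_of_mem _ hv)
  have hc : DifferentiableAt 𝕜 (fun w => f (Φ w)) v := DifferentiableAt.comp v hf' hd
  rw [pd_eq_fderiv hc]
  rw [show (fun w => f (Φ w)) = f ∘ Φ from rfl, fderiv_comp v hf' hd,
    ContinuousLinearMap.comp_apply, fderiv_eq_sum_pd hf']
  refine Finset.sum_congr rfl fun α _ => ?_
  rw [h.fderiv_eq_sum_jacobian hv]
  simp [Pi.single_apply]

/-- The chain rule, solved for the derivatives in the new coordinates. -/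
theorem pd_image (h : IsCoordChange Φ U) (hf : ContDiffOn 𝕜 ∞ f (Φ '' U)) (hv : v ∈ U)
    {J : Matrix (Fin n) (Fin n) 𝕜} (hJ : jacobian Φ v * J = 1) (α : Fin n) :
    pd α f (Φ v) = ∑ β, J β α * pd β (fun w => f (Φ w)) v := by
  simp_rw [h.pd_comp hf hv, Finset.mul_sum]
  rw [Finset.sum_comm]
  have : ∀ γ, ∑ β, J β α * (jacobian Φ v γ β * pd γ f (Φ v))
      = (1 : Matrix (Fin n) (Fin n) 𝕜) γ α * pd γ f (Φ v) := by
    intro γ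
    rw [← hJ, Matrix.mul_apply, Finset.sum_mul]
    exact Finset.sum_congr rfl fun β _ => by ring
  simp_rw [this]
  simp [Matrix.one_apply]

/-- The chain rule for a vector field. -/
theorem lineDeriv_image (h : IsCoordChange Φ U) (hf : ContDiffOn 𝕜 ∞ f (Φ '' U)) (hv : v ∈ U)
    {e e' : Fin n → 𝕜} (he : ∀ α, e' α = lineDeriv 𝕜 (fun w => Φ w α) v e) :
    lineDeriv 𝕜 f (Φ v) e' = lineDeriv 𝕜 (fun w => f (Φ w)) v e := by
  have hd := h.smooth.differentiableAt_of_isOpen h.isOpen hv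
  have hf' := hf.differentiableAt_of_isOpen h.isOpen_image (Set.mem_image_of_mem _ hv)
  have hc : DifferentiableAt 𝕜 (fun w => f (Φ w)) v := DifferentiableAt.comp v hf' hd
  rw [lineDeriv_eq_sum_pd hf', lineDeriv_eq_sum_pd hc]
  simp_rw [h.pd_comp hf hv, he, Finset.mul_sum]
  rw [Finset.sum_comm]
  refine Finset.sum_congr rfl fun α _ => ?_
  rw [lineDeriv_eq_sum_pd ((h.contDiffOn_coord α).differentiableAt_of_isOpen h.isOpen hv),
    Finset.sum_mul]
  exact Finset.sum_congr rfl fun β _ => by simp [jacobian]; ring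

end IsCoordChange

end PartialDerivatives

/-! ### The Euler vector field and first consequences of the WDVV equations. -/

namespace FrobeniusData

variable {𝕜 : Type*} [RCLike 𝕜] {n : ℕ} {D : FrobeniusData 𝕜 n} {v : Fin n → 𝕜}
  {f g : (Fin n → 𝕜) → 𝕜} {U : Set (Fin n → 𝕜)}

theorem eulerDeriv_eq_sum (hf : DifferentiableAt 𝕜 f v) :
    D.eulerDeriv f v = ∑ γ, D.euler v γ * pd γ f v := lineDeriv_eq_sum_pd hf _

theorem eulerDeriv_congr (hU : IsOpen U) (h : ∀ w ∈ U, f w = g w) (hv : v ∈ U) :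
    D.eulerDeriv f v = D.eulerDeriv g v :=
  Filter.EventuallyEq.lineDeriv_eq (Filter.eventuallyEq_of_mem (hU.mem_nhds hv) h)

theorem eulerDeriv_const (c : 𝕜) : D.eulerDeriv (fun _ => c) v = 0 := by
  rw [eulerDeriv_eq_sum (by fun_prop)]
  simp [pd_const]

theorem eulerDeriv_coord (α : Fin n) :
    D.eulerDeriv (fun w => w α) v = (1 - D.d / 2 - D.μ α) * v α + D.r α := by
  rw [eulerDeriv_eq_sum (by fun_prop)]
  simp [pd_coord, euler]

theorem eulerDeriv_add (hf : DifferentiableAt 𝕜 f v) (hg : DifferentiableAt 𝕜 g v) :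
    D.eulerDeriv (fun w => f w + g w) v = D.eulerDeriv f v + D.eulerDeriv g v := by
  rw [eulerDeriv_eq_sum (by fun_prop), eulerDeriv_eq_sum hf, eulerDeriv_eq_sum hg,
    ← Finset.sum_add_distrib]
  exact Finset.sum_congr rfl fun γ _ => by rw [pd_add hf hg]; ring

theorem eulerDeriv_mul (hf : DifferentiableAt 𝕜 f v) (hg : DifferentiableAt 𝕜 g v) :
    D.eulerDeriv (fun w => f w * g w) v = D.eulerDeriv f v * g v + f v * D.eulerDeriv g v := by
  rw [eulerDeriv_eq_sum (by fun_prop), eulerDeriv_eq_sum hf, eulerDeriv_eq_sum hg,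
    Finset.sum_mul, Finset.mul_sum, ← Finset.sum_add_distrib]
  exact Finset.sum_congr rfl fun γ _ => by rw [pd_mul hf hg]; ring

theorem eulerDeriv_const_mul (c : 𝕜) (hf : DifferentiableAt 𝕜 f v) :
    D.eulerDeriv (fun w => c * f w) v = c * D.eulerDeriv f v := by
  rw [eulerDeriv_mul (by fun_prop) hf, eulerDeriv_const]; ring

theorem eulerDeriv_sum {ι : Type*} (s : Finset ι) {f : ι → (Fin n → 𝕜) → 𝕜}
    (hf : ∀ i ∈ s, DifferentiableAt 𝕜 (f i) v) :
    D.eulerDeriv (fun w => ∑ i ∈ s, f i w) v = ∑ i ∈ s, D.eulerDeriv (f i) v := by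
  rw [eulerDeriv_eq_sum (DifferentiableAt.fun_sum hf),
    Finset.sum_congr rfl fun i hi => eulerDeriv_eq_sum (hf i hi), Finset.sum_comm]
  exact Finset.sum_congr rfl fun γ _ => by rw [pd_sum s hf, Finset.mul_sum]

theorem eulerDeriv_inv (hf : DifferentiableAt 𝕜 f v) (h0 : f v ≠ 0) :
    D.eulerDeriv (fun w => (f w)⁻¹) v = -D.eulerDeriv f v / f v ^ 2 := by
  rw [eulerDeriv_eq_sum (f := fun w => (f w)⁻¹) (hf.inv h0), eulerDeriv_eq_sum hf, ← Finset.sum_neg_distrib,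
    Finset.sum_div]
  exact Finset.sum_congr rfl fun γ _ => by rw [pd_inv hf h0]; ring

theorem contDiffOn_eulerDeriv (hU : IsOpen U) (hf : ContDiffOn 𝕜 ∞ f U) :
    ContDiffOn 𝕜 ∞ (D.eulerDeriv f) U := by
  have h : ContDiffOn 𝕜 ∞ (fun w => ∑ γ, D.euler w γ * pd γ f w) U := by
    refine ContDiffOn.sum fun γ _ => ContDiffOn.mul ?_ (hf.pd hU γ)
    unfold euler
    fun_prop
  exact h.congr fun w hw => eulerDeriv_eq_sum (hf.differentiableAt_of_isOpen hU hw)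

/-- The commutator of `∂_α` and `∂_E`. -/
theorem pd_eulerDeriv (hU : IsOpen U) (hf : ContDiffOn 𝕜 ∞ f U) (hv : v ∈ U) (α : Fin n) :
    pd α (D.eulerDeriv f) v
      = D.eulerDeriv (pd α f) v + (1 - D.d / 2 - D.μ α) * pd α f v := by
  have hd := fun γ => (hf.pd hU γ).differentiableAt_of_isOpen hU hv
  have he : ∀ γ, DifferentiableAt 𝕜 (fun w => D.euler w γ) v := fun γ => by
    unfold euler; fun_prop
  have hp : ∀ γ, pd α (fun w => D.euler w γ) v
      = if α = γ then (1 - D.d / 2 - D.μ γ) else 0 := fun γ => by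
    unfold euler
    rw [pd_add (by fun_prop) (by fun_prop), pd_const, pd_const_mul _ (by fun_prop), pd_coord]
    simp
  rw [pd_congr hU (fun w hw => eulerDeriv_eq_sum (hf.differentiableAt_of_isOpen hU hw)) hv,
    pd_sum _ (f := fun γ w => D.euler w γ * pd γ f w) fun γ _ => (he γ).mul (hd γ), eulerDeriv_eq_sum (hd α),
    Finset.sum_congr rfl fun γ _ => pd_mul (he γ) (hd γ) α, Finset.sum_add_distrib, add_comm]
  congr 1
  · exact Finset.sum_congr rfl fun γ _ => by rw [pd_comm hf hU hv]
  · simp_rw [hp]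
    simp

namespace IsWDVV

variable (h : D.IsWDVV)
include h

theorem isUnit_det : IsUnit D.η.det := h.nondegenerate.isUnit

theorem eta_mul_inv : D.η * D.η⁻¹ = 1 := Matrix.mul_nonsing_inv _ h.isUnit_det

theorem inv_mul_eta : D.η⁻¹ * D.η = 1 := Matrix.nonsing_inv_mul _ h.isUnit_det

theorem contDiffOn_pd (α : Fin n) : ContDiffOn 𝕜 ∞ (pd α D.F) D.dom := h.smooth.pd h.isOpen α

theorem contDiffOn_pd₂ (α β : Fin n) : ContDiffOn 𝕜 ∞ (pd α (pd β D.F)) D.dom :=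
  (h.contDiffOn_pd β).pd h.isOpen α

theorem pd_swap (hv : v ∈ D.dom) (α β : Fin n) : pd α (pd β D.F) v = pd β (pd α D.F) v :=
  pd_comm h.smooth h.isOpen hv α β

theorem pd₃_swap_left (hv : v ∈ D.dom) (α β γ : Fin n) :
    pd α (pd β (pd γ D.F)) v = pd β (pd α (pd γ D.F)) v :=
  pd_comm (h.contDiffOn_pd γ) h.isOpen hv α β

theorem pd₃_swap_right (hv : v ∈ D.dom) (α β γ : Fin n) :
    pd α (pd β (pd γ D.F)) v = pd α (pd γ (pd β D.F)) v :=
  pd_congr h.isOpen (fun _ hw => h.pd_swap hw β γ) hv α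

theorem eta_transpose : D.ηᵀ = D.η := by
  obtain ⟨v, hv⟩ := h.isConnected.nonempty
  ext α β
  rw [Matrix.transpose_apply, ← h.metric v hv, ← h.metric v hv, h.pd₃_swap_right hv]

theorem inv_symm (α β : Fin n) : D.η⁻¹ α β = D.η⁻¹ β α := by
  have := congrArg (fun M => M⁻¹) h.eta_transpose
  simp only [← Matrix.transpose_nonsing_inv] at this
  exact congrFun (congrFun this β) α

theorem c_swap (hv : v ∈ D.dom) (α β γ : Fin n) : D.c α β γ v = D.c α γ β v :=
  Finset.sum_congr rfl fun ν _ => by rw [h.pd₃_swap_right hv]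

theorem c_unit (hv : v ∈ D.dom) (α β : Fin n) :
    D.c α D.unit β v = if α = β then 1 else 0 := by
  have : D.c α D.unit β v = (D.η⁻¹ * D.η) α β := by
    rw [Matrix.mul_apply]
    exact Finset.sum_congr rfl fun ν _ => by
      rw [h.pd₃_swap_left hv, h.metric v hv]
  rw [this, h.inv_mul_eta, Matrix.one_apply]

variable {A : Matrix (Fin n) (Fin n) 𝕜} {B : Fin n → 𝕜} {C : 𝕜}

/-- Apply ∂_α to the quasi-homogeneity of F; the commutator of ∂_α with ∂_E shifts the weight, and
the symmetry of A merges the two halves of the quadratic term. -/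
theorem eulerDeriv_pd (hq : D.IsQuasiHomogeneous A B C) (hv : v ∈ D.dom) (α : Fin n) :
    D.eulerDeriv (pd α D.F) v
      = (2 - D.d / 2 + D.μ α) * pd α D.F v + ∑ β, A α β * v β + B α := by
  have h1 := pd_eulerDeriv (D := D) h.isOpen h.smooth hv α
  have hd := h.smooth.differentiableAt_of_isOpen h.isOpen hv
  rw [pd_congr h.isOpen hq.2 hv, pd_add (by fun_prop) (by fun_prop),
    pd_add (by fun_prop) (by fun_prop), pd_add (by fun_prop) (by fun_prop), pd_const,
    pd_const_mul _ hd, pd_const_mul _ (by fun_prop), pd_quadratic, pd_linear] at h1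
  have e : ∀ β, A β α = A α β := fun β => hq.1.apply α β
  simp only [e, ← two_mul, mul_assoc, ← Finset.mul_sum] at h1
  linear_combination -h1

theorem eulerDeriv_pd₂ (hq : D.IsQuasiHomogeneous A B C) (hv : v ∈ D.dom) (α β : Fin n) :
    D.eulerDeriv (pd α (pd β D.F)) v
      = (1 + D.μ α + D.μ β) * pd α (pd β D.F) v + A α β := by
  have h1 := pd_eulerDeriv (D := D) h.isOpen (h.contDiffOn_pd β) hv α
  have hd := (h.contDiffOn_pd β).differentiableAt_of_isOpen h.isOpen hv
  rw [pd_congr h.isOpen (fun w hw => h.eulerDeriv_pd hq hw β) hv,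
    pd_add (by fun_prop) (by fun_prop), pd_add (by fun_prop) (by fun_prop), pd_const,
    pd_const_mul _ hd, pd_linear, hq.1.apply α β] at h1
  linear_combination -h1

/-- The unit derivative of ∂_α∂_βF is the constant η_{αβ}, which ∂_E annihilates. Differentiating
the quasi-homogeneity of the Hessian along the unit, with μ_unit = −d/2, leaves exactly this. -/
theorem mu_add_mul_eta (α β : Fin n) : (D.μ α + D.μ β) * D.η α β = 0 := by
  obtain ⟨A, B, C, hq⟩ := h.quasi
  obtain ⟨v, hv⟩ := h.isConnected.nonempty
  have h1 := pd_eulerDeriv (D := D) h.isOpen (h.contDiffOn_pd₂ α β) hv D.unit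
  have hd := (h.contDiffOn_pd₂ α β).differentiableAt_of_isOpen h.isOpen hv
  rw [pd_congr h.isOpen (fun w hw => h.eulerDeriv_pd₂ hq hw α β) hv,
    pd_add (by fun_prop) (by fun_prop), pd_const, pd_const_mul _ hd,
    eulerDeriv_congr h.isOpen (fun w hw => h.metric w hw α β) hv, eulerDeriv_const,
    h.metric v hv, h.charge] at h1
  linear_combination h1

/-- The matrices diag(μ) and η anticommute; multiplying by η⁻¹ on both sides transfers this to η⁻¹.
-/
theorem mu_add_mul_inv (α β : Fin n) : (D.μ α + D.μ β) * D.η⁻¹ α β = 0 := by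
  have h1 : Matrix.diagonal D.μ * D.η + D.η * Matrix.diagonal D.μ = 0 := by
    ext α β
    rw [Matrix.add_apply, Matrix.diagonal_mul, Matrix.mul_diagonal, Matrix.zero_apply]
    linear_combination h.mu_add_mul_eta α β
  have h2 : D.η⁻¹ * Matrix.diagonal D.μ + Matrix.diagonal D.μ * D.η⁻¹ = 0 := by
    have := congrArg (fun M => D.η⁻¹ * M * D.η⁻¹) h1
    simp only [mul_add, add_mul, mul_zero, zero_mul] at this
    rwa [mul_assoc, mul_assoc, h.eta_mul_inv, mul_one, ← mul_assoc D.η⁻¹ D.η,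
      h.inv_mul_eta, one_mul] at this
  have := congrFun (congrFun h2 α) β
  rw [Matrix.add_apply, Matrix.diagonal_mul, Matrix.mul_diagonal, Matrix.zero_apply] at this
  linear_combination this

end IsWDVV

end FrobeniusData

/-! ### Type 1: WDVV equations, calibration and two-point functions. -/

namespace FrobeniusData

variable {𝕜 : Type*} [RCLike 𝕜] {n : ℕ} {D D' : FrobeniusData 𝕜 n} {v : Fin n → 𝕜}

theorem IsCalibration.contDiffOn_pd (hF : D.IsWDVV) (hθ : D.IsCalibration) (α β : Fin n) (p : ℕ) :
    ContDiffOn 𝕜 ∞ (pd β (D.θ α p)) D.dom := (hθ.smooth α p).pd hF.isOpen β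

namespace IsType1

variable {κ : Fin n} (h : D.IsType1 κ D') (hF : D.IsWDVV)
include h hF

omit h in
-- This is the matrix of multiplication by ∂_κ, which is why invertibility of that multiplication is
-- the right hypothesis.
theorem jacobian_eq (hv : v ∈ D.dom) :
    jacobian (D.type1Coord κ) v = Matrix.of fun α β => D.c α β κ v := by
  ext α β
  have hd := fun γ => (hF.contDiffOn_pd₂ γ κ).differentiableAt_of_isOpen hF.isOpen hv
  simp only [jacobian, type1Coord, c, Matrix.of_apply]
  rw [pd_sum _ (f := fun γ w => D.η⁻¹ α γ * pd γ (pd κ D.F) w)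
    fun γ _ => (hd γ).const_mul (D.η⁻¹ α γ)]
  exact Finset.sum_congr rfl fun γ _ => by rw [pd_const_mul _ (hd γ), hF.pd₃_swap_left hv]

theorem isCoordChange : IsCoordChange (D.type1Coord κ) D.dom where
  isOpen := hF.isOpen
  smooth := contDiffOn_pi.2 fun α => ContDiffOn.sum fun γ _ =>
    contDiffOn_const.mul (hF.contDiffOn_pd₂ γ κ)
  det_ne_zero := fun v hv => by
    rw [jacobian_eq hF hv]
    exact h.invertible v hv

theorem isOpen_dom : IsOpen D'.dom := by
  rw [h.dom]
  exact (h.isCoordChange hF).isOpen_image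

omit hF in
theorem mem_dom (hv : v ∈ D.dom) : D.type1Coord κ v ∈ D'.dom := by
  rw [h.dom]
  exact Set.mem_image_of_mem _ hv

theorem isUnit_jacobian (hv : v ∈ D.dom) : IsUnit (jacobian (D.type1Coord κ) v).det :=
  ((h.isCoordChange hF).det_ne_zero v hv).isUnit

theorem pd_coord_eq {f f' : (Fin n → 𝕜) → 𝕜} (hf : ContDiffOn 𝕜 ∞ f' D'.dom)
    (e : ∀ w ∈ D.dom, f' (D.type1Coord κ w) = f w) (hv : v ∈ D.dom) (α : Fin n) :
    pd α f' (D.type1Coord κ v) = ∑ β, (jacobian (D.type1Coord κ) v)⁻¹ β α * pd β f v := by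
  rw [h.dom] at hf
  rw [(h.isCoordChange hF).pd_image hf hv (Matrix.mul_nonsing_inv _ (h.isUnit_jacobian hF hv))]
  exact Finset.sum_congr rfl fun β _ => by rw [pd_congr hF.isOpen e hv]

/-- Multiplication by ∂_κ sends the unit field to ∂_κ, so ∂/∂v̂^κ is the old unit field. This makes
κ the new unit index. -/
theorem inv_jacobian_unit (hv : v ∈ D.dom) (β : Fin n) :
    (jacobian (D.type1Coord κ) v)⁻¹ β κ = if β = D.unit then 1 else 0 := by
  have h1 := congrFun (congrFun (Matrix.nonsing_inv_mul _ (h.isUnit_jacobian hF hv)) β) D.unit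
  rw [Matrix.mul_apply, Matrix.one_apply] at h1
  rw [← h1]
  have : ∀ α, jacobian (D.type1Coord κ) v α D.unit = if α = κ then 1 else 0 := fun α => by
    rw [jacobian_eq hF hv, Matrix.of_apply, hF.c_unit hv]
  simp [this]

/-- Second derivatives of the potential agree as functions of the point, so only the outermost
derivative feels the change of coordinates. -/
theorem pd₃_eq (hv : v ∈ D.dom) (α β γ : Fin n) :
    pd α (pd β (pd γ D'.F)) (D.type1Coord κ v)
      = ∑ δ, (jacobian (D.type1Coord κ) v)⁻¹ δ α * pd δ (pd β (pd γ D.F)) v :=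
  h.pd_coord_eq hF ((h.smooth.pd (h.isOpen_dom hF) γ).pd (h.isOpen_dom hF) β)
    (fun w hw => h.potential w hw β γ) hv α

theorem c_eq (hv : v ∈ D.dom) (α β γ : Fin n) :
    D'.c α β γ (D.type1Coord κ v)
      = ∑ δ, (jacobian (D.type1Coord κ) v)⁻¹ δ β * D.c α δ γ v := by
  simp_rw [c, Finset.mul_sum]
  rw [Finset.sum_comm]
  refine Finset.sum_congr rfl fun ν _ => ?_
  rw [pd_comm (h.smooth.pd (h.isOpen_dom hF) γ) (h.isOpen_dom hF) (h.mem_dom hv),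
    h.pd₃_eq hF hv, h.η, Finset.mul_sum]
  exact Finset.sum_congr rfl fun δ _ => by rw [hF.pd₃_swap_left hv]; ring

/-- By symmetry of the lower indices the inverse Jacobian may act on either of them; the
associativity proof uses one version for each factor. -/
theorem c_eq' (hv : v ∈ D.dom) (α β γ : Fin n) :
    D'.c α β γ (D.type1Coord κ v)
      = ∑ δ, (jacobian (D.type1Coord κ) v)⁻¹ δ γ * D.c α β δ v := by
  have : D'.c α β γ (D.type1Coord κ v) = D'.c α γ β (D.type1Coord κ v) :=
    Finset.sum_congr rfl fun ν _ => by
      rw [pd_congr (h.isOpen_dom hF)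
        (fun w hw => pd_comm h.smooth (h.isOpen_dom hF) hw β γ) (h.mem_dom hv)]
  rw [this, h.c_eq hF hv]
  exact Finset.sum_congr rfl fun δ _ => by rw [hF.c_swap hv]

theorem assoc (hv : v ∈ D.dom) (α β γ ν : Fin n) :
    ∑ l, D'.c l α β (D.type1Coord κ v) * D'.c ν l γ (D.type1Coord κ v)
      = ∑ l, D'.c l γ β (D.type1Coord κ v) * D'.c ν l α (D.type1Coord κ v) := by
  -- The inverse Jacobians carry only the outer indices α and γ, so they factor out of the
  -- contraction over l and leave the old associativity relation.
  have key : ∀ α γ, ∑ l, D'.c l α β (D.type1Coord κ v) * D'.c ν l γ (D.type1Coord κ v)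
      = ∑ δ, ∑ ε, (jacobian (D.type1Coord κ) v)⁻¹ δ α * (jacobian (D.type1Coord κ) v)⁻¹ ε γ
        * ∑ l, D.c l δ β v * D.c ν l ε v := by
    intro α γ
    simp_rw [h.c_eq hF hv _ _ β, h.c_eq' hF hv ν, Finset.sum_mul_sum, Finset.mul_sum]
    rw [Finset.sum_comm]
    refine Finset.sum_congr rfl fun δ _ => ?_
    rw [Finset.sum_comm]
    exact Finset.sum_congr rfl fun ε _ => Finset.sum_congr rfl fun l _ => by ring
  rw [key, key, Finset.sum_comm]
  refine Finset.sum_congr rfl fun δ _ => Finset.sum_congr rfl fun ε _ => ?_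
  rw [hF.assoc v hv]
  ring

/-- The Hessian entry ∂_γ∂_κF has weight 1 + μ_γ + μ_κ with inhomogeneity A_{γκ}. Raising γ to α
replaces μ_γ by −μ_α, and with d̂ = −2μ_κ the weight is 1 − d̂/2 − μ_α while the inhomogeneity
becomes r̂_α. -/
theorem euler_eq (hv : v ∈ D.dom) (α : Fin n) :
    D'.euler (D.type1Coord κ v) α
      = lineDeriv 𝕜 (fun w => D.type1Coord κ w α) v (D.euler v) := by
  obtain ⟨A, B, C, hq, hr⟩ := h.r
  have hd := fun γ => (hF.contDiffOn_pd₂ γ κ).differentiableAt_of_isOpen hF.isOpen hv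
  change _ = D.eulerDeriv (fun w => ∑ γ, D.η⁻¹ α γ * pd γ (pd κ D.F) w) v
  rw [eulerDeriv_sum _ (f := fun γ w => D.η⁻¹ α γ * pd γ (pd κ D.F) w)
    fun γ _ => (hd γ).const_mul (D.η⁻¹ α γ), euler, hr, type1Coord, Finset.mul_sum,
    ← Finset.sum_add_distrib]
  refine Finset.sum_congr rfl fun γ _ => ?_
  rw [eulerDeriv_const_mul _ (hd γ), hF.eulerDeriv_pd₂ hq hv, h.d, h.μ, hq.1.apply γ κ,
    hF.inv_symm γ α]
  linear_combination -pd γ (pd κ D.F) v * hF.mu_add_mul_inv α γ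

theorem eulerDeriv_eq {f f' : (Fin n → 𝕜) → 𝕜} (hf : ContDiffOn 𝕜 ∞ f' D'.dom)
    (e : ∀ w ∈ D.dom, f' (D.type1Coord κ w) = f w) (hv : v ∈ D.dom) :
    D'.eulerDeriv f' (D.type1Coord κ v) = D.eulerDeriv f v := by
  rw [h.dom] at hf
  rw [eulerDeriv, (h.isCoordChange hF).lineDeriv_image hf hv (h.euler_eq hF hv)]
  exact eulerDeriv_congr hF.isOpen e hv

/-- The potential F̂ is known only through its Hessian. The Hessian of ∂_ÊF̂ − (3 − d̂)F̂ is the old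
constant matrix A, and on a connected domain this forces a quadratic polynomial. -/
theorem quasi : ∃ A B C, D'.IsQuasiHomogeneous A B C := by
  obtain ⟨A, B, C, hq, hr⟩ := h.r
  have hU := h.isOpen_dom hF
  have h1 := fun β => h.smooth.pd hU β
  have h2 := fun α β => (h1 β).pd hU α
  have hE := contDiffOn_eulerDeriv (D := D') hU h.smooth
  have hess : ∀ v ∈ D'.dom, ∀ α β,
      pd α (pd β fun w => D'.eulerDeriv D'.F w - (3 - D'.d) * D'.F w) v = A α β := by
    intro v' hv' α β
    obtain ⟨v, hv, rfl⟩ : v' ∈ D.type1Coord κ '' D.dom := h.dom ▸ hv'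
    have hβ : ∀ w ∈ D'.dom, pd β (fun w => D'.eulerDeriv D'.F w - (3 - D'.d) * D'.F w) w
        = D'.eulerDeriv (pd β D'.F) w + (D'.d / 2 - 2 - D'.μ β) * pd β D'.F w := by
      intro w hw
      have hd := h.smooth.differentiableAt_of_isOpen hU hw
      rw [pd_sub (hE.differentiableAt_of_isOpen hU hw) (hd.const_mul _), pd_const_mul _ hd,
        pd_eulerDeriv hU h.smooth hw]
      ring
    have hd := (h1 β).differentiableAt_of_isOpen hU hv'
    rw [pd_congr hU hβ hv', pd_add ((contDiffOn_eulerDeriv hU (h1 β)).differentiableAt_of_isOpen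
      hU hv') (hd.const_mul _), pd_const_mul _ hd, pd_eulerDeriv hU (h1 β) hv',
      h.eulerDeriv_eq hF (h2 α β) (fun w hw => h.potential w hw α β) hv,
      hF.eulerDeriv_pd₂ hq hv, h.potential v hv, h.μ]
    ring
  obtain ⟨B', C', hBC⟩ := exists_quadratic_of_hessian_const hU
    (by rw [h.dom]; exact ((h.isCoordChange hF).isConnected_image hF.isConnected).isPreconnected)
    (hE.sub (contDiffOn_const.mul h.smooth)) A hq.1 hess
  refine ⟨A, B', C', hq.1, fun v hv => ?_⟩
  linear_combination hBC v hv

theorem isWDVV : D'.IsWDVV where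
  isOpen := h.isOpen_dom hF
  isConnected := by
    rw [h.dom]
    exact (h.isCoordChange hF).isConnected_image hF.isConnected
  smooth := h.smooth
  metric := by
    intro v' hv' α β
    obtain ⟨v, hv, rfl⟩ : v' ∈ D.type1Coord κ '' D.dom := h.dom ▸ hv'
    rw [h.unit, h.η, h.pd₃_eq hF hv]
    simp [h.inv_jacobian_unit hF hv, hF.metric v hv]
  nondegenerate := by
    rw [h.η]
    exact hF.nondegenerate
  assoc := by
    intro v' hv' α β γ ν
    obtain ⟨v, hv, rfl⟩ : v' ∈ D.type1Coord κ '' D.dom := h.dom ▸ hv'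
    exact h.assoc hF hv α β γ ν
  charge := by
    rw [h.μ, h.unit, h.d]
    ring
  quasi := h.quasi hF

variable (hθ : D.IsCalibration)
include hθ

theorem contDiffOn_θ (α : Fin n) (p : ℕ) : ContDiffOn 𝕜 ∞ (D'.θ α p) D'.dom := by
  rw [h.dom]
  refine (h.isCoordChange hF).contDiffOn_image ?_
  exact (hθ.contDiffOn_pd hF α κ (p + 1)).congr fun v hv => h.θ v hv α p

/-- Flatness says that the gradient of ∂_κθ_{α,p+1} is the transposed Jacobian applied to the
gradient of θ_{α,p}; the chain rule removes that Jacobian. -/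
theorem pd_θ (hv : v ∈ D.dom) (α β : Fin n) (p : ℕ) :
    pd β (D'.θ α p) (D.type1Coord κ v) = pd β (D.θ α p) v := by
  rw [h.pd_coord_eq hF (h.contDiffOn_θ hF hθ α p) (fun w hw => h.θ w hw α p) hv]
  have e : ∀ δ, pd δ (pd κ (D.θ α (p + 1))) v
      = ∑ γ, jacobian (D.type1Coord κ) v γ δ * pd γ (D.θ α p) v := fun δ => by
    rw [hθ.flat v hv, jacobian_eq hF hv]
    rfl
  have h1 := Matrix.mul_nonsing_inv _ (h.isUnit_jacobian hF hv)
  simp_rw [e, Finset.mul_sum]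
  rw [Finset.sum_comm]
  have e2 : ∀ γ, ∑ δ, (jacobian (D.type1Coord κ) v)⁻¹ δ β
      * (jacobian (D.type1Coord κ) v γ δ * pd γ (D.θ α p) v)
      = (1 : Matrix (Fin n) (Fin n) 𝕜) γ β * pd γ (D.θ α p) v := by
    intro γ
    rw [← h1, Matrix.mul_apply, Finset.sum_mul]
    exact Finset.sum_congr rfl fun _ _ => by ring
  simp_rw [e2]
  simp [Matrix.one_apply]

theorem gradPair_eq (hv : v ∈ D.dom) (α β : Fin n) (p q : ℕ) :
    D'.gradPair (D'.θ α p) (D'.θ β q) (D.type1Coord κ v)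
      = D.gradPair (D.θ α p) (D.θ β q) v := by
  simp_rw [gradPair, h.pd_θ hF hθ hv, h.η]

theorem twoPoint_eq (hv : v ∈ D.dom) (α β : Fin n) (p q : ℕ) :
    D'.twoPoint α p β q (D.type1Coord κ v) = D.twoPoint α p β q v := by
  simp_rw [twoPoint, h.gradPair_eq hF hθ hv]

theorem isCalibration : D'.IsCalibration where
  smooth := h.contDiffOn_θ hF hθ
  flat := by
    intro v' hv' α β ν p
    obtain ⟨v, hv, rfl⟩ : v' ∈ D.type1Coord κ '' D.dom := h.dom ▸ hv'
    rw [h.pd_coord_eq hF ((h.contDiffOn_θ hF hθ ν _).pd (h.isOpen_dom hF) β)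
      (fun w hw => h.pd_θ hF hθ hw ν β _) hv]
    simp_rw [hθ.flat v hv, h.c_eq hF hv, h.pd_θ hF hθ hv, Finset.mul_sum, Finset.sum_mul]
    rw [Finset.sum_comm]
    exact Finset.sum_congr rfl fun _ _ => Finset.sum_congr rfl fun _ _ => by ring
  homogeneous := by
    intro v' hv' α β p
    obtain ⟨v, hv, rfl⟩ : v' ∈ D.type1Coord κ '' D.dom := h.dom ▸ hv'
    rw [h.eulerDeriv_eq hF ((h.contDiffOn_θ hF hθ α p).pd (h.isOpen_dom hF) β)
      (fun w hw => h.pd_θ hF hθ hw α β p) hv, hθ.homogeneous v hv]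
    simp_rw [h.pd_θ hF hθ hv, h.μ, h.R]
  theta_zero := by
    intro v' hv' α
    obtain ⟨v, hv, rfl⟩ : v' ∈ D.type1Coord κ '' D.dom := h.dom ▸ hv'
    rw [h.θ v hv, h.normalized v hv, hF.pd_swap hv, h.η]
    have : ∀ γ, D.η α γ * D.type1Coord κ v γ
        = ∑ δ, D.η α γ * D.η⁻¹ γ δ * pd δ (pd κ D.F) v := fun γ => by
      rw [type1Coord, Finset.mul_sum]
      exact Finset.sum_congr rfl fun _ _ => by ring
    simp_rw [this]
    rw [Finset.sum_comm]
    simp_rw [← Finset.sum_mul, ← Matrix.mul_apply, hF.eta_mul_inv, Matrix.one_apply]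
    simp
  orthogonal := by
    intro v' hv' α β p
    obtain ⟨v, hv, rfl⟩ : v' ∈ D.type1Coord κ '' D.dom := h.dom ▸ hv'
    simp_rw [h.gradPair_eq hF hθ hv, h.η]
    exact hθ.orthogonal v hv α β p
  unit_deriv := by
    intro v' hv' α p
    obtain ⟨v, hv, rfl⟩ : v' ∈ D.type1Coord κ '' D.dom := h.dom ▸ hv'
    rw [h.unit, h.pd_θ hF hθ hv, h.θ v hv]
  R_zero := by rw [h.R, hθ.R_zero]
  R_graded := by
    rw [h.R, h.μ]
    exact hθ.R_graded
  R_symm := by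
    rw [h.R, h.η]
    exact hθ.R_symm

end IsType1

end FrobeniusData

/-! ### Type 2: the inversion, its Jacobian, and derivatives of quotients by v^n. -/

namespace FrobeniusData

variable {𝕜 : Type*} [RCLike 𝕜] {n : ℕ} [NeZero n] {D D' : FrobeniusData 𝕜 n} {v : Fin n → 𝕜}

/-- The matrix `∂v^γ/∂v̂^β`, as a function of `v`, divided by `v^n`. -/
def inversionMatrix (D : FrobeniusData 𝕜 n) (v : Fin n → 𝕜) : Matrix (Fin n) (Fin n) 𝕜 :=
  Matrix.of fun γ β =>
    (if β = 0 then 0 else if β = Fin.rev 0 then -v γ else if γ = β then 1 else 0)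
      - if γ = 0 then D.type2Coord v β.rev else 0

namespace IsType2Normalized

variable (h : D.IsType2Normalized)
include h

theorem rev_zero_ne : (Fin.rev 0 : Fin n) ≠ 0 := by
  have := h.two_le
  intro e
  have := congrArg Fin.val e
  simp [Fin.val_rev] at this
  omega

theorem eta_mul_eta : D.η * D.η = 1 := by
  ext α β
  simp_rw [Matrix.mul_apply, h.η]
  rw [Finset.sum_eq_single α.rev (fun b _ hb => by simp [hb]) (by simp)]
  simp [Matrix.one_apply, eq_comm]

theorem inv_eta : D.η⁻¹ = D.η := Matrix.inv_eq_left_inv h.eta_mul_eta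

theorem sqNorm_eq (v : Fin n → 𝕜) : D.sqNorm v = ∑ σ, v σ * v σ.rev := by
  simp [sqNorm, h.η]

theorem pd_sqNorm (γ : Fin n) : pd γ D.sqNorm v = 2 * v γ.rev := by
  have e : ∀ β, (β = γ.rev) = (γ = β.rev) := fun β =>
    propext ⟨fun e => by rw [e, Fin.rev_rev], fun e => by rw [e, Fin.rev_rev]⟩
  have : pd γ D.sqNorm v = _ := pd_quadratic D.η γ
  rw [this]
  simp_rw [h.η, ← e]
  simp [← two_mul]

omit [NeZero n] h in
theorem contDiff_sqNorm : ContDiff 𝕜 ∞ D.sqNorm := by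
  unfold sqNorm
  fun_prop

omit [NeZero n] h in
theorem differentiableAt_sqNorm : DifferentiableAt 𝕜 D.sqNorm v := by
  unfold sqNorm
  fun_prop

omit h in
theorem coord_zero (v : Fin n → 𝕜) :
    D.type2Coord v 0 = -(1 / 2) * D.sqNorm v / v (Fin.rev 0) := by simp [type2Coord]

theorem coord_last (v : Fin n → 𝕜) :
    D.type2Coord v (Fin.rev 0) = 1 / v (Fin.rev 0) := by simp [type2Coord, h.rev_zero_ne]

omit h in
theorem coord_other (v : Fin n → 𝕜) {α : Fin n} (h0 : α ≠ 0) (h1 : α ≠ Fin.rev 0) :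
    D.type2Coord v α = v α / v (Fin.rev 0) := by simp [type2Coord, h0, h1]

omit h in
theorem rev_ne_zero {α : Fin n} (h1 : α ≠ Fin.rev 0) : α.rev ≠ 0 := by
  rintro e; exact h1 (by rw [← e, Fin.rev_rev])

omit h in
theorem rev_ne_last {α : Fin n} (h1 : α ≠ 0) : α.rev ≠ Fin.rev 0 := fun e =>
  h1 (Fin.rev_injective e)

theorem jacobian_last (hv : v ∈ D.dom) (β : Fin n) :
    jacobian D.type2Coord v (Fin.rev 0) β
      = if β = Fin.rev 0 then -(v (Fin.rev 0) ^ 2)⁻¹ else 0 := by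
  have hw := h.last_ne_zero v hv
  simp only [jacobian, Matrix.of_apply, h.coord_last]
  rw [pd_div (by fun_prop) (by fun_prop) hw, pd_const, pd_coord]
  split_ifs <;> simp [div_eq_mul_inv]

theorem jacobian_zero (hv : v ∈ D.dom) (β : Fin n) :
    jacobian D.type2Coord v 0 β
      = -(v β.rev / v (Fin.rev 0))
        + if β = Fin.rev 0 then 1 / 2 * D.sqNorm v / v (Fin.rev 0) ^ 2 else 0 := by
  have hw := h.last_ne_zero v hv
  have := differentiableAt_sqNorm (D := D) (v := v)
  simp only [jacobian, Matrix.of_apply, coord_zero]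
  rw [pd_div (by fun_prop) (by fun_prop) hw, pd_const_mul _ this, h.pd_sqNorm, pd_coord]
  split_ifs <;> (field_simp; try ring)

theorem jacobian_other (hv : v ∈ D.dom) {α : Fin n} (h0 : α ≠ 0) (h1 : α ≠ Fin.rev 0)
    (β : Fin n) :
    jacobian D.type2Coord v α β
      = (if β = α then (v (Fin.rev 0))⁻¹ else 0)
        - if β = Fin.rev 0 then v α / v (Fin.rev 0) ^ 2 else 0 := by
  have hw := h.last_ne_zero v hv
  simp only [jacobian, Matrix.of_apply, coord_other _ h0 h1]
  rw [pd_div (by fun_prop) (by fun_prop) hw, pd_coord, pd_coord]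
  split_ifs <;> (field_simp; try ring)

theorem inversionMatrix_zero (hv : v ∈ D.dom) (γ : Fin n) :
    v (Fin.rev 0) * D.inversionMatrix v γ 0 = if γ = 0 then -1 else 0 := by
  have hw := h.last_ne_zero v hv
  simp only [inversionMatrix, Matrix.of_apply, h.coord_last]
  split_ifs <;> simp [hw]

theorem inversionMatrix_other (hv : v ∈ D.dom) {β : Fin n} (h0 : β ≠ 0) (h1 : β ≠ Fin.rev 0)
    (γ : Fin n) :
    v (Fin.rev 0) * D.inversionMatrix v γ β
      = (if γ = β then v (Fin.rev 0) else 0) - if γ = 0 then v β.rev else 0 := by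
  have hw := h.last_ne_zero v hv
  simp only [inversionMatrix, Matrix.of_apply, h0, h1, if_false,
    coord_other v (rev_ne_zero h1) (rev_ne_last h0)]
  split_ifs <;> (field_simp; try ring)

theorem inversionMatrix_last (hv : v ∈ D.dom) (γ : Fin n) :
    v (Fin.rev 0) * D.inversionMatrix v γ (Fin.rev 0)
      = -(v (Fin.rev 0) * v γ) + if γ = 0 then 1 / 2 * D.sqNorm v else 0 := by
  have hw := h.last_ne_zero v hv
  simp only [inversionMatrix, Matrix.of_apply, h.rev_zero_ne, if_false, if_true, Fin.rev_rev,
    coord_zero v]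
  split_ifs <;> (field_simp; try ring)

/-- Conformality of the inversion. Moving an index with η amounts to `Fin.rev`, so this says that
the inverse Jacobian v^n M is (v^n)² times the η-adjoint of the Jacobian. -/
theorem inversionMatrix_eq_jacobian (hv : v ∈ D.dom) (α γ : Fin n) :
    v (Fin.rev 0) * D.inversionMatrix v γ.rev α
      = v (Fin.rev 0) ^ 2 * jacobian D.type2Coord v α.rev γ := by
  have hw := h.last_ne_zero v hv
  have e1 : γ.rev = 0 ↔ γ = Fin.rev 0 := Fin.rev_eq_iff
  by_cases h0 : α = 0
  · subst h0
    rw [h.inversionMatrix_zero hv, h.jacobian_last hv]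
    simp only [e1]
    split_ifs <;> field_simp
    simp
  by_cases h1 : α = Fin.rev 0
  · subst h1
    rw [h.inversionMatrix_last hv, Fin.rev_rev, h.jacobian_zero hv]
    simp only [e1]
    split_ifs <;> field_simp
    simp
  rw [h.inversionMatrix_other hv h0 h1, h.jacobian_other hv (rev_ne_zero h1) (rev_ne_last h0)]
  have e2 : γ.rev = α ↔ γ = α.rev := Fin.rev_eq_iff
  simp only [e1, e2]
  split_ifs <;> field_simp <;> ring

/-- A check over nine blocks, each index being first, last or other. Only the block (first, last)
involves a genuine sum, and it closes because that sum is η_{σγ}v^σv^γ. -/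
theorem jacobian_mul (hv : v ∈ D.dom) :
    jacobian D.type2Coord v * (v (Fin.rev 0) • D.inversionMatrix v) = 1 := by
  have hw := h.last_ne_zero v hv
  have hne := h.rev_zero_ne
  have hsq := h.sqNorm_eq v
  ext α β
  rw [Matrix.mul_apply]
  simp only [Matrix.smul_apply, smul_eq_mul]
  by_cases b0 : β = 0
  · subst b0
    simp_rw [h.inversionMatrix_zero hv]
    simp only [mul_ite, mul_neg, mul_one, mul_zero, Finset.sum_ite_eq', Finset.mem_univ, if_true]
    by_cases a0 : α = 0
    · subst a0
      rw [h.jacobian_zero hv]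
      simp [hne.symm, hw]
    by_cases a1 : α = Fin.rev 0
    · subst a1
      rw [h.jacobian_last hv]
      simp [hne.symm, hne]
    rw [h.jacobian_other hv a0 a1]
    simp [hne.symm, Ne.symm a0, a0]
  by_cases b1 : β = Fin.rev 0
  · subst b1
    simp_rw [h.inversionMatrix_last hv, mul_add, Finset.sum_add_distrib]
    simp only [mul_ite, mul_zero, Finset.sum_ite_eq', Finset.mem_univ, if_true]
    by_cases a0 : α = 0
    · subst a0
      simp_rw [h.jacobian_zero hv, add_mul, Finset.sum_add_distrib]
      have : ∑ x : Fin n, -(v x.rev / v (Fin.rev 0)) * -(v (Fin.rev 0) * v x) = D.sqNorm v := by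
        rw [hsq]
        exact Finset.sum_congr rfl fun x _ => by field_simp
      rw [this]
      simp only [ite_mul, zero_mul, Finset.sum_ite_eq', Finset.mem_univ, if_true, hne.symm,
        if_false, Matrix.one_apply]
      field_simp
      ring
    by_cases a1 : α = Fin.rev 0
    · subst a1
      simp_rw [h.jacobian_last hv]
      simp [hne.symm]
      field_simp
    simp_rw [h.jacobian_other hv a0 a1]
    simp only [sub_mul, ite_mul, zero_mul, Finset.sum_sub_distrib, Finset.sum_ite_eq',
      Finset.mem_univ, if_true, hne.symm, Ne.symm a0, a1, if_false, Matrix.one_apply]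
    field_simp
    ring
  simp_rw [h.inversionMatrix_other hv b0 b1, mul_sub, Finset.sum_sub_distrib]
  simp only [mul_ite, mul_zero, Finset.sum_ite_eq', Finset.mem_univ, if_true]
  by_cases a0 : α = 0
  · subst a0
    simp_rw [h.jacobian_zero hv]
    simp [b1, hne.symm, Ne.symm b0]
    field_simp
    simp
  by_cases a1 : α = Fin.rev 0
  · subst a1
    simp_rw [h.jacobian_last hv]
    simp [b1, hne.symm, Ne.symm b1]
  simp_rw [h.jacobian_other hv a0 a1]
  simp [b1, hne.symm, Ne.symm a0, Matrix.one_apply, eq_comm (a := β), hw, ite_mul]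

theorem isCoordChange (hF : D.IsWDVV) : IsCoordChange D.type2Coord D.dom where
  isOpen := hF.isOpen
  smooth := by
    refine contDiffOn_pi.2 fun α => ?_
    by_cases h0 : α = 0
    · subst h0
      simp_rw [coord_zero]
      exact (contDiffOn_const.mul contDiff_sqNorm.contDiffOn).div (by fun_prop) h.last_ne_zero
    by_cases h1 : α = Fin.rev 0
    · subst h1
      simp_rw [h.coord_last]
      exact contDiffOn_const.div (by fun_prop) h.last_ne_zero
    simp_rw [coord_other _ h0 h1]
    exact ContDiffOn.div (by fun_prop) (by fun_prop) h.last_ne_zero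
  det_ne_zero := fun v hv e => by
    have := congrArg Matrix.det (h.jacobian_mul hv)
    rw [Matrix.det_mul, e, zero_mul, Matrix.det_one] at this
    exact zero_ne_one this

theorem mul_jacobian (hv : v ∈ D.dom) :
    (v (Fin.rev 0) • D.inversionMatrix v) * jacobian D.type2Coord v = 1 :=
  mul_eq_one_comm.1 (h.jacobian_mul hv)

theorem inversionMatrix_last_left (β : Fin n) :
    D.inversionMatrix v (Fin.rev 0) β = if β = Fin.rev 0 then -v (Fin.rev 0) else 0 := by
  simp only [inversionMatrix, Matrix.of_apply, h.rev_zero_ne, if_false, sub_zero]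
  split_ifs with h1 h2 h3 h4 <;> simp_all [h.rev_zero_ne]

/-- Only the last column (entries −v^γ) and the first row (entries −v̂ with reversed index) of M
vary with v. -/
theorem pd_inversionMatrix (hF : D.IsWDVV) (hv : v ∈ D.dom) (l γ β : Fin n) :
    pd l (fun w => D.inversionMatrix w γ β) v
      = (if β = Fin.rev 0 then (if l = γ then -1 else 0) else 0)
        - if γ = 0 then jacobian D.type2Coord v β.rev l else 0 := by
  have hd := ((h.isCoordChange hF).contDiffOn_coord β.rev).differentiableAt_of_isOpen hF.isOpen hv
  have hne := h.rev_zero_ne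
  have h1 : pd l (fun w : Fin n → 𝕜 => if β = 0 then 0 else
      if β = Fin.rev 0 then -w γ else if γ = β then 1 else 0) v
      = (if β = Fin.rev 0 then (if l = γ then -1 else 0) else 0) := by
    by_cases b0 : β = 0
    · simp [b0, hne.symm, pd_const]
    by_cases b1 : β = Fin.rev 0
    · simp only [b1, if_false, if_true, hne]
      rw [pd_neg (by fun_prop), pd_coord]
      split_ifs <;> simp
    simp [b0, b1, pd_const]
  have hd1 : DifferentiableAt 𝕜 (fun w : Fin n → 𝕜 => if β = 0 then 0 else
      if β = Fin.rev 0 then -w γ else if γ = β then 1 else 0) v := by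
    split_ifs <;> fun_prop
  have h2 : pd l (fun w : Fin n → 𝕜 => if γ = 0 then D.type2Coord w β.rev else 0) v
      = if γ = 0 then jacobian D.type2Coord v β.rev l else 0 := by
    split_ifs
    · rfl
    · exact pd_const _ _
  have hd2 : DifferentiableAt 𝕜 (fun w : Fin n → 𝕜 =>
      if γ = 0 then D.type2Coord w β.rev else 0) v := by
    split_ifs
    · exact hd
    · fun_prop
  rw [← h1, ← h2, ← pd_sub hd1 hd2]
  rfl

theorem contDiffOn_inversionMatrix (hF : D.IsWDVV) (γ β : Fin n) :
    ContDiffOn 𝕜 ∞ (fun w => D.inversionMatrix w γ β) D.dom := by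
  have hd := (h.isCoordChange hF).contDiffOn_coord β.rev
  simp only [inversionMatrix, Matrix.of_apply]
  refine ContDiffOn.sub ?_ ?_
  · split_ifs <;> fun_prop
  · split_ifs
    · exact hd
    · fun_prop

theorem contDiffOn_of_div (hF : D.IsWDVV) {φ f' : (Fin n → 𝕜) → 𝕜} (hφ : ContDiffOn 𝕜 ∞ φ D.dom)
    (e : ∀ w ∈ D.dom, f' (D.type2Coord w) = φ w / w (Fin.rev 0)) :
    ContDiffOn 𝕜 ∞ f' (D.type2Coord '' D.dom) :=
  (h.isCoordChange hF).contDiffOn_image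
    ((hφ.div (by fun_prop) h.last_ne_zero).congr e)

/-- The gradient, in the new coordinates, of `φ / v^n`. -/
theorem pd_of_div (hF : D.IsWDVV) {φ f' : (Fin n → 𝕜) → 𝕜} (hφ : ContDiffOn 𝕜 ∞ φ D.dom)
    (e : ∀ w ∈ D.dom, f' (D.type2Coord w) = φ w / w (Fin.rev 0)) (hv : v ∈ D.dom) (β : Fin n) :
    pd β f' (D.type2Coord v)
      = ∑ γ, D.inversionMatrix v γ β * pd γ φ v + if β = Fin.rev 0 then φ v else 0 := by
  have hw := h.last_ne_zero v hv
  have hd := hφ.differentiableAt_of_isOpen hF.isOpen hv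
  rw [(h.isCoordChange hF).pd_image (h.contDiffOn_of_div hF hφ e) hv (h.jacobian_mul hv)]
  -- The derivative of 1/v^n enters only for γ = n, and the last row of M vanishes outside its last
  -- entry; this is where the extra term for β = n comes from.
  have : ∀ γ, (v (Fin.rev 0) • D.inversionMatrix v) γ β
      * pd γ (fun w => f' (D.type2Coord w)) v = D.inversionMatrix v γ β * pd γ φ v
        - if γ = Fin.rev 0 then D.inversionMatrix v γ β * φ v / v (Fin.rev 0) else 0 := fun γ => by
    rw [pd_congr hF.isOpen e hv, pd_div hd (by fun_prop) hw, pd_coord, Matrix.smul_apply,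
      smul_eq_mul]
    split_ifs <;> (field_simp; try ring)
  simp_rw [this, Finset.sum_sub_distrib]
  rw [Finset.sum_ite_eq', if_pos (Finset.mem_univ _), h.inversionMatrix_last_left]
  split_ifs <;> field_simp <;> ring

/-- The Hessian, in the new coordinates, of `φ / v^n`. -/
theorem pd_pd_of_div (hF : D.IsWDVV) {φ f' : (Fin n → 𝕜) → 𝕜} (hφ : ContDiffOn 𝕜 ∞ φ D.dom)
    (e : ∀ w ∈ D.dom, f' (D.type2Coord w) = φ w / w (Fin.rev 0)) (hv : v ∈ D.dom) (α β : Fin n) :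
    pd α (pd β f') (D.type2Coord v)
      = v (Fin.rev 0) * ∑ l, ∑ γ, D.inversionMatrix v l α * D.inversionMatrix v γ β
          * pd l (pd γ φ) v - D.η α β * pd 0 φ v := by
  have hw := h.last_ne_zero v hv
  have hs : ContDiffOn 𝕜 ∞ (pd β f') (D.type2Coord '' D.dom) :=
    (h.contDiffOn_of_div hF hφ e).pd (h.isCoordChange hF).isOpen_image β
  have hd := hφ.differentiableAt_of_isOpen hF.isOpen hv
  have hdp := fun γ => (hφ.pd hF.isOpen γ).differentiableAt_of_isOpen hF.isOpen hv
  have hdM := fun γ => (h.contDiffOn_inversionMatrix hF γ β).differentiableAt_of_isOpen hF.isOpen hv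
  have hi : DifferentiableAt 𝕜 (fun w => if β = Fin.rev 0 then φ w else 0) v := by
    split_ifs <;> fun_prop
  have hpi : ∀ l, pd l (fun w => if β = Fin.rev 0 then φ w else 0) v
      = if β = Fin.rev 0 then pd l φ v else 0 := fun l => by
    split_ifs
    · rfl
    · exact pd_const _ _
  rw [(h.isCoordChange hF).pd_image hs hv (h.jacobian_mul hv)]
  -- Differentiating the last column of M gives −∂_lφ, which cancels the derivative of the extra
  -- term of the gradient. The first row contributes the remaining Jacobian entry times ∂_1φ.
  have key : ∀ l, pd l (fun w => pd β f' (D.type2Coord w)) v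
      = ∑ γ, D.inversionMatrix v γ β * pd l (pd γ φ) v
        - jacobian D.type2Coord v β.rev l * pd 0 φ v := by
    intro l
    rw [pd_congr hF.isOpen (fun w hw => h.pd_of_div hF hφ e hw β) hv,
      pd_add (f := fun w => ∑ γ, D.inversionMatrix w γ β * pd γ φ w)
        (DifferentiableAt.fun_sum fun γ _ => (hdM γ).mul (hdp γ)) hi, hpi,
      pd_sum _ (f := fun γ w => D.inversionMatrix w γ β * pd γ φ w)
        fun γ _ => (hdM γ).mul (hdp γ)]
    simp_rw [fun γ => pd_mul (hdM γ) (hdp γ) l, h.pd_inversionMatrix hF hv, sub_mul,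
      Finset.sum_add_distrib, Finset.sum_sub_distrib]
    split_ifs <;> simp <;> ring
  simp_rw [key, mul_sub, Finset.sum_sub_distrib]
  congr 1
  · rw [Finset.mul_sum]
    refine Finset.sum_congr rfl fun l _ => ?_
    rw [Finset.mul_sum, Finset.mul_sum]
    exact Finset.sum_congr rfl fun γ _ => by
      rw [Matrix.smul_apply, smul_eq_mul]; ring
  -- The leftover Jacobian meets its inverse, and the reversed index turns the identity matrix into
  -- η.
  · have h1 := congrFun (congrFun (h.jacobian_mul hv) β.rev) α
    rw [Matrix.mul_apply, Matrix.one_apply] at h1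
    simp only [Fin.rev_eq_iff] at h1
    rw [h.η, ← h1, Finset.sum_mul]
    exact Finset.sum_congr rfl fun l _ => by ring

end IsType2Normalized

end FrobeniusData

/-! ### Type 2: quadratic polynomials, and the derivatives of F̂ up to third order. -/

namespace FrobeniusData

variable {𝕜 : Type*} [RCLike 𝕜] {n : ℕ} {D D' : FrobeniusData 𝕜 n} {v : Fin n → 𝕜}

/-- The matrix of multiplication by `∂_α`. -/
def multMatrix (D : FrobeniusData 𝕜 n) (v : Fin n → 𝕜) (α : Fin n) : Matrix (Fin n) (Fin n) 𝕜 :=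
  Matrix.of fun γ β => D.c γ α β v

theorem IsWDVV.multMatrix_mul_apply (hF : D.IsWDVV) (hv : v ∈ D.dom) (α β γ ν : Fin n) :
    (D.multMatrix v γ * D.multMatrix v α) ν β = ∑ l, D.c l α β v * D.c ν l γ v := by
  rw [Matrix.mul_apply]
  exact Finset.sum_congr rfl fun l _ => by
    simp only [multMatrix, Matrix.of_apply]; rw [hF.c_swap hv ν γ l]; ring

theorem IsWDVV.multMatrix_comm (hF : D.IsWDVV) (hv : v ∈ D.dom) (α γ : Fin n) :
    Commute (D.multMatrix v γ) (D.multMatrix v α) := by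
  ext ν β
  rw [hF.multMatrix_mul_apply hv, hF.multMatrix_mul_apply hv, hF.assoc v hv]

section Quadratic

/-- `f` is given on `S` by a polynomial of degree at most two. -/
def IsQuadraticOn (f : (Fin n → 𝕜) → 𝕜) (S : Set (Fin n → 𝕜)) : Prop :=
  ∃ (A : Matrix (Fin n) (Fin n) 𝕜) (B : Fin n → 𝕜) (C : 𝕜), A.IsSymm ∧ ∀ v ∈ S,
    f v = 1 / 2 * ∑ α, ∑ β, A α β * v α * v β + ∑ α, B α * v α + C

/-- `f` is given on `S` by a polynomial of degree at most one. -/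
def IsAffineOn (f : (Fin n → 𝕜) → 𝕜) (S : Set (Fin n → 𝕜)) : Prop :=
  ∃ (b : Fin n → 𝕜) (c : 𝕜), ∀ v ∈ S, f v = ∑ α, b α * v α + c

variable {f g : (Fin n → 𝕜) → 𝕜} {S : Set (Fin n → 𝕜)}

theorem isAffineOn_const (c : 𝕜) : IsAffineOn (fun _ : Fin n → 𝕜 => c) S :=
  ⟨0, c, fun v _ => by simp⟩

theorem isAffineOn_coord (α : Fin n) : IsAffineOn (fun v : Fin n → 𝕜 => v α) S :=
  ⟨Pi.single α 1, 0, fun v _ => by simp [Pi.single_apply]⟩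

/-- The rank-one coefficient matrix is symmetrized because quasi-homogeneity asks for a symmetric A.
-/
theorem IsAffineOn.mul (hf : IsAffineOn f S) (hg : IsAffineOn g S) :
    IsQuadraticOn (fun v => f v * g v) S := by
  obtain ⟨b, c, hb⟩ := hf
  obtain ⟨b', c', hb'⟩ := hg
  refine ⟨Matrix.of fun α β => b α * b' β + b β * b' α, fun α => c * b' α + c' * b α, c * c',
    Matrix.IsSymm.ext fun α β => by simp only [Matrix.of_apply]; ring, fun v hv => ?_⟩
  have e : ∑ α, ∑ β, (b α * b' β + b β * b' α) * v α * v β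
      = 2 * ((∑ α, b α * v α) * ∑ α, b' α * v α) := by
    have e1 : ∑ α, ∑ β, b α * v α * (b' β * v β) = (∑ α, b α * v α) * ∑ α, b' α * v α := by
      rw [Finset.sum_mul_sum]
    have e2 : ∑ α, ∑ β, b β * v β * (b' α * v α) = (∑ α, b α * v α) * ∑ α, b' α * v α := by
      rw [Finset.sum_comm, Finset.sum_mul_sum]
    rw [two_mul]
    nth_rw 1 [← e1]
    rw [← e2, ← Finset.sum_add_distrib]
    refine Finset.sum_congr rfl fun α _ => ?_
    rw [← Finset.sum_add_distrib]
    exact Finset.sum_congr rfl fun β _ => by ring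
  simp only [Matrix.of_apply]
  rw [e, hb v hv, hb' v hv]
  simp only [add_mul, Finset.sum_add_distrib, mul_assoc, ← Finset.mul_sum]
  ring

theorem IsQuadraticOn.add (hf : IsQuadraticOn f S) (hg : IsQuadraticOn g S) :
    IsQuadraticOn (fun v => f v + g v) S := by
  obtain ⟨A, B, C, hA, hB⟩ := hf
  obtain ⟨A', B', C', hA', hB'⟩ := hg
  refine ⟨A + A', B + B', C + C', hA.add hA', fun v hv => ?_⟩
  simp only [Matrix.add_apply, Pi.add_apply, add_mul, Finset.sum_add_distrib]
  rw [hB v hv, hB' v hv]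
  ring

theorem IsQuadraticOn.const_mul (c : 𝕜) (hf : IsQuadraticOn f S) :
    IsQuadraticOn (fun v => c * f v) S := by
  obtain ⟨A, B, C, hA, hB⟩ := hf
  refine ⟨c • A, c • B, c * C, hA.smul c, fun v hv => ?_⟩
  simp only [Matrix.smul_apply, Pi.smul_apply, smul_eq_mul, mul_assoc, ← Finset.mul_sum]
  rw [hB v hv]
  simp only [mul_assoc]
  ring

theorem IsQuadraticOn.sum {ι : Type*} (s : Finset ι) {f : ι → (Fin n → 𝕜) → 𝕜}
    (hf : ∀ i ∈ s, IsQuadraticOn (f i) S) : IsQuadraticOn (fun v => ∑ i ∈ s, f i v) S := by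
  classical
  induction s using Finset.induction_on with
  | empty => exact ⟨0, 0, 0, Matrix.isSymm_zero, fun v _ => by simp⟩
  | insert i s hi ih =>
    simp only [Finset.sum_insert hi]
    exact (hf i (Finset.mem_insert_self i s)).add
      (ih fun j hj => hf j (Finset.mem_insert_of_mem hj))

end Quadratic

variable [NeZero n]

namespace IsType2Normalized

variable (h : D.IsType2Normalized)
include h

/-- Conformality combined with J · v^n M = 1: after removing the scale v^n, the Jacobian is
η-orthogonal. -/
theorem transpose_mul_eta_mul (hv : v ∈ D.dom) :
    (D.inversionMatrix v)ᵀ * D.η * D.inversionMatrix v = D.η := by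
  have hw := h.last_ne_zero v hv
  ext α β
  have h1 := congrFun (congrFun (h.jacobian_mul hv) α.rev) β
  rw [Matrix.mul_apply] at h1
  rw [Matrix.mul_assoc, Matrix.mul_apply, h.η]
  simp only [Matrix.one_apply] at h1
  simp only [eq_comm (a := β), ← h1]
  rw [← Equiv.sum_comp Fin.revPerm]
  refine Finset.sum_congr rfl fun l _ => ?_
  rw [Fin.revPerm_apply]
  have e : (D.η * D.inversionMatrix v) l.rev β = D.inversionMatrix v l β := by
    simp [Matrix.mul_apply, h.η]
  have h2 := h.inversionMatrix_eq_jacobian hv α l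
  rw [e, Matrix.transpose_apply, Matrix.smul_apply, smul_eq_mul]
  refine mul_left_cancel₀ hw ?_
  linear_combination D.inversionMatrix v l β * h2

theorem mul_eta_mul_transpose (hv : v ∈ D.dom) :
    D.inversionMatrix v * D.η * (D.inversionMatrix v)ᵀ = D.η := by
  have h1 : (D.η * (D.inversionMatrix v)ᵀ * D.η) * D.inversionMatrix v = 1 := by
    rw [Matrix.mul_assoc, Matrix.mul_assoc, ← Matrix.mul_assoc _ D.η, h.transpose_mul_eta_mul hv,
      h.eta_mul_eta]
  have h2 := congrArg (· * D.η) (mul_eq_one_comm.1 h1)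
  rw [one_mul] at h2
  refine Eq.trans ?_ h2
  simp only [Matrix.mul_assoc, h.eta_mul_eta, mul_one]

theorem sum_mul_sum_eta (hv : v ∈ D.dom) (α β : Fin n) :
    ∑ l, ∑ m, D.inversionMatrix v l α * D.inversionMatrix v m β * D.η l m = D.η α β := by
  conv_rhs => rw [← h.transpose_mul_eta_mul hv, Matrix.mul_assoc]
  rw [Matrix.mul_apply]
  refine Finset.sum_congr rfl fun l _ => ?_
  rw [Matrix.mul_apply, Finset.mul_sum]
  exact Finset.sum_congr rfl fun m _ => by rw [Matrix.transpose_apply]; ring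

end IsType2Normalized

namespace IsType2

variable (h : D.IsType2 D') (hN : D.IsType2Normalized) (hF : D.IsWDVV)
include h hN hF

theorem isOpen_dom : IsOpen D'.dom := by
  rw [h.dom]
  exact (hN.isCoordChange hF).isOpen_image

omit hN hF in
theorem mem_dom (hv : v ∈ D.dom) : D.type2Coord v ∈ D'.dom := by
  rw [h.dom]
  exact Set.mem_image_of_mem _ hv

omit h hN in
theorem contDiffOn_potential :
    ContDiffOn 𝕜 ∞ (fun v => -D.F v + 1 / 2 * (v 0 * D.sqNorm v)) D.dom :=
  hF.smooth.neg.add (contDiffOn_const.mul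
    (ContDiffOn.mul (by fun_prop) IsType2Normalized.contDiff_sqNorm.contDiffOn))

theorem smooth : ContDiffOn 𝕜 ∞ D'.F D'.dom := by
  rw [h.dom]
  refine hN.contDiffOn_of_div hF (φ := fun v =>
    (-D.F v + 1 / 2 * (v 0 * D.sqNorm v)) / v (Fin.rev 0))
    ((contDiffOn_potential hF).div (by fun_prop) hN.last_ne_zero) fun v hv => ?_
  have hw := hN.last_ne_zero v hv
  rw [h.potential v hv]
  field_simp

omit h in
theorem pd_pd_zero (hv : v ∈ D.dom) (γ : Fin n) : pd γ (pd 0 D.F) v = v γ.rev := by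
  rw [pd_congr hF.isOpen hN.potential hv, pd_const_mul _ IsType2Normalized.differentiableAt_sqNorm,
    hN.pd_sqNorm]
  ring

omit h in
theorem metric_zero (hv : v ∈ D.dom) (β γ : Fin n) :
    pd 0 (pd β (pd γ D.F)) v = D.η β γ := hN.unit ▸ hF.metric v hv β γ

/-- `v^n` times the gradient of `F̂`. -/
def gradDensity (D : FrobeniusData 𝕜 n) (β : Fin n) : (Fin n → 𝕜) → 𝕜 := fun v =>
  if β = 0 then -v 0 else if β = Fin.rev 0 then ∑ γ, v γ * pd γ D.F v - 2 * D.F v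
  else -pd β D.F v

omit h hN in
theorem contDiffOn_gradDensity (β : Fin n) : ContDiffOn 𝕜 ∞ (gradDensity D β) D.dom := by
  unfold gradDensity
  split_ifs
  · fun_prop
  · exact (ContDiffOn.sum fun γ _ => ContDiffOn.mul (by fun_prop) (hF.contDiffOn_pd γ)).sub
      (contDiffOn_const.mul hF.smooth)
  · exact (hF.contDiffOn_pd β).neg

theorem pd_eq (hv : v ∈ D.dom) (β : Fin n) :
    pd β D'.F (D.type2Coord v) = gradDensity D β v / v (Fin.rev 0) := by
  have hw := hN.last_ne_zero v hv
  have hX := contDiffOn_potential hF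
  have hd := hX.differentiableAt_of_isOpen hF.isOpen hv
  have hFd := hF.smooth.differentiableAt_of_isOpen hF.isOpen hv
  have hsd := IsType2Normalized.differentiableAt_sqNorm (D := D) (v := v)
  have hF0 := hN.potential v hv
  have hs := hN.sqNorm_eq v
  set X : (Fin n → 𝕜) → 𝕜 := fun v => -D.F v + 1 / 2 * (v 0 * D.sqNorm v) with hXdef
  have hpX : ∀ γ, pd γ X v
      = -pd γ D.F v + v 0 * v γ.rev + if γ = 0 then 1 / 2 * D.sqNorm v else 0 := fun γ => by
    rw [hXdef, pd_add (by fun_prop) (by fun_prop), pd_neg hFd, pd_const_mul _ (by fun_prop),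
      pd_mul (by fun_prop) hsd, hN.pd_sqNorm, pd_coord]
    split_ifs <;> ring
  -- The denominator of F̂ is (v^n)²; one factor is absorbed into φ so that the quotient formula
  -- applies.
  rw [hN.pd_of_div hF (φ := fun v => X v / v (Fin.rev 0))
    (hX.div (by fun_prop) hN.last_ne_zero) (fun w hw' => by
      have := hN.last_ne_zero w hw'
      rw [h.potential w hw']
      simp only [X]
      field_simp) hv]
  have key : ∀ γ, D.inversionMatrix v γ β * pd γ (fun v => X v / v (Fin.rev 0)) v
      = (v (Fin.rev 0) * D.inversionMatrix v γ β) * pd γ X v / v (Fin.rev 0) ^ 2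
        - if γ = Fin.rev 0 then D.inversionMatrix v γ β * X v / v (Fin.rev 0) ^ 2 else 0 := by
    intro γ
    rw [pd_div hd (by fun_prop) hw, pd_coord]
    split_ifs <;> field_simp <;> ring
  simp_rw [key, Finset.sum_sub_distrib, ← Finset.sum_div]
  rw [Finset.sum_ite_eq', if_pos (Finset.mem_univ _), hN.inversionMatrix_last_left]
  have hne := hN.rev_zero_ne
  by_cases b0 : β = 0
  · subst b0
    simp_rw [hN.inversionMatrix_zero hv, ite_mul, zero_mul]
    rw [Finset.sum_ite_eq', if_pos (Finset.mem_univ _), hpX, hF0]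
    simp only [gradDensity, hne.symm, if_true, if_false]
    field_simp
    ring
  by_cases b1 : β = Fin.rev 0
  · subst b1
    simp_rw [hN.inversionMatrix_last hv, add_mul, ite_mul, zero_mul, Finset.sum_add_distrib]
    rw [Finset.sum_ite_eq', if_pos (Finset.mem_univ _), hpX, hF0]
    simp_rw [hpX, mul_add, Finset.sum_add_distrib, mul_ite, mul_zero]
    rw [Finset.sum_ite_eq', if_pos (Finset.mem_univ _)]
    have e1 : ∑ x, -(v (Fin.rev 0) * v x) * -pd x D.F v
        = v (Fin.rev 0) * ∑ x, v x * pd x D.F v := by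
      rw [Finset.mul_sum]; exact Finset.sum_congr rfl fun _ _ => by ring
    have e2 : ∑ x : Fin n, -(v (Fin.rev 0) * v x) * (v 0 * v x.rev)
        = -(v (Fin.rev 0) * v 0 * D.sqNorm v) := by
      rw [hs, Finset.mul_sum, ← Finset.sum_neg_distrib]
      exact Finset.sum_congr rfl fun _ _ => by ring
    rw [e1, e2]
    simp only [gradDensity, hne, if_true, if_false, hXdef]
    field_simp
    ring
  simp_rw [hN.inversionMatrix_other hv b0 b1, sub_mul, ite_mul, zero_mul, Finset.sum_sub_distrib]
  rw [Finset.sum_ite_eq', if_pos (Finset.mem_univ _), Finset.sum_ite_eq',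
    if_pos (Finset.mem_univ _), hpX, hpX, hF0]
  simp only [gradDensity, b0, b1, if_true, if_false]
  field_simp
  ring

omit h in
theorem pd_gradDensity (hv : v ∈ D.dom) (m γ : Fin n) :
    pd m (gradDensity D γ) v = if γ = 0 then (if m = 0 then -1 else 0)
      else if γ = Fin.rev 0 then ∑ k, v k * pd m (pd k D.F) v - pd m D.F v
      else -pd m (pd γ D.F) v := by
  have hFd := hF.smooth.differentiableAt_of_isOpen hF.isOpen hv
  have hd := fun γ => (hF.contDiffOn_pd γ).differentiableAt_of_isOpen hF.isOpen hv
  have hne := hN.rev_zero_ne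
  by_cases b0 : γ = 0
  · subst b0
    rw [show gradDensity D 0 = fun w => -w 0 by funext w; simp [gradDensity]]
    simp only [if_true]
    rw [pd_neg (by fun_prop), pd_coord]
    split_ifs <;> simp
  by_cases b1 : γ = Fin.rev 0
  · subst b1
    rw [show gradDensity D (Fin.rev 0) = fun w => ∑ γ, w γ * pd γ D.F w - 2 * D.F w by
      funext w; simp [gradDensity, hne]]
    simp only [if_true, hne, if_false]
    rw [pd_sub (by fun_prop) (by fun_prop), pd_const_mul _ hFd, pd_sum _ fun γ _ => by fun_prop]
    simp_rw [fun γ => pd_mul (f := fun w : Fin n → 𝕜 => w γ) (v := v) (by fun_prop) (hd γ) m,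
      pd_coord, Finset.sum_add_distrib]
    simp
    ring
  · rw [show gradDensity D γ = fun w => -pd γ D.F w by funext w; simp [gradDensity, b0, b1]]
    simp only [b0, b1, if_false]
    rw [pd_neg (hd γ)]

omit h in
-- This supplies the correction term η ∂_1φ in the Hessian formula when φ is v^n times a component
-- of the gradient of F̂.
theorem pd_zero_gradDensity (hv : v ∈ D.dom) (γ : Fin n) :
    pd 0 (gradDensity D γ) v = -(v (Fin.rev 0) * D.type2Coord v γ.rev) := by
  have hw := hN.last_ne_zero v hv
  have hne := hN.rev_zero_ne
  rw [pd_gradDensity hN hF hv]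
  by_cases b0 : γ = 0
  · subst b0
    rw [hN.coord_last]
    simp [hw]
  by_cases b1 : γ = Fin.rev 0
  · subst b1
    rw [Fin.rev_rev, IsType2Normalized.coord_zero]
    simp only [hne, if_false, if_true]
    simp_rw [fun k => hF.pd_swap hv 0 k, pd_pd_zero hN hF hv]
    rw [← hN.sqNorm_eq, hN.potential v hv]
    field_simp
    ring
  · rw [IsType2Normalized.coord_other v (IsType2Normalized.rev_ne_zero b1)
      (IsType2Normalized.rev_ne_last b0)]
    simp only [b0, b1, if_false]
    rw [hF.pd_swap hv, pd_pd_zero hN hF hv]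
    field_simp

omit h in
-- The column γ of M appears by itself: its entries are the coefficients with which first
-- derivatives of F enter the density. The first row of M would add a multiple of η through the
-- unit, and the last summand removes it.
theorem pd_pd_gradDensity (hv : v ∈ D.dom) (l m γ : Fin n) :
    pd l (pd m (gradDensity D γ)) v
      = -(∑ k, D.inversionMatrix v k γ * pd k (pd l (pd m D.F)) v
          + D.type2Coord v γ.rev * D.η l m) := by
  have hd := fun γ => (hF.contDiffOn_pd γ).differentiableAt_of_isOpen hF.isOpen hv
  have hd2 := fun α γ => (hF.contDiffOn_pd₂ α γ).differentiableAt_of_isOpen hF.isOpen hv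
  have hne := hN.rev_zero_ne
  rw [pd_congr hF.isOpen (fun w hw => pd_gradDensity hN hF hw m γ) hv]
  have e : ∑ k, D.inversionMatrix v k γ * pd k (pd l (pd m D.F)) v
      = (if γ = 0 then 0 else if γ = Fin.rev 0 then -∑ k, v k * pd k (pd l (pd m D.F)) v
          else pd γ (pd l (pd m D.F)) v) - D.type2Coord v γ.rev * D.η l m := by
    simp only [inversionMatrix, Matrix.of_apply, sub_mul, Finset.sum_sub_distrib, ite_mul,
      zero_mul]
    rw [Finset.sum_ite_eq', if_pos (Finset.mem_univ _), metric_zero hN hF hv]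
    congr 1
    split_ifs
    · simp
    · simp
    · simp
  rw [e, sub_add_cancel]
  by_cases b0 : γ = 0
  · simp [b0, pd_const]
  by_cases b1 : γ = Fin.rev 0
  · simp only [b1, if_true, hne, if_false]
    rw [pd_sub (by fun_prop) (hd m), pd_sum _ fun γ _ => by fun_prop]
    simp_rw [fun γ => pd_mul (f := fun w : Fin n → 𝕜 => w γ) (v := v) (by fun_prop) (hd2 m γ) l,
      pd_coord, Finset.sum_add_distrib]
    have e3 : ∀ k, pd l (pd m (pd k D.F)) v = pd k (pd l (pd m D.F)) v := fun k => by
      rw [hF.pd₃_swap_right hv, hF.pd₃_swap_left hv]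
    simp [e3, hF.pd_swap hv m l]
  · simp only [b0, b1, if_false]
    rw [pd_neg (hd2 m γ), hF.pd₃_swap_right hv, hF.pd₃_swap_left hv]

/-- The multiple of η in the Hessian of the density and the one in the quotient formula cancel,
because M preserves η. What remains is a tensorial transformation of the third derivatives, one
factor M per index. -/
theorem pd₃_eq (hv : v ∈ D.dom) (α β γ : Fin n) :
    pd α (pd β (pd γ D'.F)) (D.type2Coord v)
      = -v (Fin.rev 0) * ∑ l, ∑ m, D.inversionMatrix v l α * D.inversionMatrix v m β
          * ∑ k, D.inversionMatrix v k γ * pd k (pd l (pd m D.F)) v := by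
  rw [hN.pd_pd_of_div hF (contDiffOn_gradDensity hF γ) (fun w hw => h.pd_eq hN hF hw γ) hv,
    pd_zero_gradDensity hN hF hv, ← hN.sum_mul_sum_eta hv, Finset.mul_sum, Finset.mul_sum,
    Finset.sum_mul, ← Finset.sum_sub_distrib]
  refine Finset.sum_congr rfl fun l _ => ?_
  rw [Finset.mul_sum, Finset.mul_sum, Finset.sum_mul, ← Finset.sum_sub_distrib]
  refine Finset.sum_congr rfl fun m _ => ?_
  rw [pd_pd_gradDensity hN hF hv]
  ring

end IsType2

end FrobeniusData

/-! ### Type 2: the WDVV equations for F̂. -/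

namespace FrobeniusData

variable {𝕜 : Type*} [RCLike 𝕜] {n : ℕ} [NeZero n] {D D' : FrobeniusData 𝕜 n} {v : Fin n → 𝕜}

namespace IsType2Normalized

variable (h : D.IsType2Normalized)
include h

theorem c_eq (α β γ : Fin n) : D.c α β γ v = pd α.rev (pd β (pd γ D.F)) v := by
  simp [c, h.inv_eta, h.η]

variable (hF : D.IsWDVV)
include hF

theorem mu_rev (α : Fin n) : D.μ α.rev = -D.μ α := by
  have := hF.mu_add_mul_eta α α.rev
  rw [h.η, if_pos rfl] at this
  linear_combination this

theorem mu_zero : D.μ 0 = -(D.d / 2) := h.unit ▸ hF.charge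

theorem mu_last : D.μ (Fin.rev 0) = D.d / 2 := by
  rw [h.mu_rev hF, h.mu_zero hF, neg_neg]

omit hF in
theorem eulerDeriv_coord (α : Fin n) :
    D.eulerDeriv (fun w => w α) v = (1 - D.d / 2 - D.μ α) * v α := by
  rw [FrobeniusData.eulerDeriv_coord, h.r, Pi.zero_apply, add_zero]

theorem eulerDeriv_last : D.eulerDeriv (fun w => w (Fin.rev 0)) v = (1 - D.d) * v (Fin.rev 0) := by
  rw [h.eulerDeriv_coord, h.mu_last hF]
  ring

theorem eulerDeriv_sqNorm : D.eulerDeriv D.sqNorm v = (2 - D.d) * D.sqNorm v := by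
  rw [eulerDeriv_eq_sum differentiableAt_sqNorm, h.sqNorm_eq]
  have e0 : ∑ γ, D.μ γ * v γ * v γ.rev = 0 := by
    have : ∑ γ, D.μ γ * v γ * v γ.rev = ∑ γ : Fin n, -(D.μ γ * v γ * v γ.rev) := by
      rw [← Equiv.sum_comp Fin.revPerm]
      refine Finset.sum_congr rfl fun γ _ => ?_
      rw [Fin.revPerm_apply, Fin.rev_rev, h.mu_rev hF]
      ring
    rw [Finset.sum_neg_distrib] at this
    linear_combination (1 / 2 : 𝕜) * this
  have e1 : ∀ γ, D.euler v γ * pd γ D.sqNorm v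
      = (2 - D.d) * (v γ * v γ.rev) - 2 * (D.μ γ * v γ * v γ.rev) := fun γ => by
    rw [h.pd_sqNorm, euler, h.r, Pi.zero_apply]
    ring
  simp_rw [e1, Finset.sum_sub_distrib, ← Finset.mul_sum]
  rw [e0]
  ring

variable {A : Matrix (Fin n) (Fin n) 𝕜} {B : Fin n → 𝕜} {C : 𝕜}

/-- The derivative ∂_1F = ½η_{αβ}v^αv^β is exactly homogeneous, so the inhomogeneous terms in its
Euler derivative vanish identically on an open set. -/
theorem quasi_zero (hq : D.IsQuasiHomogeneous A B C) : (∀ β, A 0 β = 0) ∧ B 0 = 0 := by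
  have e : ∀ v ∈ D.dom, ∑ β, A 0 β * v β + B 0 = 0 := fun v hv => by
    have h1 := hF.eulerDeriv_pd hq hv 0
    rw [eulerDeriv_congr hF.isOpen h.potential hv,
      eulerDeriv_const_mul _ differentiableAt_sqNorm, h.eulerDeriv_sqNorm hF, h.potential v hv,
      h.mu_zero hF] at h1
    linear_combination -h1
  obtain ⟨v, hv⟩ := hF.isConnected.nonempty
  have hA : ∀ β, A 0 β = 0 := fun β => by
    have h1 := pd_congr hF.isOpen e hv β
    rwa [pd_add (by fun_prop) (by fun_prop), pd_linear, pd_const, pd_const, add_zero] at h1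
  exact ⟨hA, by simpa [hA] using e v hv⟩

end IsType2Normalized

namespace IsType2

variable (h : D.IsType2 D') (hN : D.IsType2Normalized) (hF : D.IsWDVV)
include h hN hF

omit hF in
theorem c_eq_pd (α β γ : Fin n) :
    D'.c α β γ (D.type2Coord v) = pd α.rev (pd β (pd γ D'.F)) (D.type2Coord v) := by
  simp [c, h.η, hN.inv_eta, hN.η]

/-- Raising one index by η turns one factor M into the Jacobian. As M is the inverse Jacobian up to
a scalar, the new multiplication matrices are scaled conjugates of combinations of the old ones, and
commutativity survives. -/
theorem multMatrix_eq (hv : v ∈ D.dom) (α : Fin n) :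
    D'.multMatrix (D.type2Coord v) α
      = -(v (Fin.rev 0) ^ 2) • (jacobian D.type2Coord v
          * (∑ m, D.inversionMatrix v m α • D.multMatrix v m) * D.inversionMatrix v) := by
  have hw := hN.last_ne_zero v hv
  ext γ β
  have hM : ∀ l, D.inversionMatrix v l.rev γ.rev
      = v (Fin.rev 0) * jacobian D.type2Coord v γ l := fun l => by
    have := hN.inversionMatrix_eq_jacobian hv γ.rev l
    rw [Fin.rev_rev] at this
    refine mul_left_cancel₀ hw (this.trans (by ring))
  rw [multMatrix, Matrix.of_apply, h.c_eq_pd hN, h.pd₃_eq hN hF hv, Matrix.smul_apply,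
    smul_eq_mul, Matrix.mul_assoc, Matrix.mul_apply, ← Equiv.sum_comp Fin.revPerm, Finset.mul_sum,
    Finset.mul_sum]
  refine Finset.sum_congr rfl fun l _ => ?_
  simp_rw [Fin.revPerm_apply, hM, Matrix.mul_apply, Matrix.sum_apply, Matrix.smul_apply,
    multMatrix, Matrix.of_apply, hN.c_eq, smul_eq_mul, Finset.mul_sum, Finset.sum_mul,
    Finset.mul_sum]
  rw [Finset.sum_comm]
  refine Finset.sum_congr rfl fun k _ => Finset.sum_congr rfl fun m _ => ?_
  rw [hF.pd₃_swap_left hv k, hF.pd₃_swap_right hv l.rev k m]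
  ring

theorem pd₃_swap (hv : v ∈ D.dom) (α β γ : Fin n) :
    pd α (pd β (pd γ D'.F)) (D.type2Coord v) = pd α (pd γ (pd β D'.F)) (D.type2Coord v) :=
  pd_congr (h.isOpen_dom hN hF)
    (fun _ hw => pd_comm (h.smooth hN hF) (h.isOpen_dom hN hF) hw β γ) (h.mem_dom hv) α

theorem assoc (hv : v ∈ D.dom) (α β γ ν : Fin n) :
    ∑ l, D'.c l α β (D.type2Coord v) * D'.c ν l γ (D.type2Coord v)
      = ∑ l, D'.c l γ β (D.type2Coord v) * D'.c ν l α (D.type2Coord v) := by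
  have e : ∀ α γ, ∑ l, D'.c l α β (D.type2Coord v) * D'.c ν l γ (D.type2Coord v)
      = (D'.multMatrix (D.type2Coord v) γ * D'.multMatrix (D.type2Coord v) α) ν β := by
    intro α γ
    rw [Matrix.mul_apply]
    refine Finset.sum_congr rfl fun l _ => ?_
    simp only [multMatrix, Matrix.of_apply]
    rw [h.c_eq_pd hN ν γ l, h.c_eq_pd hN ν l γ, h.pd₃_swap hN hF hv _ γ l]
    ring
  rw [e, e]
  suffices hc : Commute (D'.multMatrix (D.type2Coord v) γ) (D'.multMatrix (D.type2Coord v) α) by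
    rw [hc.eq]
  have hw := hN.last_ne_zero v hv
  have hMK : D.inversionMatrix v * jacobian D.type2Coord v = (v (Fin.rev 0))⁻¹ • 1 := by
    rw [← hN.mul_jacobian hv, Matrix.smul_mul, smul_smul, inv_mul_cancel₀ hw, one_smul]
  have key : ∀ N N' : Matrix (Fin n) (Fin n) 𝕜,
      (jacobian D.type2Coord v * N * D.inversionMatrix v)
        * (jacobian D.type2Coord v * N' * D.inversionMatrix v)
      = (v (Fin.rev 0))⁻¹ • (jacobian D.type2Coord v * (N * N') * D.inversionMatrix v) := by
    intro N N'
    have : (jacobian D.type2Coord v * N * D.inversionMatrix v)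
        * (jacobian D.type2Coord v * N' * D.inversionMatrix v)
        = jacobian D.type2Coord v * N * (D.inversionMatrix v * jacobian D.type2Coord v) * N'
          * D.inversionMatrix v := by simp only [Matrix.mul_assoc]
    rw [this, hMK]
    simp [Matrix.mul_assoc]
  rw [h.multMatrix_eq hN hF hv, h.multMatrix_eq hN hF hv]
  refine Commute.smul_left (Commute.smul_right ?_ _) _
  rw [Commute, SemiconjBy, key, key]
  have : Commute (∑ m, D.inversionMatrix v m γ • D.multMatrix v m)
      (∑ m, D.inversionMatrix v m α • D.multMatrix v m) :=
    Commute.sum_left _ _ _ fun m _ => Commute.sum_right _ _ _ fun m' _ =>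
      Commute.smul_left (Commute.smul_right (hF.multMatrix_comm hv m' m) _) _
  rw [this.eq]

/-- The first column of M is −1/v^n times the unit field. Contracting the third derivatives with it
gives η, which M preserves. -/
theorem metric (hv : v ∈ D.dom) (α β : Fin n) :
    pd 0 (pd α (pd β D'.F)) (D.type2Coord v) = D.η α β := by
  have hw := hN.last_ne_zero v hv
  have hM : ∀ l, D.inversionMatrix v l 0 = if l = 0 then -(v (Fin.rev 0))⁻¹ else 0 := fun l => by
    refine mul_left_cancel₀ hw ?_
    rw [hN.inversionMatrix_zero hv]
    split_ifs <;> simp [hw]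
  rw [pd_comm ((h.smooth hN hF).pd (h.isOpen_dom hN hF) β) (h.isOpen_dom hN hF) (h.mem_dom hv),
    h.pd₃_swap hN hF hv, h.pd₃_eq hN hF hv, ← hN.sum_mul_sum_eta hv, Finset.mul_sum]
  refine Finset.sum_congr rfl fun l _ => ?_
  rw [Finset.mul_sum]
  refine Finset.sum_congr rfl fun m _ => ?_
  simp_rw [hM, ite_mul, zero_mul]
  rw [Finset.sum_ite_eq', if_pos (Finset.mem_univ _), metric_zero hN hF hv]
  field_simp

/-- The function v^n has Euler weight 1 − d and η_{σγ}v^σv^γ has weight 2 − d; the weights of the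
quotients are those prescribed by d̂ and μ̂. -/
theorem euler_eq (hv : v ∈ D.dom) (α : Fin n) :
    D'.euler (D.type2Coord v) α
      = lineDeriv 𝕜 (fun w => D.type2Coord w α) v (D.euler v) := by
  have hw := hN.last_ne_zero v hv
  have hsd := IsType2Normalized.differentiableAt_sqNorm (D := D) (v := v)
  have hwd : DifferentiableAt 𝕜 (fun w : Fin n → 𝕜 => w (Fin.rev 0)) v := by fun_prop
  have hid : DifferentiableAt 𝕜 (fun w : Fin n → 𝕜 => (w (Fin.rev 0))⁻¹) v := hwd.inv hw
  change _ = D.eulerDeriv (fun w => D.type2Coord w α) v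
  rw [euler, h.r, h.d, h.μ, Pi.zero_apply]
  have hne := hN.rev_zero_ne
  by_cases h0 : α = 0
  · subst h0
    simp_rw [IsType2Normalized.coord_zero, div_eq_mul_inv]
    rw [eulerDeriv_mul (by fun_prop) hid, eulerDeriv_const_mul _ hsd, eulerDeriv_inv hwd hw,
      hN.eulerDeriv_sqNorm hF, hN.eulerDeriv_last hF]
    simp only [flip, delta, Equiv.swap_apply_left, hN.mu_last hF, if_true, hne.symm, if_false]
    field_simp
    push_cast
    ring
  by_cases h1 : α = Fin.rev 0
  · subst h1
    simp_rw [hN.coord_last, one_div]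
    rw [eulerDeriv_inv hwd hw, hN.eulerDeriv_last hF]
    simp only [flip, delta, Equiv.swap_apply_right, hN.mu_zero hF, if_true, hne, if_false]
    field_simp
    push_cast
    ring
  · simp_rw [IsType2Normalized.coord_other _ h0 h1, div_eq_mul_inv]
    rw [eulerDeriv_mul (by fun_prop) hid, eulerDeriv_inv hwd hw,
      hN.eulerDeriv_coord, hN.eulerDeriv_last hF]
    simp only [flip, delta, Equiv.swap_apply_of_ne_of_ne h0 h1, h0, h1, if_false]
    field_simp
    push_cast
    ring

theorem eulerDeriv_eq {f f' : (Fin n → 𝕜) → 𝕜} (hf : ContDiffOn 𝕜 ∞ f' D'.dom)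
    (e : ∀ w ∈ D.dom, f' (D.type2Coord w) = f w) (hv : v ∈ D.dom) :
    D'.eulerDeriv f' (D.type2Coord v) = D.eulerDeriv f v := by
  rw [h.dom] at hf
  rw [eulerDeriv, (hN.isCoordChange hF).lineDeriv_image hf hv (h.euler_eq hN hF hv)]
  exact eulerDeriv_congr hF.isOpen e hv

/-- The derivative of `φ / v^n` along the Euler vector field. -/
theorem eulerDeriv_of_div {φ f' : (Fin n → 𝕜) → 𝕜} (hφ : ContDiffOn 𝕜 ∞ φ D.dom)
    (e : ∀ w ∈ D.dom, f' (D.type2Coord w) = φ w / w (Fin.rev 0)) (hv : v ∈ D.dom) :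
    D'.eulerDeriv f' (D.type2Coord v)
      = (D.eulerDeriv φ v - (1 - D.d) * φ v) / v (Fin.rev 0) := by
  have hw := hN.last_ne_zero v hv
  have hd := hφ.differentiableAt_of_isOpen hF.isOpen hv
  have hwd : DifferentiableAt 𝕜 (fun w : Fin n → 𝕜 => w (Fin.rev 0)) v := by fun_prop
  have hf' : ContDiffOn 𝕜 ∞ f' D'.dom := by
    rw [h.dom]
    exact hN.contDiffOn_of_div hF hφ e
  rw [h.eulerDeriv_eq hN hF hf' e hv]
  simp_rw [div_eq_mul_inv]
  have hid : DifferentiableAt 𝕜 (fun w : Fin n → 𝕜 => (w (Fin.rev 0))⁻¹) v := hwd.inv hw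
  rw [eulerDeriv_mul hd hid, eulerDeriv_inv hwd hw, hN.eulerDeriv_last hF]
  field_simp
  ring

theorem quasi : ∃ A B C, D'.IsQuasiHomogeneous A B C := by
  obtain ⟨A, B, C, hq⟩ := hF.quasi
  obtain ⟨hA, hB⟩ := hN.quasi_zero hF hq
  -- For α ≠ 1 these affine functions of v̂ represent v^α/v^n. The quotient v^1/v^n is not affine in
  -- v̂, but its coefficients A_{1β} and B_1 vanish, so L may be 0 there.
  let L : Fin n → (Fin n → 𝕜) → 𝕜 := fun α w =>
    if α = 0 then 0 else if α = Fin.rev 0 then 1 else w α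
  have hL : ∀ α, IsAffineOn (L α) D'.dom := fun α => by
    simp only [L]
    by_cases h0 : α = 0
    · simpa [h0] using isAffineOn_const 0
    by_cases h1 : α = Fin.rev 0
    · simpa [h1, hN.rev_zero_ne] using isAffineOn_const 1
    simpa [h0, h1] using isAffineOn_coord α
  have hlast : IsAffineOn (fun w : Fin n → 𝕜 => w (Fin.rev 0)) D'.dom := isAffineOn_coord _
  have hQ : IsQuadraticOn (fun w => -1 * ((1 / 2) * ∑ α, ∑ β, A α β * (L α w * L β w)
      + ∑ α, B α * (L α w * w (Fin.rev 0)) + C * (w (Fin.rev 0) * w (Fin.rev 0)))) D'.dom := by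
    refine IsQuadraticOn.const_mul _ (((IsQuadraticOn.const_mul _ ?_).add ?_).add ?_)
    · exact IsQuadraticOn.sum _ fun α _ => IsQuadraticOn.sum _ fun β _ =>
        ((hL α).mul (hL β)).const_mul _
    · exact IsQuadraticOn.sum _ fun α _ => ((hL α).mul hlast).const_mul _
    · exact (hlast.mul hlast).const_mul _
  obtain ⟨A', B', C', hA', hB'⟩ := hQ
  refine ⟨A', B', C', hA', fun v' hv' => ?_⟩
  rw [add_assoc, add_assoc, ← add_assoc (1 / 2 * _), ← hB' v' hv']
  obtain ⟨v, hv, rfl⟩ : v' ∈ D.type2Coord '' D.dom := h.dom ▸ hv'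
  have hw := hN.last_ne_zero v hv
  have hLv : ∀ α, α ≠ 0 → L α (D.type2Coord v) = v α / v (Fin.rev 0) := fun α h0 => by
    simp only [L]
    by_cases h1 : α = Fin.rev 0
    · simp [h1, hN.rev_zero_ne, hw]
    simp [h0, h1, IsType2Normalized.coord_other v h0 h1]
  have eA : ∑ α, ∑ β, A α β * (L α (D.type2Coord v) * L β (D.type2Coord v))
      = (∑ α, ∑ β, A α β * v α * v β) / v (Fin.rev 0) ^ 2 := by
    rw [Finset.sum_div]
    refine Finset.sum_congr rfl fun α _ => ?_
    rw [Finset.sum_div]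
    refine Finset.sum_congr rfl fun β _ => ?_
    by_cases h0 : α = 0
    · simp [h0, hA]
    by_cases h1 : β = 0
    · simp [h1, hq.1.apply 0 α, hA]
    rw [hLv α h0, hLv β h1]
    field_simp
  have eB : ∑ α, B α * (L α (D.type2Coord v) * D.type2Coord v (Fin.rev 0))
      = (∑ α, B α * v α) / v (Fin.rev 0) ^ 2 := by
    rw [Finset.sum_div]
    refine Finset.sum_congr rfl fun α _ => ?_
    by_cases h0 : α = 0
    · simp [h0, hB]
    rw [hLv α h0, hN.coord_last]
    field_simp
  simp only [eA, eB]
  rw [hN.coord_last, h.d]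
  have hid : DifferentiableAt 𝕜 (fun w : Fin n → 𝕜 => (w (Fin.rev 0))⁻¹) v :=
    DifferentiableAt.inv (by fun_prop) hw
  have hFd := hF.smooth.differentiableAt_of_isOpen hF.isOpen hv
  have hsd := IsType2Normalized.differentiableAt_sqNorm (D := D) (v := v)
  have hwd : DifferentiableAt 𝕜 (fun w : Fin n → 𝕜 => w (Fin.rev 0)) v := by fun_prop
  have hXd : DifferentiableAt 𝕜 (fun v => -D.F v + 1 / 2 * (v 0 * D.sqNorm v)) v := by fun_prop
  rw [h.eulerDeriv_of_div hN hF (φ := fun v =>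
    (-D.F v + 1 / 2 * (v 0 * D.sqNorm v)) * (v (Fin.rev 0))⁻¹)
    ((contDiffOn_potential hF).mul (ContDiffOn.inv (by fun_prop) hN.last_ne_zero))
    (fun w hw' => by
      have := hN.last_ne_zero w hw'
      rw [h.potential w hw']
      field_simp) hv, h.potential v hv, eulerDeriv_mul hXd hid, eulerDeriv_inv hwd hw,
    hN.eulerDeriv_last hF]
  have e1 : D.eulerDeriv (fun v => -D.F v + 1 / 2 * (v 0 * D.sqNorm v)) v
      = -((3 - D.d) * D.F v + 1 / 2 * ∑ α, ∑ β, A α β * v α * v β + ∑ α, B α * v α + C)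
        + 1 / 2 * ((3 - D.d) * (v 0 * D.sqNorm v)) := by
    rw [eulerDeriv_add (by fun_prop) (by fun_prop), eulerDeriv_const_mul _ (by fun_prop),
      eulerDeriv_mul (by fun_prop) hsd, hN.eulerDeriv_coord, hN.mu_zero hF,
      hN.eulerDeriv_sqNorm hF, ← hq.2 v hv, show (fun w => -D.F w) = fun w => -1 * D.F w by
        simp, eulerDeriv_const_mul _ hFd]
    ring
  rw [e1]
  field_simp
  ring

theorem isWDVV : D'.IsWDVV where
  isOpen := h.isOpen_dom hN hF
  isConnected := by
    rw [h.dom]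
    exact (hN.isCoordChange hF).isConnected_image hF.isConnected
  smooth := h.smooth hN hF
  metric := by
    intro v' hv' α β
    obtain ⟨v, hv, rfl⟩ : v' ∈ D.type2Coord '' D.dom := h.dom ▸ hv'
    rw [h.unit, h.η, h.metric hN hF hv]
  nondegenerate := by
    rw [h.η]
    exact hF.nondegenerate
  assoc := by
    intro v' hv' α β γ ν
    obtain ⟨v, hv, rfl⟩ : v' ∈ D.type2Coord '' D.dom := h.dom ▸ hv'
    exact h.assoc hN hF hv α β γ ν
  charge := by
    rw [h.unit, h.μ, h.d]
    simp only [flip, delta, Equiv.swap_apply_left, hN.mu_last hF, if_true, hN.rev_zero_ne.symm,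
      if_false]
    push_cast
    ring
  quasi := h.quasi hN hF

end IsType2

end FrobeniusData

/-! ### Type 2: the matrices R̂ and Euler derivatives of the densities. -/

namespace FrobeniusData

variable {𝕜 : Type*} [RCLike 𝕜] {n : ℕ} {D D' : FrobeniusData 𝕜 n} {v : Fin n → 𝕜}

/-- The matrices `R_l` extended by zero to `l ∈ ℤ`. -/
def intR (D : FrobeniusData 𝕜 n) (l : ℤ) : Matrix (Fin n) (Fin n) 𝕜 :=
  if 0 < l then D.R l.toNat else 0

theorem intR_natCast (hθ : D.IsCalibration) (k : ℕ) : D.intR k = D.R k := by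
  rcases Nat.eq_zero_or_pos k with rfl | hk
  · simp [intR, hθ.R_zero]
  · simp [intR, hk]

theorem intR_of_nonpos {l : ℤ} (hl : l ≤ 0) : D.intR l = 0 := by
  simp [intR, not_lt.2 hl]

/-- Reindexing by j = p − k makes the summation bound arbitrary, since `intR` vanishes for j ≥ p.
The index shifts by ±1 of type 2 then cost nothing. -/
theorem sum_Icc_R (g : Fin n → ℕ → 𝕜) {p M : ℕ} (hM : p ≤ M) (α : Fin n) :
    ∑ k ∈ Finset.Icc 1 p, ∑ ε, g ε (p - k) * D.R k ε α
      = ∑ ε, ∑ j ∈ Finset.range M, g ε j * D.intR ((p : ℤ) - j) ε α := by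
  rw [Finset.sum_comm]
  refine Finset.sum_congr rfl fun ε _ => ?_
  rw [← Finset.sum_subset (Finset.range_subset_range.2 hM)]
  · refine Finset.sum_nbij' (fun k => p - k) (fun j => p - j) ?_ ?_ ?_ ?_ ?_
    · intro k hk; simp only [Finset.mem_Icc, Finset.mem_range] at *; omega
    · intro k hk; simp only [Finset.mem_Icc, Finset.mem_range] at *; omega
    · intro k hk; simp only [Finset.mem_Icc] at hk; omega
    · intro k hk; simp only [Finset.mem_range] at hk; omega
    · intro k hk
      simp only [Finset.mem_Icc] at hk
      rw [intR, if_pos (by omega)]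
      congr 3
      omega
  · intro j _ hj
    simp only [Finset.mem_range, not_lt] at hj
    rw [intR_of_nonpos (by omega), Matrix.zero_apply, mul_zero]

variable [NeZero n]

/-- The sign `-1` for the last index and `1` for the others. -/
def lastSign (𝕜 : Type*) [RCLike 𝕜] (α : Fin n) : 𝕜 := if α = Fin.rev 0 then -1 else 1

theorem lastSign_mul_self (α : Fin n) : lastSign 𝕜 α * lastSign 𝕜 α = 1 := by
  unfold lastSign; split_ifs <;> norm_num

theorem delta_zero (hne : (Fin.rev 0 : Fin n) ≠ 0) : delta (0 : Fin n) = 1 := by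
  simp [delta, hne.symm]

theorem delta_last (hne : (Fin.rev 0 : Fin n) ≠ 0) : delta (Fin.rev 0 : Fin n) = -1 := by
  simp [delta, hne]

theorem delta_other {α : Fin n} (h0 : α ≠ 0) (h1 : α ≠ Fin.rev 0) : delta α = 0 := by
  simp [delta, h0, h1]

theorem flip_zero : flip (0 : Fin n) = Fin.rev 0 := Equiv.swap_apply_left _ _

theorem flip_last : flip (Fin.rev 0 : Fin n) = 0 := Equiv.swap_apply_right _ _

theorem flip_other {α : Fin n} (h0 : α ≠ 0) (h1 : α ≠ Fin.rev 0) : flip α = α :=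
  Equiv.swap_apply_of_ne_of_ne h0 h1

/-- The functions `v^n θ̂_{α,p}`. -/
def type2Density (D : FrobeniusData 𝕜 n) (α : Fin n) (p : ℕ) : (Fin n → 𝕜) → 𝕜 := fun v =>
  if α = 0 ∧ p = 0 then 1
  else lastSign 𝕜 α * (-1) ^ p * D.θ (flip α) ((p : ℤ) - delta α).toNat v

theorem type2Density_zero_zero : D.type2Density 0 0 = fun _ => 1 := by
  funext v; simp [type2Density]

theorem type2Density_eq {α : Fin n} {p q : ℕ} (h : ¬(α = 0 ∧ p = 0))
    (hq : (q : ℤ) = p - delta α) :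
    D.type2Density α p = fun v => lastSign 𝕜 α * (-1) ^ p * D.θ (flip α) q v := by
  funext v; simp [type2Density, h, ← hq]

/-- Only the pair (1,0) would be sent to the negative level −1. -/
theorem exists_type2_index (hne : (Fin.rev 0 : Fin n) ≠ 0) {α : Fin n} {p : ℕ}
    (h : ¬(α = 0 ∧ p = 0)) : ∃ q : ℕ, (q : ℤ) = p - delta α := by
  refine ⟨((p : ℤ) - delta α).toNat, Int.toNat_of_nonneg ?_⟩
  by_cases h0 : α = 0
  · subst h0
    rw [delta_zero hne]
    have : p ≠ 0 := fun e => h ⟨rfl, e⟩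
    omega
  by_cases h1 : α = Fin.rev 0
  · subst h1
    rw [delta_last hne]
    omega
  · rw [delta_other h0 h1]
    omega

theorem type2Density_zero_succ (hne : (Fin.rev 0 : Fin n) ≠ 0) (p : ℕ) :
    D.type2Density 0 (p + 1) = fun v => (-1) ^ (p + 1) * D.θ (Fin.rev 0) p v := by
  rw [type2Density_eq (q := p) (by simp) (by rw [delta_zero hne]; push_cast; ring), flip_zero]
  simp [lastSign, hne.symm]

theorem type2Density_last (hne : (Fin.rev 0 : Fin n) ≠ 0) (p : ℕ) :
    D.type2Density (Fin.rev 0) p = fun v => (-1) ^ (p + 1) * D.θ 0 (p + 1) v := by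
  rw [type2Density_eq (q := p + 1) (by simp [hne]) (by rw [delta_last hne]; push_cast; ring),
    flip_last]
  simp [lastSign, pow_succ]

theorem type2Density_other {α : Fin n} (h0 : α ≠ 0) (h1 : α ≠ Fin.rev 0) (p : ℕ) :
    D.type2Density α p = fun v => (-1) ^ p * D.θ α p v := by
  rw [type2Density_eq (q := p) (by simp [h0]) (by rw [delta_other h0 h1]; ring),
    flip_other h0 h1]
  simp [lastSign, h1]

namespace IsType2Normalized

variable (hN : D.IsType2Normalized) (hF : D.IsWDVV) (hθ : D.IsCalibration)
include hN hθ

theorem theta_zero (hv : v ∈ D.dom) (α : Fin n) : D.θ α 0 v = v α.rev := by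
  rw [hθ.theta_zero v hv]
  simp [hN.η]

theorem pd_zero_theta (hv : v ∈ D.dom) (α : Fin n) (p : ℕ) :
    pd 0 (D.θ α (p + 1)) v = D.θ α p v := by
  have := hθ.unit_deriv v hv α p
  rwa [hN.unit] at this

include hF

theorem pd_theta_zero (hv : v ∈ D.dom) (α β : Fin n) :
    pd β (D.θ α 0) v = if β = α.rev then 1 else 0 := by
  rw [pd_congr hF.isOpen (fun w hw => hN.theta_zero hθ hw α) hv, pd_coord]

omit [NeZero n] hN in
theorem _root_.FrobeniusData.IsCalibration.differentiableAt (hv : v ∈ D.dom) (α : Fin n) (p : ℕ) :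
    DifferentiableAt 𝕜 (D.θ α p) v := (hθ.smooth α p).differentiableAt_of_isOpen hF.isOpen hv

/-- Since ∂_1θ_{α,p+1} = θ_{α,p}, the homogeneity of gradients at level p + 1 in direction 1 is a
homogeneity of θ_{α,p} itself. The term of level 0 is the constant R_{p+1}. -/
theorem eulerDeriv_theta (hv : v ∈ D.dom) (α : Fin n) {p M : ℕ} (hM : p + 1 ≤ M) :
    D.eulerDeriv (D.θ α p) v = ((p : 𝕜) + 1 - D.d / 2 + D.μ α) * D.θ α p v
      + ∑ ε, ∑ j ∈ Finset.range M, D.θ ε j v * D.intR ((p : ℤ) - j) ε α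
      + D.R (p + 1) (Fin.rev 0) α := by
  have h1 := hθ.homogeneous v hv α 0 (p + 1)
  rw [eulerDeriv_congr hF.isOpen (fun w hw => hN.pd_zero_theta hθ hw α p) hv,
    hN.pd_zero_theta hθ hv] at h1
  have h2 := sum_Icc_R (D := D) (fun ε j => pd 0 (D.θ ε j) v) (show p + 1 ≤ M + 1 by omega) α
  simp only [Finset.sum_range_succ', hN.pd_zero_theta hθ hv, hN.pd_theta_zero hF hθ hv,
    Finset.sum_add_distrib] at h2
  rw [h1, h2, hN.mu_zero hF]
  have h3 : ∑ x : Fin n, (if (0 : Fin n) = x.rev then (1 : 𝕜) else 0)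
      * D.intR (((p + 1 : ℕ) : ℤ) - ((0 : ℕ) : ℤ)) x α = D.R (p + 1) (Fin.rev 0) α := by
    rw [Finset.sum_eq_single (Fin.rev 0)]
    · rw [Fin.rev_rev, if_pos rfl, one_mul, Int.natCast_zero, sub_zero, intR_natCast hθ]
    · intro b _ hb
      rw [if_neg, zero_mul]
      intro e
      exact hb (by rw [e, Fin.rev_rev])
    · simp
  rw [h3]
  push_cast
  simp only [add_sub_add_right_eq_sub]
  ring

/-- The normalization of `θ_{1,1}` determines the first columns of `R_1`, `R_2`. -/
theorem R_first_column : (∀ ε, D.R 1 ε 0 = 0) ∧ D.R 2 (Fin.rev 0) 0 = 0 := by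
  have e : ∀ v ∈ D.dom, ∑ ε, D.R 1 (ε.rev) 0 * v ε + D.R 2 (Fin.rev 0) 0 = 0 := fun v hv => by
    -- Here θ_{1,1} is the exactly homogeneous function ½η_{αβ}v^αv^β, so the affine function made
    -- of R_1 and R_2 must be zero.
    have h1 := hN.eulerDeriv_theta hF hθ hv 0 (p := 1) (M := 2) le_rfl
    rw [eulerDeriv_congr hF.isOpen hN.theta_one hv, eulerDeriv_const_mul _ differentiableAt_sqNorm,
      hN.eulerDeriv_sqNorm hF, hN.theta_one v hv, hN.mu_zero hF] at h1
    simp only [Finset.sum_range_succ, Finset.sum_range_zero, hN.theta_zero hθ hv,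
      Nat.cast_one, Int.natCast_zero, sub_zero, sub_self, zero_add,
      intR_of_nonpos (D := D) le_rfl, Matrix.zero_apply, mul_zero, add_zero] at h1
    have h2 : ∑ x : Fin n, v x.rev * D.intR 1 x 0 = ∑ ε, D.R 1 (ε.rev) 0 * v ε := by
      rw [← Equiv.sum_comp Fin.revPerm]
      refine Finset.sum_congr rfl fun ε _ => ?_
      rw [Fin.revPerm_apply, Fin.rev_rev, ← Nat.cast_one, intR_natCast hθ, mul_comm]
    rw [h2] at h1
    linear_combination -h1
  obtain ⟨v, hv⟩ := hF.isConnected.nonempty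
  have hA : ∀ β, D.R 1 (Fin.rev β) 0 = 0 := fun β => by
    have h1 := pd_congr hF.isOpen e hv β
    rwa [pd_add (by fun_prop) (by fun_prop), pd_linear, pd_const, pd_const, add_zero] at h1
  refine ⟨fun ε => by simpa using hA ε.rev, by simpa [hA] using e v hv⟩

/-- In degree 1 the matrix ηR_1 is symmetric, which exchanges the first column and the last row of
R_1. -/
theorem R_last_row (α : Fin n) : D.R 1 (Fin.rev 0) α = 0 := by
  have h1 := hθ.R_symm 1 le_rfl 0 α
  simp only [hN.η, ite_mul, one_mul, zero_mul, Finset.sum_ite_eq', Finset.mem_univ, if_true,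
    (hN.R_first_column hF hθ).1] at h1
  simpa using h1

/-- The shift δ(ε) − δ(α) is at most 2, so for k ≤ 0 only degrees 1 and 2 can be positive. The
entries reached lie in the first column or last row of R_1, or are the (n,1) entry of R_2, all
killed by the normalization of θ_{1,1}. -/
theorem intR_flip_eq_zero {k : ℤ} (hk : k ≤ 0) (ε α : Fin n) :
    D.intR (k + delta ε - delta α) (flip ε) (flip α) = 0 := by
  have hne := hN.rev_zero_ne
  obtain ⟨h1, h2⟩ := hN.R_first_column hF hθ
  have h3 := hN.R_last_row hF hθ
  by_cases hl : k + delta ε - delta α ≤ 0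
  · rw [intR_of_nonpos hl, Matrix.zero_apply]
  have key1 : k + delta ε - delta α = 1 → (flip ε = Fin.rev 0 ∨ flip α = 0) →
      D.intR (k + delta ε - delta α) (flip ε) (flip α) = 0 := by
    intro e e'
    rw [e, ← Nat.cast_one, intR_natCast hθ]
    rcases e' with e' | e' <;> rw [e']
    · exact h3 _
    · exact h1 _
  by_cases e0 : ε = 0
  · subst e0
    by_cases a0 : α = 0
    · subst a0; omega
    by_cases a1 : α = Fin.rev 0
    · subst a1
      rw [delta_zero hne, delta_last hne] at hl
      by_cases hk1 : k = 0
      · subst hk1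
        rw [delta_zero hne, delta_last hne, flip_zero, flip_last]
        rw [show (0 + 1 - -1 : ℤ) = ((2 : ℕ) : ℤ) by norm_num, intR_natCast hθ, h2]
      · exact key1 (by rw [delta_zero hne, delta_last hne]; omega) (Or.inl flip_zero)
    · exact key1 (by rw [delta_zero hne, delta_other a0 a1] at *; omega) (Or.inl flip_zero)
  by_cases e1 : ε = Fin.rev 0
  · subst e1
    rw [delta_last hne] at hl
    by_cases a0 : α = 0
    · subst a0; rw [delta_zero hne] at hl; omega
    by_cases a1 : α = Fin.rev 0
    · subst a1; rw [delta_last hne] at hl; omega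
    · rw [delta_other a0 a1] at hl; omega
  · rw [delta_other e0 e1] at hl
    by_cases a0 : α = 0
    · subst a0; rw [delta_zero hne] at hl; omega
    by_cases a1 : α = Fin.rev 0
    · subst a1
      exact key1 (by rw [delta_other e0 e1, delta_last hne] at *; omega) (Or.inr flip_last)
    · rw [delta_other a0 a1] at hl; omega

end IsType2Normalized

namespace IsType2

variable (h : D.IsType2 D') (hN : D.IsType2Normalized) (hF : D.IsWDVV) (hθ : D.IsCalibration)
include h hN hF hθ

/-- Valid for all integers k: the truncation in the definition of R̂ loses nothing, so later sums
may be reindexed freely. -/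
theorem intR_eq (k : ℤ) (ε α : Fin n) : D'.intR k ε α
    = (-1) ^ k * lastSign 𝕜 ε * lastSign 𝕜 α
      * D.intR (k + delta ε - delta α) (flip ε) (flip α) := by
  rcases le_or_gt k 0 with hk | hk
  · rw [intR_of_nonpos hk, Matrix.zero_apply, hN.intR_flip_eq_zero hF hθ hk, mul_zero]
  · obtain ⟨m, rfl⟩ : ∃ m : ℕ, k = m := ⟨k.toNat, by omega⟩
    rw [intR, if_pos hk, Int.toNat_natCast, h.R m (by omega), zpow_natCast, pow_add, pow_add]
    have : (if 0 < (m : ℤ) + delta ε - delta α then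
        D.R ((m : ℤ) + delta ε - delta α).toNat (flip ε) (flip α) else 0)
        = D.intR ((m : ℤ) + delta ε - delta α) (flip ε) (flip α) := by
      unfold intR
      split_ifs <;> rfl
    rw [this]
    simp only [lastSign]
    split_ifs <;> simp

/-- The homogeneity of θ in terms of the family Φ. The multiple of v^n becomes a constant after
division by v^n and then disappears from gradients. -/
theorem eulerDeriv_type2Density (α : Fin n) {p M : ℕ} (hM : p + 2 ≤ M) :
    ∃ κ : 𝕜, ∀ v ∈ D.dom, D.eulerDeriv (D.type2Density α p) v
      = ((p : 𝕜) + 1 - D.d / 2 + D'.μ α) * D.type2Density α p v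
        + ∑ ε, ∑ j ∈ Finset.range M, D.type2Density ε j v * D'.intR ((p : ℤ) - j) ε α
        + κ * v (Fin.rev 0) := by
  have hne := hN.rev_zero_ne
  by_cases h00 : α = 0 ∧ p = 0
  · obtain ⟨rfl, rfl⟩ := h00
    refine ⟨0, fun v hv => ?_⟩
    rw [type2Density_zero_zero, eulerDeriv_const, h.μ, flip_zero, hN.mu_last hF, delta_zero hne]
    have : ∀ (ε : Fin n) (j : ℕ), D'.intR (((0 : ℕ) : ℤ) - j) ε 0 = 0 := fun ε j => by
      rw [intR_of_nonpos (by omega), Matrix.zero_apply]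
    simp only [this]
    simp
  obtain ⟨q, hq⟩ := exists_type2_index hne h00
  have hq' : q ≤ p + 1 := by
    have : -1 ≤ delta α := by unfold delta; split_ifs <;> simp
    omega
  obtain ⟨M, rfl⟩ : ∃ N, M = N + 1 := ⟨M - 1, by omega⟩
  -- This κ comes from θ_{1,0} = v^n, the only density that is not ± some Φ. Conversely Φ_{1,0} = 1
  -- absorbs the constant R_{q+1} in the homogeneity of θ.
  refine ⟨lastSign 𝕜 α * (-1) ^ p * D.intR q 0 (flip α), fun v hv => ?_⟩
  have hd := hθ.differentiableAt hF hv (flip α) q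
  rw [type2Density_eq h00 hq, eulerDeriv_const_mul _ hd,
    hN.eulerDeriv_theta hF hθ hv (flip α) (M := M + 1) (by omega), h.μ]
  have hqc : (q : 𝕜) = p - ((delta α : ℤ) : 𝕜) := by exact_mod_cast congrArg (Int.cast (R := 𝕜)) hq
  -- the sums over the first index, term by term
  have key : ∀ ε, ∑ j ∈ Finset.range (M + 1),
      D.type2Density ε j v * D'.intR ((p : ℤ) - j) ε α
      = lastSign 𝕜 α * (-1) ^ p * ∑ j ∈ Finset.range (M + 1),
          D.θ (flip ε) j v * D.intR ((q : ℤ) - j) (flip ε) (flip α)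
        + (if ε = 0 then lastSign 𝕜 α * (-1) ^ p * D.R (q + 1) (Fin.rev 0) (flip α) else 0)
        - (if ε = Fin.rev 0 then
            lastSign 𝕜 α * (-1) ^ p * D.intR q 0 (flip α) * v (Fin.rev 0) else 0) := by
    intro ε
    have hR : ∀ j : ℕ, D'.intR ((p : ℤ) - j) ε α = (-1) ^ p * (-1) ^ j * lastSign 𝕜 ε
        * lastSign 𝕜 α * D.intR ((q : ℤ) - j + delta ε) (flip ε) (flip α) := fun j => by
      rw [h.intR_eq hN hF hθ, hq, zpow_sub₀ (by norm_num), zpow_natCast, zpow_natCast,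
        show (p : ℤ) - j + delta ε - delta α = p - delta α - j + delta ε by ring,
        div_eq_mul_inv, ← inv_pow, inv_neg_one]
    have hs : ∀ j : ℕ, ((-1 : 𝕜) ^ j) * (-1) ^ j = 1 := fun j => by rw [← mul_pow]; simp
    by_cases e0 : ε = 0
    · subst e0
      rw [Finset.sum_range_succ', Finset.sum_range_succ, if_pos rfl, if_neg hne.symm, flip_zero,
        intR_of_nonpos (l := (q : ℤ) - M) (by omega), type2Density_zero_zero, hR, flip_zero,
        delta_zero hne, Int.natCast_zero, sub_zero, show (q : ℤ) + 1 = ((q + 1 : ℕ) : ℤ) by simp,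
        intR_natCast hθ, Matrix.zero_apply, mul_zero, add_zero, sub_zero, Finset.mul_sum]
      have hl : lastSign 𝕜 (0 : Fin n) = 1 := by simp [lastSign, hne.symm]
      rw [hl]
      congr 1
      · refine Finset.sum_congr rfl fun j _ => ?_
        rw [type2Density_zero_succ hne, hR, flip_zero, delta_zero hne, hl]
        rw [show (q : ℤ) - ((j + 1 : ℕ) : ℤ) + 1 = q - j by push_cast; ring]
        linear_combination (D.θ (Fin.rev 0) j v * (-1) ^ p * lastSign 𝕜 α
          * D.intR ((q : ℤ) - j) (Fin.rev 0) (flip α)) * hs (j + 1)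
      · ring
    by_cases e1 : ε = Fin.rev 0
    · subst e1
      rw [Finset.sum_range_succ, hR, delta_last hne,
        intR_of_nonpos (l := (q : ℤ) - M + -1) (by omega), Finset.sum_range_succ', if_neg hne,
        if_pos rfl, flip_last, hN.theta_zero hθ hv, Matrix.zero_apply, mul_zero, mul_zero,
        add_zero, add_zero, Int.natCast_zero, sub_zero, mul_add, Finset.mul_sum]
      have hl : lastSign 𝕜 (Fin.rev 0 : Fin n) = -1 := by simp [lastSign]
      rw [mul_comm (v (Fin.rev 0)), ← mul_assoc, add_sub_cancel_right]
      refine Finset.sum_congr rfl fun j _ => ?_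
      rw [type2Density_last hne, hR, flip_last, delta_last hne, hl]
      rw [show (q : ℤ) - j + -1 = (q : ℤ) - ((j + 1 : ℕ) : ℤ) by push_cast; ring]
      rw [pow_succ]
      linear_combination (D.θ 0 (j + 1) v * (-1) ^ p * lastSign 𝕜 α
          * D.intR ((q : ℤ) - ((j + 1 : ℕ) : ℤ)) 0 (flip α)) * hs j
    · rw [if_neg e0, if_neg e1, add_zero, sub_zero, Finset.mul_sum]
      refine Finset.sum_congr rfl fun j _ => ?_
      have hl : lastSign 𝕜 ε = 1 := by simp [lastSign, e1]
      rw [type2Density_other e0 e1, hR, flip_other e0 e1, delta_other e0 e1, hl, add_zero]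
      linear_combination (D.θ ε j v * (-1) ^ p * lastSign 𝕜 α
          * D.intR ((q : ℤ) - j) ε (flip α)) * hs j
  simp_rw [key, Finset.sum_sub_distrib, Finset.sum_add_distrib]
  rw [Finset.sum_ite_eq', Finset.sum_ite_eq', if_pos (Finset.mem_univ _),
    if_pos (Finset.mem_univ _), ← Finset.mul_sum]
  have hsw : ∑ ε : Fin n, ∑ j ∈ Finset.range (M + 1),
      D.θ (flip ε) j v * D.intR ((q : ℤ) - j) (flip ε) (flip α)
      = ∑ ε : Fin n, ∑ j ∈ Finset.range (M + 1), D.θ ε j v * D.intR ((q : ℤ) - j) ε (flip α) :=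
    Equiv.sum_comp (Equiv.swap 0 (Fin.rev 0)) fun ε =>
      ∑ j ∈ Finset.range (M + 1), D.θ ε j v * D.intR ((q : ℤ) - j) ε (flip α)
  rw [hsw, hqc]
  ring

end IsType2

end FrobeniusData

/-! ### Type 2: flatness, homogeneity and two-point functions of the calibration. -/

namespace FrobeniusData

variable {𝕜 : Type*} [RCLike 𝕜] {n : ℕ} {D D' : FrobeniusData 𝕜 n} {v : Fin n → 𝕜}

theorem gradPair_const_mul_left {f g : (Fin n → 𝕜) → 𝕜} (hf : DifferentiableAt 𝕜 f v) (c : 𝕜) :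
    D.gradPair (fun w => c * f w) g v = c * D.gradPair f g v := by
  simp only [gradPair, Finset.mul_sum]
  exact Finset.sum_congr rfl fun _ _ => Finset.sum_congr rfl fun _ _ => by
    rw [pd_const_mul _ hf]; ring

theorem gradPair_const_mul_right {f g : (Fin n → 𝕜) → 𝕜} (hg : DifferentiableAt 𝕜 g v) (c : 𝕜) :
    D.gradPair f (fun w => c * g w) v = c * D.gradPair f g v := by
  simp only [gradPair, Finset.mul_sum]
  exact Finset.sum_congr rfl fun _ _ => Finset.sum_congr rfl fun _ _ => by
    rw [pd_const_mul _ hg]; ring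

theorem gradPair_const_right (f : (Fin n → 𝕜) → 𝕜) (c : 𝕜) :
    D.gradPair f (fun _ => c) v = 0 := by
  simp [gradPair, pd_const]

/-- The orthogonality condition in terms of the functions `Ω_{α,0;β,q}`. -/
theorem sum_gradPair_eq (α β : Fin n) (q : ℕ) :
    ∑ i ∈ Finset.range (q + 1 + 1),
        (-1) ^ (q + 1 - i) * D.gradPair (D.θ α i) (D.θ β (q + 1 - i)) v
      = (-1) ^ (q + 1) * (D.gradPair (D.θ α 0) (D.θ β (q + 1)) v - D.twoPoint α 0 β q v) := by
  rw [Finset.sum_range_succ', twoPoint, mul_sub, sub_eq_neg_add, Finset.mul_sum,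
    ← Finset.sum_neg_distrib]
  congr 1
  refine Finset.sum_congr rfl fun i hi => ?_
  obtain ⟨j, rfl⟩ : ∃ j, q = i + j := ⟨q - i, by have := Finset.mem_range.1 hi; omega⟩
  rw [show i + j + 1 - (i + 1) = j by omega, show i + j - i = j by omega,
    show 0 + 1 + i = i + 1 by ring]
  have : ((-1 : 𝕜) ^ i) * (-1) ^ i = 1 := by rw [← mul_pow]; simp
  linear_combination (-(-1 : 𝕜) ^ j * D.gradPair (D.θ α (i + 1)) (D.θ β j) v) * this

variable [NeZero n]

theorem contDiffOn_type2Density (hθ : D.IsCalibration) (α : Fin n) (p : ℕ) :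
    ContDiffOn 𝕜 ∞ (D.type2Density α p) D.dom := by
  unfold type2Density
  split_ifs
  · fun_prop
  · exact contDiffOn_const.mul (hθ.smooth _ _)

namespace IsType2Normalized

variable (hN : D.IsType2Normalized)
include hN

theorem gradPair_eq (f g : (Fin n → 𝕜) → 𝕜) :
    D.gradPair f g v = ∑ γ, pd γ f v * pd γ.rev g v := by
  simp [gradPair, hN.inv_eta, hN.η]

variable (hF : D.IsWDVV) (hθ : D.IsCalibration)
include hF hθ

theorem gradPair_theta_zero_left (hv : v ∈ D.dom) (α : Fin n) (f : (Fin n → 𝕜) → 𝕜) :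
    D.gradPair (D.θ α 0) f v = pd α f v := by
  simp [hN.gradPair_eq, hN.pd_theta_zero hF hθ hv]

theorem gradPair_theta_zero_right (hv : v ∈ D.dom) (α : Fin n) (f : (Fin n → 𝕜) → 𝕜) :
    D.gradPair f (D.θ α 0) v = pd α f v := by
  have e : ∀ γ : Fin n, γ.rev = α.rev ↔ γ = α := fun γ => Fin.rev_inj
  simp [hN.gradPair_eq, hN.pd_theta_zero hF hθ hv]

theorem pd_zero_type2Density_succ (hv : v ∈ D.dom) (α : Fin n) (p : ℕ) :
    pd 0 (D.type2Density α (p + 1)) v = -D.type2Density α p v := by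
  have hne := hN.rev_zero_ne
  by_cases h00 : α = 0 ∧ p = 0
  · obtain ⟨rfl, rfl⟩ := h00
    rw [type2Density_zero_succ hne, pd_const_mul _ (hθ.differentiableAt hF hv _ _),
      hN.pd_theta_zero hF hθ hv, type2Density_zero_zero]
    simp
  obtain ⟨q, hq⟩ := exists_type2_index hne h00
  rw [type2Density_eq (q := q + 1) (by simp) (by push_cast; omega), type2Density_eq h00 hq,
    pd_const_mul _ (hθ.differentiableAt hF hv _ _), hN.pd_zero_theta hθ hv]
  ring

theorem pd_zero_type2Density_zero (hv : v ∈ D.dom) (α : Fin n) :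
    pd 0 (D.type2Density α 0) v = if α = Fin.rev 0 then -v (Fin.rev 0) else 0 := by
  have hne := hN.rev_zero_ne
  by_cases h0 : α = 0
  · subst h0
    rw [type2Density_zero_zero, pd_const, if_neg hne.symm]
  by_cases h1 : α = Fin.rev 0
  · subst h1
    rw [type2Density_last hne, pd_const_mul _ (hθ.differentiableAt hF hv _ _),
      hN.pd_zero_theta hθ hv, hN.theta_zero hθ hv, if_pos rfl]
    ring
  · rw [type2Density_other h0 h1, pd_const_mul _ (hθ.differentiableAt hF hv _ _),
      hN.pd_theta_zero hF hθ hv, if_neg h1, if_neg (rev_ne_zero h1).symm]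
    ring

/-- The alternating sign (−1)^p in Φ turns flatness of θ into flatness with −c. At (1,0) both sides
vanish: Φ_{1,1} is linear and Φ_{1,0} is constant. -/
theorem pd_pd_type2Density_succ (hv : v ∈ D.dom) (l m α : Fin n) (p : ℕ) :
    pd l (pd m (D.type2Density α (p + 1))) v
      = -∑ γ, D.c γ l m v * pd γ (D.type2Density α p) v := by
  have hne := hN.rev_zero_ne
  have hd : ∀ α p, DifferentiableAt 𝕜 (pd m (D.θ α p)) v := fun α p =>
    (hθ.contDiffOn_pd hF α m p).differentiableAt_of_isOpen hF.isOpen hv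
  by_cases h00 : α = 0 ∧ p = 0
  · obtain ⟨rfl, rfl⟩ := h00
    rw [type2Density_zero_succ hne, pd_congr hF.isOpen (fun w hw =>
      (pd_const_mul _ (hθ.differentiableAt hF hw _ _) m).trans
        (by rw [hN.pd_theta_zero hF hθ hw])) hv, pd_const, type2Density_zero_zero]
    simp [pd_const]
  obtain ⟨q, hq⟩ := exists_type2_index hne h00
  rw [type2Density_eq (q := q + 1) (by simp) (by push_cast; omega), type2Density_eq h00 hq,
    pd_congr hF.isOpen (fun w hw => pd_const_mul _ (hθ.differentiableAt hF hw _ _) m) hv,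
    pd_const_mul _ (hd _ _), hθ.flat v hv, Finset.mul_sum, ← Finset.sum_neg_distrib]
  refine Finset.sum_congr rfl fun γ _ => ?_
  rw [pd_const_mul _ (hθ.differentiableAt hF hv _ _)]
  ring

end IsType2Normalized

namespace IsType2

variable (h : D.IsType2 D') (hN : D.IsType2Normalized) (hF : D.IsWDVV) (hθ : D.IsCalibration)

section
include h hN

theorem theta_eq (hv : v ∈ D.dom) (α : Fin n) (p : ℕ) :
    D'.θ α p (D.type2Coord v) = D.type2Density α p v / v (Fin.rev 0) := by
  have hne := hN.rev_zero_ne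
  by_cases h0 : α = 0
  · subst h0
    cases p with
    | zero => rw [h.θ_first_zero v hv, type2Density_zero_zero]
    | succ p => rw [h.θ_first v hv, type2Density_zero_succ hne]
  by_cases h1 : α = Fin.rev 0
  · subst h1
    rw [h.θ_last v hv, type2Density_last hne]
  · rw [h.θ_other v hv α h0 h1, type2Density_other h0 h1]

include hF

/-- The pairing of the gradients of `φ / v^n` and `ψ / v^n` in the new coordinates. -/
theorem gradPair_of_div {φ ψ f g : (Fin n → 𝕜) → 𝕜} (hφ : ContDiffOn 𝕜 ∞ φ D.dom)
    (hψ : ContDiffOn 𝕜 ∞ ψ D.dom)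
    (ef : ∀ w ∈ D.dom, f (D.type2Coord w) = φ w / w (Fin.rev 0))
    (eg : ∀ w ∈ D.dom, g (D.type2Coord w) = ψ w / w (Fin.rev 0)) (hv : v ∈ D.dom) :
    D'.gradPair f g (D.type2Coord v)
      = D.gradPair φ ψ v - (pd 0 φ v * ψ v + φ v * pd 0 ψ v) / v (Fin.rev 0) := by
  have hw := hN.last_ne_zero v hv
  have hne := hN.rev_zero_ne
  have hM : ∀ (φ : (Fin n → 𝕜) → 𝕜), ∑ l, D.inversionMatrix v l 0 * pd l φ v
      = -(pd 0 φ v / v (Fin.rev 0)) := fun φ => by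
    refine mul_left_cancel₀ hw ?_
    rw [Finset.mul_sum]
    simp_rw [← mul_assoc, hN.inversionMatrix_zero hv, ite_mul, zero_mul]
    rw [Finset.sum_ite_eq', if_pos (Finset.mem_univ _)]
    field_simp
  -- The pairing of the homogeneous parts of the two gradients is the old one because MηMᵀ = η.
  have hE : ∑ γ : Fin n, (∑ l, D.inversionMatrix v l γ * pd l φ v)
      * (∑ l, D.inversionMatrix v l γ.rev * pd l ψ v) = D.gradPair φ ψ v := by
    have h1 : ∀ l m, ∑ γ : Fin n, D.inversionMatrix v l γ * D.inversionMatrix v m γ.rev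
        = D.η l m := fun l m => by
      have := congrFun (congrFun (hN.mul_eta_mul_transpose hv) l) m
      rw [← this, Matrix.mul_assoc, Matrix.mul_apply]
      refine Finset.sum_congr rfl fun γ _ => ?_
      simp [Matrix.mul_apply, hN.η]
    simp_rw [Finset.sum_mul_sum]
    rw [Finset.sum_comm]
    unfold gradPair
    refine Finset.sum_congr rfl fun l _ => ?_
    rw [Finset.sum_comm]
    refine Finset.sum_congr rfl fun m _ => ?_
    rw [hN.inv_eta, ← h1, Finset.mul_sum, Finset.sum_mul]
    exact Finset.sum_congr rfl fun γ _ => by ring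
  have hG : D'.gradPair f g (D.type2Coord v)
      = ∑ γ, pd γ f (D.type2Coord v) * pd γ.rev g (D.type2Coord v) := by
    simp [gradPair, h.η, hN.inv_eta, hN.η]
  have e0 : ∀ γ : Fin n, γ.rev = Fin.rev 0 ↔ γ = 0 := fun γ => Fin.rev_inj
  rw [hG]
  simp_rw [hN.pd_of_div hF hφ ef hv, hN.pd_of_div hF hψ eg hv, add_mul, mul_add, e0,
    Finset.sum_add_distrib]
  rw [hE]
  simp only [mul_ite, ite_mul, mul_zero, zero_mul, Finset.sum_ite_eq', Finset.mem_univ, if_true,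
    Fin.rev_rev, hne.symm, if_false, hM, add_zero]
  field_simp
  ring

end

include h hN hF hθ

theorem contDiffOn_theta (α : Fin n) (p : ℕ) : ContDiffOn 𝕜 ∞ (D'.θ α p) D'.dom := by
  rw [h.dom]
  exact hN.contDiffOn_of_div hF (contDiffOn_type2Density hθ α p)
    fun w hw => h.theta_eq hN hw α p

theorem pd_theta (hv : v ∈ D.dom) (α β : Fin n) (p : ℕ) :
    pd β (D'.θ α p) (D.type2Coord v)
      = ∑ γ, D.inversionMatrix v γ β * pd γ (D.type2Density α p) v
        + if β = Fin.rev 0 then D.type2Density α p v else 0 :=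
  hN.pd_of_div hF (contDiffOn_type2Density hθ α p) (fun _ hw => h.theta_eq hN hw α p) hv β

theorem unit_deriv (hv : v ∈ D.dom) (α : Fin n) (p : ℕ) :
    pd 0 (D'.θ α (p + 1)) (D.type2Coord v) = D'.θ α p (D.type2Coord v) := by
  have hw := hN.last_ne_zero v hv
  rw [h.pd_theta hN hF hθ hv, if_neg hN.rev_zero_ne.symm, add_zero, h.theta_eq hN hv]
  refine mul_left_cancel₀ hw ?_
  rw [Finset.mul_sum]
  simp_rw [← mul_assoc, hN.inversionMatrix_zero hv, ite_mul, zero_mul]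
  rw [Finset.sum_ite_eq', if_pos (Finset.mem_univ _), hN.pd_zero_type2Density_succ hF hθ hv]
  field_simp

omit hF hθ in
theorem theta_zero (hθ : D.IsCalibration) (hv : v ∈ D.dom) (α : Fin n) :
    D'.θ α 0 (D.type2Coord v) = D.type2Coord v α.rev := by
  have hne := hN.rev_zero_ne
  rw [h.theta_eq hN hv]
  by_cases h0 : α = 0
  · subst h0
    rw [type2Density_zero_zero, hN.coord_last]
  by_cases h1 : α = Fin.rev 0
  · subst h1
    rw [type2Density_last hne, Fin.rev_rev, IsType2Normalized.coord_zero]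
    simp only [zero_add, hN.theta_one v hv]
    ring
  · rw [type2Density_other h0 h1, IsType2Normalized.coord_other v
      (IsType2Normalized.rev_ne_zero h1) (IsType2Normalized.rev_ne_last h0)]
    simp only [hN.theta_zero hθ hv]
    ring

/-- In the Hessian of Φ_{ν,p+1}/v^n the correction −η_{αβ}∂_1Φ_{ν,p+1} is η_{αβ}Φ_{ν,p}. It matches
the extra term of the last gradient component, whose coefficient ĉ^n_{αβ} is η_{αβ}; the rest is the
conjugation formula for multiplication. -/
theorem flat (hv : v ∈ D.dom) (α β ν : Fin n) (p : ℕ) :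
    pd α (pd β (D'.θ ν (p + 1))) (D.type2Coord v)
      = ∑ γ, D'.c γ α β (D.type2Coord v) * pd γ (D'.θ ν p) (D.type2Coord v) := by
  have hw := hN.last_ne_zero v hv
  rw [hN.pd_pd_of_div hF (contDiffOn_type2Density hθ ν (p + 1))
    (fun w hw => h.theta_eq hN hw ν (p + 1)) hv, hN.pd_zero_type2Density_succ hF hθ hv]
  simp_rw [hN.pd_pd_type2Density_succ hF hθ hv, h.pd_theta hN hF hθ hv, mul_add,
    Finset.sum_add_distrib, mul_ite, mul_zero]
  rw [Finset.sum_ite_eq', if_pos (Finset.mem_univ _), h.c_eq_pd hN, Fin.rev_rev,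
    h.metric hN hF hv, mul_neg, sub_neg_eq_add]
  congr 1
  obtain ⟨Q, hQ⟩ : ∃ Q : Fin n → 𝕜, ∀ δ, Q δ = ∑ l, ∑ m, D.inversionMatrix v l α
      * D.inversionMatrix v m β * D.c δ l m v := ⟨_, fun _ => rfl⟩
  have hc : ∀ γ, D'.c γ α β (D.type2Coord v)
      = -(v (Fin.rev 0) ^ 2) * ∑ δ, jacobian D.type2Coord v γ δ * Q δ := by
    intro γ
    simp_rw [hQ]
    have := congrFun (congrFun (h.multMatrix_eq hN hF hv α) γ) β
    rw [multMatrix, Matrix.of_apply, Matrix.smul_apply, Matrix.mul_assoc, Matrix.mul_apply,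
      smul_eq_mul] at this
    rw [this]
    congr 1
    refine Finset.sum_congr rfl fun δ _ => ?_
    congr 1
    rw [Matrix.mul_apply]
    simp_rw [Matrix.sum_apply, Finset.sum_mul]
    rw [Finset.sum_comm]
    refine Finset.sum_congr rfl fun l _ => Finset.sum_congr rfl fun m _ => ?_
    simp only [Matrix.smul_apply, multMatrix, Matrix.of_apply, smul_eq_mul]
    ring
  have hMK : ∀ δ ε, ∑ γ, D.inversionMatrix v ε γ * jacobian D.type2Coord v γ δ
      = if ε = δ then (v (Fin.rev 0))⁻¹ else 0 := by
    intro δ ε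
    have := congrFun (congrFun (hN.mul_jacobian hv) ε) δ
    rw [Matrix.mul_apply, Matrix.one_apply] at this
    refine mul_left_cancel₀ hw ?_
    rw [Finset.mul_sum, mul_ite, mul_inv_cancel₀ hw, mul_zero, ← this]
    exact Finset.sum_congr rfl fun γ _ => by rw [Matrix.smul_apply, smul_eq_mul]; ring
  have hR : ∑ γ, D'.c γ α β (D.type2Coord v)
      * ∑ ε, D.inversionMatrix v ε γ * pd ε (D.type2Density ν p) v
      = -(v (Fin.rev 0) ^ 2) * ∑ δ, ∑ ε, Q δ * pd ε (D.type2Density ν p) v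
        * ∑ γ, D.inversionMatrix v ε γ * jacobian D.type2Coord v γ δ := by
    have e : ∀ γ, D'.c γ α β (D.type2Coord v)
        * ∑ ε, D.inversionMatrix v ε γ * pd ε (D.type2Density ν p) v
        = ∑ δ, ∑ ε, -(v (Fin.rev 0) ^ 2) * (Q δ * pd ε (D.type2Density ν p) v
          * (D.inversionMatrix v ε γ * jacobian D.type2Coord v γ δ)) := by
      intro γ
      rw [hc, mul_assoc, Finset.sum_mul_sum, Finset.mul_sum]
      refine Finset.sum_congr rfl fun δ _ => ?_
      rw [Finset.mul_sum]
      exact Finset.sum_congr rfl fun ε _ => by ring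
    simp_rw [e, Finset.mul_sum]
    rw [Finset.sum_comm]
    refine Finset.sum_congr rfl fun δ _ => ?_
    rw [Finset.sum_comm]
  rw [hR]
  simp_rw [hMK, mul_ite, mul_zero]
  simp only [Finset.sum_ite_eq', Finset.mem_univ, if_true]
  have hS : ∑ δ, Q δ * pd δ (D.type2Density ν p) v = ∑ l, ∑ m, D.inversionMatrix v l α
      * D.inversionMatrix v m β * ∑ γ, D.c γ l m v * pd γ (D.type2Density ν p) v := by
    simp_rw [hQ, Finset.sum_mul, Finset.mul_sum]
    rw [Finset.sum_comm]
    refine Finset.sum_congr rfl fun l _ => ?_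
    rw [Finset.sum_comm]
    exact Finset.sum_congr rfl fun m _ => Finset.sum_congr rfl fun γ _ => by ring
  simp_rw [mul_neg, Finset.sum_neg_distrib]
  rw [← Finset.sum_mul, ← hS]
  field_simp

theorem homogeneous (hv : v ∈ D.dom) (α β : Fin n) (p : ℕ) :
    D'.eulerDeriv (pd β (D'.θ α p)) (D.type2Coord v)
      = ((p : 𝕜) + D'.μ α + D'.μ β) * pd β (D'.θ α p) (D.type2Coord v)
        + ∑ k ∈ Finset.Icc 1 p, ∑ ε, pd β (D'.θ ε (p - k)) (D.type2Coord v) * D'.R k ε α := by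
  have hU := h.isOpen_dom hN hF
  have hs := h.contDiffOn_theta hN hF hθ
  obtain ⟨κ, hκ⟩ := h.eulerDeriv_type2Density hN hF hθ α (le_refl (p + 2))
  -- Homogeneity of θ̂ up to an additive constant; its gradient, through the commutator with ∂_E, is
  -- the required identity.
  have e : ∀ w ∈ D'.dom, D'.eulerDeriv (D'.θ α p) w
      = ((p : 𝕜) + D.d / 2 + D'.μ α) * D'.θ α p w
        + ∑ ε, ∑ j ∈ Finset.range (p + 2), D'.θ ε j w * D'.intR ((p : ℤ) - j) ε α + κ := by
    intro w' hw'
    obtain ⟨w, hw, rfl⟩ : w' ∈ D.type2Coord '' D.dom := h.dom ▸ hw'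
    have h0 := hN.last_ne_zero w hw
    rw [h.eulerDeriv_of_div hN hF (contDiffOn_type2Density hθ α p)
      (fun w hw => h.theta_eq hN hw α p) hw, hκ w hw]
    simp_rw [h.theta_eq hN hw, div_mul_eq_mul_div, ← Finset.sum_div]
    field_simp
    ring
  have hv' := h.mem_dom hv
  have hd := fun ε j => (hs ε j).differentiableAt_of_isOpen hU hv'
  have h1 := pd_eulerDeriv (D := D') hU (hs α p) hv' β
  have hdm : ∀ ε j, DifferentiableAt 𝕜 (fun w => D'.θ ε j w * D'.intR ((p : ℤ) - j) ε α)
      (D.type2Coord v) := fun ε j => (hd ε j).mul_const _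
  have hds : ∀ ε, DifferentiableAt 𝕜 (fun w => ∑ j ∈ Finset.range (p + 2),
      D'.θ ε j w * D'.intR ((p : ℤ) - j) ε α) (D.type2Coord v) := fun ε =>
    DifferentiableAt.fun_sum fun j _ => hdm ε j
  have hdA : DifferentiableAt 𝕜 (fun w => ((p : 𝕜) + D.d / 2 + D'.μ α) * D'.θ α p w)
      (D.type2Coord v) := (hd α p).const_mul _
  have hdB : DifferentiableAt 𝕜 (fun w => ∑ ε, ∑ j ∈ Finset.range (p + 2),
      D'.θ ε j w * D'.intR ((p : ℤ) - j) ε α) (D.type2Coord v) :=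
    DifferentiableAt.fun_sum fun ε _ => hds ε
  rw [pd_congr hU e hv', pd_add (hdA.fun_add hdB) (differentiableAt_const κ),
    pd_add hdA hdB, pd_const, pd_const_mul _ (hd α p), pd_sum _ fun ε _ => hds ε] at h1
  have h2 : ∀ ε, pd β (fun w => ∑ j ∈ Finset.range (p + 2),
      D'.θ ε j w * D'.intR ((p : ℤ) - j) ε α) (D.type2Coord v)
      = ∑ j ∈ Finset.range (p + 2), pd β (D'.θ ε j) (D.type2Coord v)
        * D'.intR ((p : ℤ) - j) ε α := fun ε => by
    rw [pd_sum _ fun j _ => hdm ε j]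
    refine Finset.sum_congr rfl fun j _ => ?_
    rw [pd_mul (hd ε j) (by fun_prop), pd_const]
    ring
  simp_rw [h2] at h1
  rw [sum_Icc_R (D := D') (fun ε j => pd β (D'.θ ε j) (D.type2Coord v))
    (show p ≤ p + 2 by omega) α]
  rw [h.d] at h1
  linear_combination -h1

/-- The functions `Ω̂_{α,p;β,q}` in terms of the pairings in the old coordinates. -/
theorem twoPoint_eq_sum (hv : v ∈ D.dom) (α β : Fin n) (p q : ℕ) :
    D'.twoPoint α p β q (D.type2Coord v)
      = D.type2Density α p v * D.type2Density β q v / v (Fin.rev 0)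
        + (if β = Fin.rev 0 then (-1) ^ q * D.type2Density α (p + 1 + q) v else 0)
        + ∑ i ∈ Finset.range (q + 1),
          (-1) ^ i * D.gradPair (D.type2Density α (p + 1 + i)) (D.type2Density β (q - i)) v := by
  have hw := hN.last_ne_zero v hv
  have hg : ∀ i j, D'.gradPair (D'.θ α i) (D'.θ β j) (D.type2Coord v)
      = D.gradPair (D.type2Density α i) (D.type2Density β j) v
        - (pd 0 (D.type2Density α i) v * D.type2Density β j v
          + D.type2Density α i v * pd 0 (D.type2Density β j) v) / v (Fin.rev 0) := fun i j =>
    h.gradPair_of_div hN hF (contDiffOn_type2Density hθ α i) (contDiffOn_type2Density hθ β j)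
      (fun _ hw => h.theta_eq hN hw α i) (fun _ hw => h.theta_eq hN hw β j) hv
  have e : ∀ i, p + 1 + i = p + i + 1 := fun i => by ring
  simp_rw [twoPoint, hg, mul_sub, Finset.sum_sub_distrib]
  rw [sub_eq_neg_add]
  congr 1
  simp_rw [e, hN.pd_zero_type2Density_succ hF hθ hv]
  -- The term i = q is split off: there the second level is 0, and ∂_1Φ_{β,0} is −v^n for β = n and
  -- 0 otherwise instead of a lower Φ.
  rw [Finset.sum_range_succ, Nat.sub_self, hN.pd_zero_type2Density_zero hF hθ hv]
  -- The corrections are consecutive differences, because ∂_1 lowers the level of one factor at a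
  -- time with a sign. Their sum leaves Φ_{α,p}Φ_{β,q}/v^n and, for β = n, a boundary term.
  have h1 : ∀ i ∈ Finset.range q, (-1) ^ i * ((-D.type2Density α (p + i) v
      * D.type2Density β (q - i) v + D.type2Density α (p + i + 1) v
        * pd 0 (D.type2Density β (q - i)) v) / v (Fin.rev 0))
      = (-1) ^ (i + 1) * (D.type2Density α (p + (i + 1)) v
          * D.type2Density β (q - (i + 1)) v) / v (Fin.rev 0)
        - (-1) ^ i * (D.type2Density α (p + i) v * D.type2Density β (q - i) v)
          / v (Fin.rev 0) := by
    intro i hi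
    obtain ⟨j, rfl⟩ : ∃ j, q = i + 1 + j :=
      ⟨q - (i + 1), by have := Finset.mem_range.1 hi; omega⟩
    rw [show i + 1 + j - i = j + 1 by omega, hN.pd_zero_type2Density_succ hF hθ hv,
      show i + 1 + j - (i + 1) = j by omega, ← add_assoc]
    ring
  rw [Finset.sum_congr rfl h1, Finset.sum_range_sub fun i =>
    (-1) ^ i * (D.type2Density α (p + i) v * D.type2Density β (q - i) v) / v (Fin.rev 0)]
  simp only [Nat.sub_self, add_zero, Nat.sub_zero, pow_zero, one_mul]
  split_ifs <;> field_simp <;> ring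

/-- The functions `Ω̂_{α,p;β,q}` in terms of the functions `Ω_{α,p;β,q}`. -/
theorem twoPoint_eq (hv : v ∈ D.dom) {α β : Fin n} {p q a b : ℕ}
    (hβ : ¬(β = 0 ∧ q = 0)) (ha : (a : ℤ) = p - delta α) (hb : (b : ℤ) = q - delta β) :
    D'.twoPoint α p β q (D.type2Coord v)
      = D.type2Density α p v * D.type2Density β q v / v (Fin.rev 0)
        - lastSign 𝕜 α * (-1) ^ p * (lastSign 𝕜 β * (-1) ^ q)
          * D.twoPoint (flip α) a (flip β) b v := by
  have hne := hN.rev_zero_ne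
  have hd := fun α p => hθ.differentiableAt hF hv α p
  have hΦ : ∀ i, D.type2Density α (p + 1 + i)
      = fun v => lastSign 𝕜 α * (-1) ^ (p + 1 + i) * D.θ (flip α) (a + 1 + i) v := fun i =>
    type2Density_eq (by simp) (by push_cast; omega)
  rw [h.twoPoint_eq_sum hN hF hθ hv, add_assoc, sub_eq_add_neg]
  congr 1
  have hs : ∀ j : ℕ, ((-1 : 𝕜) ^ j) * (-1) ^ j = 1 := fun j => by rw [← mul_pow]; simp
  simp_rw [hΦ, fun i => gradPair_const_mul_left (D := D)
    (g := D.type2Density β (q - i)) (hd (flip α) (a + 1 + i))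
    (lastSign 𝕜 α * (-1) ^ (p + 1 + i))]
  -- The cases differ in the length of the sum. For β = 1 it has one term more than Ω, which
  -- vanishes as Φ_{1,0} is constant. For β = n it has one term fewer, namely the pairing with
  -- θ_{1,0}, and the boundary term supplies it.
  by_cases h0 : β = 0
  · subst h0
    obtain ⟨r, rfl⟩ : ∃ r, q = r + 1 := ⟨q - 1, by
      have : q ≠ 0 := fun e => hβ ⟨rfl, e⟩
      omega⟩
    rw [delta_zero hne] at hb
    obtain rfl : b = r := by push_cast at hb; omega
    rw [if_neg hne.symm, zero_add, Finset.sum_range_succ, Nat.sub_self, type2Density_zero_zero,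
      gradPair_const_right, mul_zero, mul_zero, add_zero, twoPoint, Finset.mul_sum,
      ← Finset.sum_neg_distrib]
    refine Finset.sum_congr rfl fun i hi => ?_
    obtain ⟨j, rfl⟩ : ∃ j, b = i + j := ⟨b - i, by have := Finset.mem_range.1 hi; omega⟩
    rw [show i + j + 1 - i = j + 1 by omega, show i + j - i = j by omega,
      type2Density_zero_succ hne, gradPair_const_mul_right (hd _ _), flip_zero]
    simp only [lastSign, hne.symm, if_false]
    have := hs i
    ring_nf at this ⊢
  by_cases h1 : β = Fin.rev 0
  · subst h1
    rw [delta_last hne] at hb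
    obtain rfl : b = q + 1 := by omega
    rw [if_pos rfl, flip_last, twoPoint, Finset.sum_range_succ _ (q + 1), Nat.sub_self,
      hN.gradPair_theta_zero_right hF hθ hv, show a + 1 + (q + 1) = a + 1 + q + 1 by ring,
      hN.pd_zero_theta hθ hv, mul_add, neg_add, add_comm, Finset.mul_sum,
      ← Finset.sum_neg_distrib]
    congr 1
    · refine Finset.sum_congr rfl fun i hi => ?_
      obtain ⟨j, rfl⟩ : ∃ j, q = i + j := ⟨q - i, by have := Finset.mem_range.1 hi; omega⟩
      rw [show i + j + 1 - i = j + 1 by omega, show i + j - i = j by omega,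
        type2Density_last hne, gradPair_const_mul_right (hd _ _)]
      simp only [lastSign, if_true]
      ring_nf
    · simp only [lastSign, if_true]
      ring_nf
  · rw [delta_other h0 h1, sub_zero] at hb
    obtain rfl : b = q := by exact_mod_cast hb
    rw [if_neg h1, zero_add, flip_other h0 h1, twoPoint, Finset.mul_sum,
      ← Finset.sum_neg_distrib]
    refine Finset.sum_congr rfl fun i hi => ?_
    obtain ⟨j, rfl⟩ : ∃ j, b = i + j := ⟨b - i, by have := Finset.mem_range.1 hi; omega⟩
    rw [show i + j - i = j by omega, type2Density_other h0 h1,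
      gradPair_const_mul_right (hd _ _)]
    simp only [lastSign, h1, if_false]
    ring_nf

end IsType2

end FrobeniusData

/-! ### Type 2: orthogonality, the grading and symmetry of R̂, and the calibration. -/

namespace FrobeniusData

variable {𝕜 : Type*} [RCLike 𝕜] {n : ℕ} [NeZero n] {D D' : FrobeniusData 𝕜 n} {v : Fin n → 𝕜}

namespace IsType2

variable (h : D.IsType2 D') (hN : D.IsType2Normalized) (hF : D.IsWDVV) (hθ : D.IsCalibration)
include h hN hF hθ

theorem last_mul_pd_theta_zero (hv : v ∈ D.dom) (β : Fin n) (q : ℕ) :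
    v (Fin.rev 0) * pd 0 (D'.θ β (q + 1)) (D.type2Coord v) = D.type2Density β q v := by
  have hw := hN.last_ne_zero v hv
  rw [h.unit_deriv hN hF hθ hv, h.theta_eq hN hv]
  field_simp

theorem last_mul_pd_theta_other (hv : v ∈ D.dom) {α : Fin n} (h0 : α ≠ 0) (h1 : α ≠ Fin.rev 0)
    (β : Fin n) (q : ℕ) :
    v (Fin.rev 0) * pd α (D'.θ β (q + 1)) (D.type2Coord v)
      = v (Fin.rev 0) * pd α (D.type2Density β (q + 1)) v
        + v α.rev * D.type2Density β q v := by
  rw [h.pd_theta hN hF hθ hv, if_neg h1, add_zero, Finset.mul_sum]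
  simp_rw [← mul_assoc, hN.inversionMatrix_other hv h0 h1, sub_mul, ite_mul, zero_mul,
    Finset.sum_sub_distrib]
  rw [Finset.sum_ite_eq', if_pos (Finset.mem_univ _), Finset.sum_ite_eq',
    if_pos (Finset.mem_univ _), hN.pd_zero_type2Density_succ hF hθ hv]
  ring

theorem last_mul_pd_theta_last (hv : v ∈ D.dom) (β : Fin n) (q : ℕ) :
    v (Fin.rev 0) * pd (Fin.rev 0) (D'.θ β (q + 1)) (D.type2Coord v)
      = v (Fin.rev 0) * (D.type2Density β (q + 1) v
          - ∑ γ, v γ * pd γ (D.type2Density β (q + 1)) v)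
        - 1 / 2 * D.sqNorm v * D.type2Density β q v := by
  rw [h.pd_theta hN hF hθ hv, if_pos rfl, mul_add, Finset.mul_sum]
  simp_rw [← mul_assoc, hN.inversionMatrix_last hv, add_mul, ite_mul, zero_mul,
    Finset.sum_add_distrib]
  rw [Finset.sum_ite_eq', if_pos (Finset.mem_univ _), hN.pd_zero_type2Density_succ hF hθ hv,
    mul_sub, Finset.mul_sum]
  simp only [neg_mul, Finset.sum_neg_distrib, mul_assoc]
  ring

/-- The index (1,0) has no image under σ, so the general formula for Ω̂ does not cover it;
orthogonality of the old θ replaces it. -/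
theorem twoPoint_first_zero (hv : v ∈ D.dom) (β : Fin n) (q : ℕ) :
    v (Fin.rev 0) * D'.twoPoint 0 0 β q (D.type2Coord v) = D.type2Density β q v := by
  have hne := hN.rev_zero_ne
  have hw := hN.last_ne_zero v hv
  have hd := fun α p => hθ.differentiableAt hF hv α p
  have hs : ∀ i : ℕ, (-1 : 𝕜) ^ i * (-1) ^ i = 1 := fun i => by rw [← mul_pow]; simp
  rw [h.twoPoint_eq_sum hN hF hθ hv, type2Density_zero_zero]
  have e : ∀ i, D.type2Density 0 (0 + 1 + i) = fun v => (-1) ^ (i + 1) * D.θ (Fin.rev 0) i v :=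
    fun i => by rw [← type2Density_zero_succ hne, show 0 + 1 + i = i + 1 by ring]
  have e1 : ∀ i, (-1 : 𝕜) ^ i * D.gradPair (D.type2Density 0 (0 + 1 + i))
      (D.type2Density β (q - i)) v
      = -D.gradPair (D.θ (Fin.rev 0) i) (D.type2Density β (q - i)) v := fun i => by
    rw [e, gradPair_const_mul_left (hd _ _)]
    linear_combination (-D.gradPair (D.θ (Fin.rev 0) i) (D.type2Density β (q - i)) v) * hs i
  simp_rw [e1, e, Finset.sum_neg_distrib]
  -- The pairings form an orthogonality relation of θ_n(z) with the old density behind β. Only for β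
  -- = n is the relation incomplete, by the pairing with θ_{1,0}.
  suffices hS : (if β = Fin.rev 0 then (-1) ^ q * ((-1) ^ (q + 1) * D.θ (Fin.rev 0) q v) else 0)
      = ∑ i ∈ Finset.range (q + 1),
        D.gradPair (D.θ (Fin.rev 0) i) (D.type2Density β (q - i)) v by
    rw [hS]
    field_simp
    ring
  by_cases h0 : β = 0
  · subst h0
    rw [if_neg hne.symm, Finset.sum_range_succ, Nat.sub_self, type2Density_zero_zero,
      gradPair_const_right, add_zero]
    cases q with
    | zero => simp
    | succ r =>
      have := hθ.orthogonal v hv (Fin.rev 0) (Fin.rev 0) r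
      rw [hN.η, Fin.rev_rev, if_neg hne, ite_self] at this
      rw [← neg_eq_zero, ← Finset.sum_neg_distrib] at this
      rw [← this]
      refine Finset.sum_congr rfl fun i hi => ?_
      rw [show r + 1 - i = r - i + 1 by have := Finset.mem_range.1 hi; omega,
        type2Density_zero_succ hne, gradPair_const_mul_right (hd _ _)]
      ring
  by_cases h1 : β = Fin.rev 0
  · subst h1
    have := hθ.orthogonal v hv (Fin.rev 0) 0 (q + 1)
    rw [if_neg (Nat.succ_ne_zero q), Finset.sum_range_succ, Nat.sub_self,
      hN.gradPair_theta_zero_right hF hθ hv, hN.pd_zero_theta hθ hv] at this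
    have e2 : ∑ i ∈ Finset.range (q + 1),
        D.gradPair (D.θ (Fin.rev 0) i) (D.type2Density (Fin.rev 0) (q - i)) v
        = ∑ i ∈ Finset.range (q + 1), (-1) ^ (q + 1 - i)
          * D.gradPair (D.θ (Fin.rev 0) i) (D.θ 0 (q + 1 - i)) v := by
      refine Finset.sum_congr rfl fun i hi => ?_
      rw [show q + 1 - i = q - i + 1 by have := Finset.mem_range.1 hi; omega,
        type2Density_last hne, gradPair_const_mul_right (hd _ _)]
    rw [if_pos rfl, e2]
    linear_combination -this - D.θ (Fin.rev 0) q v * hs q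
  · have := hθ.orthogonal v hv (Fin.rev 0) β q
    rw [hN.η, Fin.rev_rev, if_neg h0, ite_self] at this
    rw [if_neg h1, ← this]
    refine Finset.sum_congr rfl fun i _ => ?_
    rw [type2Density_other h0 h1, gradPair_const_mul_right (hd _ _)]

/-- `Ω̂_{α,0;β,q} = ∂θ̂_{β,q+1} / ∂v̂^α`. -/
theorem twoPoint_zero (hv : v ∈ D.dom) (α β : Fin n) (q : ℕ) :
    D'.twoPoint α 0 β q (D.type2Coord v) = pd α (D'.θ β (q + 1)) (D.type2Coord v) := by
  have hne := hN.rev_zero_ne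
  have hw := hN.last_ne_zero v hv
  have hd := fun α p => hθ.differentiableAt hF hv α p
  refine mul_left_cancel₀ hw ?_
  by_cases h0 : α = 0
  · subst h0
    rw [h.last_mul_pd_theta_zero hN hF hθ hv, h.twoPoint_first_zero hN hF hθ hv]
  by_cases h00 : β = 0 ∧ q = 0
  · obtain ⟨rfl, rfl⟩ := h00
    have e : D'.twoPoint α 0 0 0 (D.type2Coord v) = D.type2Density α 0 v / v (Fin.rev 0) := by
      rw [h.twoPoint_eq_sum hN hF hθ hv, type2Density_zero_zero, if_neg hne.symm]
      simp [gradPair_const_right, type2Density_zero_zero]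
    have e1 : ∀ γ, pd γ (D.type2Density 0 (0 + 1)) v = if γ = 0 then -1 else 0 := fun γ => by
      rw [type2Density_zero_succ hne, pd_const_mul _ (hd _ _), hN.pd_theta_zero hF hθ hv,
        Fin.rev_rev]
      split_ifs <;> simp
    rw [e]
    by_cases h1 : α = Fin.rev 0
    · subst h1
      rw [h.last_mul_pd_theta_last hN hF hθ hv, type2Density_zero_zero]
      simp_rw [e1, mul_ite, mul_zero]
      rw [Finset.sum_ite_eq', if_pos (Finset.mem_univ _), type2Density_last hne,
        type2Density_zero_succ hne]
      beta_reduce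
      rw [hN.theta_zero hθ hv, Fin.rev_rev, zero_add, hN.theta_one v hv]
      field_simp
      ring
    · rw [h.last_mul_pd_theta_other hN hF hθ hv h0 h1, e1, if_neg h0, type2Density_zero_zero,
        type2Density_other h0 h1]
      beta_reduce
      rw [hN.theta_zero hθ hv]
      field_simp
      ring
  obtain ⟨b, hb⟩ := exists_type2_index hne h00
  have hΦ : D.type2Density β (q + 1)
      = fun v => lastSign 𝕜 β * (-1) ^ (q + 1) * D.θ (flip β) (b + 1) v :=
    type2Density_eq (by simp) (by push_cast; omega)
  by_cases h1 : α = Fin.rev 0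
  · subst h1
    rw [h.twoPoint_eq hN hF hθ hv (a := 1) h00 (by rw [delta_last hne]; simp) hb,
      flip_last, h.last_mul_pd_theta_last hN hF hθ hv, hΦ]
    simp_rw [pd_const_mul _ (hd (flip β) (b + 1))]
    -- For α = n the old index is (1,1); one step of the recursion reduces Ω_{1,1;·} to Ω_{1,0;·}
    -- and a pairing with the gradient of θ_{1,1}, which is known explicitly.
    have s1 := (D.twoPoint_spec 0 0 (flip β) b v).2
    rw [(D.twoPoint_spec_zero hθ 0 (flip β) (b + 1) v hv).2,
      hN.gradPair_theta_zero_left hF hθ hv, hN.pd_zero_theta hθ hv, hN.gradPair_eq] at s1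
    have e2 : ∀ γ : Fin n, pd γ (D.θ 0 (0 + 1)) v = v γ.rev := fun γ => by
      rw [zero_add, pd_congr hF.isOpen hN.theta_one hv,
        pd_const_mul _ IsType2Normalized.differentiableAt_sqNorm, hN.pd_sqNorm]
      ring
    have e3 : ∑ γ : Fin n, pd γ (D.θ 0 (0 + 1)) v * pd γ.rev (D.θ (flip β) (b + 1)) v
        = ∑ γ, v γ * pd γ (D.θ (flip β) (b + 1)) v := by
      rw [← Equiv.sum_comp Fin.revPerm]
      simp [e2]
    rw [e3] at s1
    rw [type2Density_last hne, zero_add]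
    beta_reduce
    rw [hN.theta_one v hv]
    simp only [lastSign, if_true]
    have e4 : ∑ x, v x * ((if β = Fin.rev 0 then -1 else 1) * (-1) ^ (q + 1)
        * pd x (D.θ (flip β) (b + 1)) v) = (if β = Fin.rev 0 then -1 else 1) * (-1) ^ (q + 1)
        * ∑ γ, v γ * pd γ (D.θ (flip β) (b + 1)) v := by
      rw [Finset.mul_sum]
      exact Finset.sum_congr rfl fun _ _ => by ring
    rw [e4, ← s1]
    field_simp
    ring
  · rw [h.twoPoint_eq hN hF hθ hv (a := 0) h00 (by rw [delta_other h0 h1]; simp) hb,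
      flip_other h0 h1, h.last_mul_pd_theta_other hN hF hθ hv h0 h1, hΦ,
      pd_const_mul _ (hd (flip β) (b + 1)), (D.twoPoint_spec_zero hθ α (flip β) b v hv).2,
      hN.gradPair_theta_zero_left hF hθ hv, type2Density_other h0 h1]
    beta_reduce
    rw [hN.theta_zero hθ hv]
    simp only [lastSign, h1, if_false]
    field_simp
    ring

theorem pd_theta_zero (hv : v ∈ D.dom) (α β : Fin n) :
    pd β (D'.θ α 0) (D.type2Coord v) = if β = α.rev then 1 else 0 := by
  have e : ∀ w ∈ D'.dom, D'.θ α 0 w = w α.rev := fun w' hw' => by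
    obtain ⟨w, hw, rfl⟩ : w' ∈ D.type2Coord '' D.dom := h.dom ▸ hw'
    exact h.theta_zero hN hθ hw α
  rw [pd_congr (h.isOpen_dom hN hF) e (h.mem_dom hv), pd_coord]

theorem gradPair_theta_zero_left (hv : v ∈ D.dom) (α : Fin n) (f : (Fin n → 𝕜) → 𝕜) :
    D'.gradPair (D'.θ α 0) f (D.type2Coord v) = pd α f (D.type2Coord v) := by
  simp [gradPair, h.η, hN.inv_eta, hN.η, h.pd_theta_zero hN hF hθ hv]

/-- In positive degree, orthogonality is equivalent to Ω̂_{α,0;β,q} = ⟨∇θ̂_{α,0}, ∇θ̂_{β,q+1}⟩, and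
the right-hand side is ∂̂_αθ̂_{β,q+1}. -/
theorem orthogonal (hv : v ∈ D.dom) (α β : Fin n) (p : ℕ) :
    ∑ i ∈ Finset.range (p + 1),
        (-1) ^ (p - i) * D'.gradPair (D'.θ α i) (D'.θ β (p - i)) (D.type2Coord v)
      = if p = 0 then D'.η α β else 0 := by
  cases p with
  | zero =>
    simp only [zero_add, Finset.sum_range_one, Nat.sub_self, pow_zero, one_mul, if_true]
    rw [h.gradPair_theta_zero_left hN hF hθ hv, h.pd_theta_zero hN hF hθ hv, h.η, hN.η]
    simp only [show α = β.rev ↔ β = α.rev by rw [eq_comm, Fin.rev_eq_iff]]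
  | succ p =>
    rw [sum_gradPair_eq, h.twoPoint_zero hN hF hθ hv, h.gradPair_theta_zero_left hN hF hθ hv,
      sub_self, mul_zero, if_neg (Nat.succ_ne_zero p)]

theorem R_graded (k : ℕ) (α β : Fin n) (hR : D'.R k α β ≠ 0) : D'.μ α - D'.μ β = k := by
  have hk : 0 < k := Nat.pos_of_ne_zero fun e => hR (by rw [e, h.R_zero]; rfl)
  have h1 : D'.intR k α β ≠ 0 := by
    rwa [intR, if_pos (by exact_mod_cast hk), Int.toNat_natCast]
  rw [h.intR_eq hN hF hθ] at h1
  have h2 := right_ne_zero_of_mul h1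
  unfold intR at h2
  split_ifs at h2 with h3
  · have h4 := hθ.R_graded _ _ _ h2
    have h5 : ((((k : ℤ) + delta α - delta β).toNat : ℤ) : 𝕜)
        = (((k : ℤ) + delta α - delta β : ℤ) : 𝕜) := by rw [Int.toNat_of_nonneg h3.le]
    push_cast at h5
    rw [h.μ, h.μ]
    linear_combination h4 + h5
  · exact absurd rfl h2

omit h hN hF hθ in
theorem flip_rev (α : Fin n) : flip α.rev = (flip α).rev := by
  by_cases h0 : α = 0
  · subst h0; rw [flip_zero, flip_last, Fin.rev_rev]
  by_cases h1 : α = Fin.rev 0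
  · subst h1; rw [Fin.rev_rev, flip_zero, flip_last]
  · rw [flip_other h0 h1, flip_other (IsType2Normalized.rev_ne_zero h1)
      (IsType2Normalized.rev_ne_last h0)]

omit h hN hF hθ in
theorem delta_rev (α : Fin n) : delta α.rev = -delta α := by
  simp only [delta, Fin.rev_eq_iff, Fin.rev_rev]
  ring

omit h hN hF hθ in
theorem lastSign_rev (hne : (Fin.rev 0 : Fin n) ≠ 0) (α : Fin n) :
    lastSign 𝕜 α.rev = lastSign 𝕜 α * (-1) ^ delta α := by
  simp only [delta, lastSign, Fin.rev_eq_iff, Fin.rev_rev]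
  by_cases h0 : α = 0
  · subst h0; simp [hne.symm]
  · by_cases h1 : α = Fin.rev 0 <;> simp [h0, h1, hne]

omit [NeZero n] h hN hF hθ D' in
theorem _root_.FrobeniusData.IsCalibration.intR_symm (hθ : D.IsCalibration) (l : ℤ) (α β : Fin n) :
    ∑ γ, D.η α γ * D.intR l γ β = (-1) ^ (l + 1) * ∑ γ, D.η β γ * D.intR l γ α := by
  unfold intR
  split_ifs with hl
  · have h1 := hθ.R_symm l.toNat (by omega) α β
    rw [h1, ← zpow_natCast]
    push_cast
    rw [Int.toNat_of_nonneg hl.le]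
  · simp

/-- The old symmetry is used in degree k − δ(α) − δ(β). Its altered parity is compensated by the
signs that `lastSign` acquires when an index is reversed. -/
theorem R_symm (k : ℕ) (hk : 1 ≤ k) (α β : Fin n) :
    ∑ γ, D'.η α γ * D'.R k γ β = (-1) ^ (k + 1) * ∑ γ, D'.η β γ * D'.R k γ α := by
  have hne := hN.rev_zero_ne
  have e : D'.R k = D'.intR k := by
    rw [intR, if_pos (by exact_mod_cast hk), Int.toNat_natCast]
  have hsum : ∀ α β, ∑ γ, D'.η α γ * D'.intR k γ β = D'.intR k α.rev β := fun α β => by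
    simp [h.η, hN.η]
  have hsum' : ∀ l α β, ∑ γ, D.η α γ * D.intR l γ β = D.intR l α.rev β := fun l α β => by
    simp [hN.η]
  have hs := hθ.intR_symm ((k : ℤ) - delta α - delta β) (flip α) (flip β)
  rw [hsum', hsum'] at hs
  rw [e, hsum, hsum, h.intR_eq hN hF hθ, h.intR_eq hN hF hθ, flip_rev, flip_rev, delta_rev,
    delta_rev, ← sub_eq_add_neg, ← sub_eq_add_neg, hs,
    show (k : ℤ) - delta β - delta α = k - delta α - delta β by ring, lastSign_rev hne,
    lastSign_rev hne]
  have h1 : (-1 : 𝕜) ≠ 0 := by simp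
  rw [zpow_add₀ h1, zpow_sub₀ h1, zpow_sub₀ h1, zpow_natCast, zpow_one, pow_succ]
  have h2 : ∀ a : ℤ, ((-1 : 𝕜) ^ a) * (-1) ^ a = 1 := fun a => by rw [← mul_zpow]; simp
  have h3 : ∀ a : ℤ, ((-1 : 𝕜) ^ a) ≠ 0 := fun a => zpow_ne_zero a h1
  have h4 : ∀ a : ℤ, ((-1 : 𝕜) ^ a)⁻¹ = (-1) ^ a := fun a =>
    (eq_inv_of_mul_eq_one_left (h2 a)).symm
  have h5 : ((-1 : 𝕜) ^ k) * (-1) ^ k = 1 := by rw [← mul_pow]; simp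
  simp only [div_eq_mul_inv, h4]
  linear_combination (-((-1) ^ k * lastSign 𝕜 β * lastSign 𝕜 α * (-1) ^ k * (-1) ^ delta β *
    D.intR (↑k - delta α - delta β) (flip β).rev (flip α))) * h2 (delta α)

theorem isCalibration : D'.IsCalibration where
  smooth := h.contDiffOn_theta hN hF hθ
  flat v' hv' α β ν p := by
    obtain ⟨v, hv, rfl⟩ : v' ∈ D.type2Coord '' D.dom := h.dom ▸ hv'
    exact h.flat hN hF hθ hv α β ν p
  homogeneous v' hv' α β p := by
    obtain ⟨v, hv, rfl⟩ : v' ∈ D.type2Coord '' D.dom := h.dom ▸ hv'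
    exact h.homogeneous hN hF hθ hv α β p
  theta_zero v' hv' α := by
    obtain ⟨v, hv, rfl⟩ : v' ∈ D.type2Coord '' D.dom := h.dom ▸ hv'
    rw [h.theta_zero hN hθ hv]
    simp [h.η, hN.η]
  orthogonal v' hv' α β p := by
    obtain ⟨v, hv, rfl⟩ : v' ∈ D.type2Coord '' D.dom := h.dom ▸ hv'
    exact h.orthogonal hN hF hθ hv α β p
  unit_deriv v' hv' α p := by
    obtain ⟨v, hv, rfl⟩ : v' ∈ D.type2Coord '' D.dom := h.dom ▸ hv'
    rw [h.unit]
    exact h.unit_deriv hN hF hθ hv α p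
  R_zero := h.R_zero
  R_graded := h.R_graded hN hF hθ
  R_symm := h.R_symm hN hF hθ

end IsType2

end FrobeniusData

/-! ### Calculus for functions of infinitely many times. -/

section TimesCalculus

variable {𝕜 : Type*} [RCLike 𝕜] {n : ℕ} {Ω : Set (Times 𝕜 n)} {t : Times 𝕜 n}

section FiniteDimensional

variable {E : Type*} [NormedAddCommGroup E] [NormedSpace 𝕜 E] [FiniteDimensional 𝕜 E]

theorem TimesOpen.isOpen_preimage (hΩ : TimesOpen Ω) (t : Times 𝕜 n) (φ : E →ₗ[𝕜] Times 𝕜 n) :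
    IsOpen {s | t + φ s ∈ Ω} := by
  let e : E ≃L[𝕜] (Fin (Module.finrank 𝕜 E) → 𝕜) :=
    (Module.finBasis 𝕜 E).equivFun.toContinuousLinearEquiv
  have h := (hΩ _ t (φ ∘ₗ e.symm.toLinearEquiv.toLinearMap)).preimage e.continuous
  convert h using 1
  ext s
  simp

theorem TimesSmoothOn.contDiffOn {V : Type*} [NormedAddCommGroup V] [NormedSpace 𝕜 V]
    {f : Times 𝕜 n → V} (hf : TimesSmoothOn f Ω) (t : Times 𝕜 n) (φ : E →ₗ[𝕜] Times 𝕜 n) :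
    ContDiffOn 𝕜 ∞ (fun s => f (t + φ s)) {s | t + φ s ∈ Ω} := by
  let e : E ≃L[𝕜] (Fin (Module.finrank 𝕜 E) → 𝕜) :=
    (Module.finBasis 𝕜 E).equivFun.toContinuousLinearEquiv
  have h := (hf _ t (φ ∘ₗ e.symm.toLinearEquiv.toLinearMap)).comp
    (e.contDiff (n := ∞)).contDiffOn (s := {s | t + φ s ∈ Ω}) fun s hs => by simpa using hs
  refine h.congr fun s _ => ?_
  simp

theorem TimesSmoothOn.contDiffAt {V : Type*} [NormedAddCommGroup V] [NormedSpace 𝕜 V]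
    {f : Times 𝕜 n → V} (hf : TimesSmoothOn f Ω) (hΩ : TimesOpen Ω) (t : Times 𝕜 n)
    (φ : E →ₗ[𝕜] Times 𝕜 n) {s : E} (hs : t + φ s ∈ Ω) :
    ContDiffAt 𝕜 ∞ (fun s => f (t + φ s)) s :=
  (hf.contDiffOn t φ).contDiffAt ((hΩ.isOpen_preimage t φ).mem_nhds hs)

end FiniteDimensional

/-- Derivatives along an affine subspace. -/
theorem lineDeriv_affine {E : Type*} [AddCommGroup E] [Module 𝕜 E] (f : Times 𝕜 n → 𝕜)
    (t : Times 𝕜 n) (φ : E →ₗ[𝕜] Times 𝕜 n) (s w : E) :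
    lineDeriv 𝕜 (fun s => f (t + φ s)) s w = lineDeriv 𝕜 f (t + φ s) (φ w) := by
  unfold lineDeriv
  congr 1
  funext r
  beta_reduce
  rw [map_add, map_smul, add_assoc]

/-- The coordinate plane spanned by the directions `∂/∂t^{ι a}`. -/
def timePlane (𝕜 : Type*) [RCLike 𝕜] {n k : ℕ} (ι : Fin k → Fin n × ℕ) :
    (Fin k → 𝕜) →ₗ[𝕜] Times 𝕜 n :=
  Fintype.linearCombination 𝕜 fun a => Finsupp.single (ι a) 1

theorem timePlane_single {k : ℕ} (ι : Fin k → Fin n × ℕ) (a : Fin k) :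
    timePlane 𝕜 ι (Pi.single a 1) = Finsupp.single (ι a) 1 := by
  simp [timePlane, Fintype.linearCombination_apply_single]

/-- Transfers time derivatives to partial derivatives on a finite-dimensional coordinate plane,
where the rules above apply. -/
theorem td_timePlane {k : ℕ} (ι : Fin k → Fin n × ℕ) (a : Fin k) (f : Times 𝕜 n → 𝕜)
    (t : Times 𝕜 n) (s : Fin k → 𝕜) :
    td (ι a) f (t + timePlane 𝕜 ι s) = pd a (fun s => f (t + timePlane 𝕜 ι s)) s := by
  rw [pd, lineDeriv_affine, timePlane_single, td]

theorem td_eq_pd (i : Fin n × ℕ) (f : Times 𝕜 n → 𝕜) (t : Times 𝕜 n) :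
    td i f t = pd 0 (fun s : Fin 1 → 𝕜 => f (t + timePlane 𝕜 (fun _ => i) s)) 0 := by
  rw [← td_timePlane (fun _ : Fin 1 => i), map_zero, add_zero]

theorem td_congr {f g : Times 𝕜 n → 𝕜} (hΩ : TimesOpen Ω) (h : ∀ t ∈ Ω, f t = g t) (ht : t ∈ Ω)
    (i : Fin n × ℕ) : td i f t = td i g t := by
  rw [td_eq_pd, td_eq_pd]
  exact pd_congr (hΩ.isOpen_preimage t (timePlane 𝕜 fun _ => i)) (fun s hs => h _ hs)
    (by simpa using ht) 0

theorem td_comm {f : Times 𝕜 n → 𝕜} (hΩ : TimesOpen Ω) (hf : TimesSmoothOn f Ω) (ht : t ∈ Ω)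
    (i j : Fin n × ℕ) : td i (td j f) t = td j (td i f) t := by
  have h : ∀ a b, td (![i, j] a) (td (![i, j] b) f) t
      = pd a (pd b fun s => f (t + timePlane 𝕜 ![i, j] s)) 0 := by
    intro a b
    have := td_timePlane ![i, j] a (td (![i, j] b) f) t 0
    rw [map_zero, add_zero] at this
    rw [this]
    congr 1
    funext s
    exact td_timePlane _ _ _ _ _
  refine (h 0 1).trans (Eq.trans ?_ (h 1 0).symm)
  exact pd_comm (hf.contDiffOn t _) (hΩ.isOpen_preimage t _) (by simpa using ht) 0 1

theorem TimesSmoothOn.td {f : Times 𝕜 n → 𝕜} (hf : TimesSmoothOn f Ω) (hΩ : TimesOpen Ω)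
    (i : Fin n × ℕ) : TimesSmoothOn (td i f) Ω := by
  intro k t φ
  -- Enlarging the subspace by the direction i exhibits the time derivative as a directional
  -- derivative of one smooth function of finitely many variables.
  let ψ : (Fin k → 𝕜) × 𝕜 →ₗ[𝕜] Times 𝕜 n :=
    φ.coprod (LinearMap.toSpanSingleton 𝕜 _ (Finsupp.single i 1))
  have h1 := (hf.contDiffOn t ψ).fderiv_of_isOpen (hΩ.isOpen_preimage t ψ) (m := ∞) (by simp)
  have h2 : ContDiffOn 𝕜 ∞ (fun p => fderiv 𝕜 (fun s => f (t + ψ s)) p ((0, 1) : (Fin k → 𝕜) × 𝕜))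
      {s | t + ψ s ∈ Ω} := h1.clm_apply contDiffOn_const
  have h3 : ContDiffOn 𝕜 ∞ (fun s : Fin k → 𝕜 => (s, (0 : 𝕜))) {s | t + φ s ∈ Ω} := by fun_prop
  refine (h2.comp h3 fun s hs => by simpa [ψ] using hs).congr fun s hs => ?_
  have hs' : t + ψ (s, 0) ∈ Ω := by simpa [ψ] using hs
  have hd := (hf.contDiffAt hΩ t ψ hs').differentiableAt (by simp)
  rw [Function.comp_apply, ← hd.lineDeriv_eq_fderiv, lineDeriv_affine]
  simp [ψ, _root_.td]

theorem TimesSmoothOn.differentiableAt {f : Times 𝕜 n → 𝕜} (hf : TimesSmoothOn f Ω)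
    (hΩ : TimesOpen Ω) (ht : t ∈ Ω) (i : Fin n × ℕ) :
    DifferentiableAt 𝕜 (fun s : Fin 1 → 𝕜 => f (t + timePlane 𝕜 (fun _ => i) s)) 0 :=
  (hf.contDiffAt hΩ t _ (by simpa using ht)).differentiableAt (by simp)

theorem TimesSmoothOn.comp {V W : Type*} [NormedAddCommGroup V] [NormedSpace 𝕜 V]
    [NormedAddCommGroup W] [NormedSpace 𝕜 W] {v : Times 𝕜 n → V} {g : V → W} {U : Set V}
    (hv : TimesSmoothOn v Ω) (hg : ContDiffOn 𝕜 ∞ g U) (h : ∀ t ∈ Ω, v t ∈ U) :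
    TimesSmoothOn (fun t => g (v t)) Ω := fun k t φ =>
  ContDiffOn.comp hg (hv k t φ) fun _ hs => h _ hs

variable {f g : Times 𝕜 n → 𝕜}

theorem td_const_mul (hΩ : TimesOpen Ω) (c : 𝕜) (hf : TimesSmoothOn f Ω) (ht : t ∈ Ω)
    (i : Fin n × ℕ) : td i (fun t => c * f t) t = c * td i f t := by
  rw [td_eq_pd, td_eq_pd, pd_const_mul _ (hf.differentiableAt hΩ ht i)]

theorem td_sub (hΩ : TimesOpen Ω) (hf : TimesSmoothOn f Ω) (hg : TimesSmoothOn g Ω) (ht : t ∈ Ω)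
    (i : Fin n × ℕ) : td i (fun t => f t - g t) t = td i f t - td i g t := by
  rw [td_eq_pd, td_eq_pd, td_eq_pd, pd_sub (hf.differentiableAt hΩ ht i)
    (hg.differentiableAt hΩ ht i)]

theorem td_mul (hΩ : TimesOpen Ω) (hf : TimesSmoothOn f Ω) (hg : TimesSmoothOn g Ω) (ht : t ∈ Ω)
    (i : Fin n × ℕ) : td i (fun t => f t * g t) t = td i f t * g t + f t * td i g t := by
  rw [td_eq_pd, td_eq_pd, td_eq_pd, pd_mul (hf.differentiableAt hΩ ht i)
    (hg.differentiableAt hΩ ht i)]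
  simp

theorem td_sum {ι : Type*} (s : Finset ι) {f : ι → Times 𝕜 n → 𝕜} (hΩ : TimesOpen Ω)
    (hf : ∀ a ∈ s, TimesSmoothOn (f a) Ω) (ht : t ∈ Ω) (i : Fin n × ℕ) :
    td i (fun t => ∑ a ∈ s, f a t) t = ∑ a ∈ s, td i (f a) t := by
  simp_rw [td_eq_pd]
  exact pd_sum s (fun a ha => (hf a ha).differentiableAt hΩ ht i) 0

theorem timesSmoothOn_coord (i : Fin n × ℕ) (Ω : Set (Times 𝕜 n)) :
    TimesSmoothOn (fun t : Times 𝕜 n => t i) Ω := by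
  intro k t φ
  have : (fun s => (t + φ s) i) = fun s => t i + (Finsupp.lapply i ∘ₗ φ) s := by
    funext s; simp
  rw [this]
  have h := (LinearMap.toContinuousLinearMap (Finsupp.lapply (R := 𝕜) i ∘ₗ φ)).contDiff (n := ∞)
  exact (contDiff_const.add h).contDiffOn

theorem td_coord (i j : Fin n × ℕ) (t : Times 𝕜 n) :
    td i (fun t => t j) t = if i = j then 1 else 0 := by
  have : (fun r : 𝕜 => (t + r • Finsupp.single i (1 : 𝕜)) j)
      = fun r => t j + r * if i = j then 1 else 0 := by
    funext r; simp [Finsupp.single_apply]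
  rw [td, lineDeriv, this]
  split_ifs <;> simp

end TimesCalculus

/-! ### The hierarchy from the second derivatives of log τ. -/

namespace FrobeniusData

variable {𝕜 : Type*} [RCLike 𝕜] {n : ℕ} {D : FrobeniusData 𝕜 n} {Ω : Set (Times 𝕜 n)}
  {v : Times 𝕜 n → Fin n → 𝕜} {logτ : Times 𝕜 n → 𝕜}

theorem IsCalibration.gradPair_theta_zero (hθ : D.IsCalibration) (hF : D.IsWDVV) {v : Fin n → 𝕜}
    (hv : v ∈ D.dom) (α : Fin n) (f : (Fin n → 𝕜) → 𝕜) :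
    D.gradPair (D.θ α 0) f v = pd α f v := by
  have h1 : ∀ γ, pd γ (D.θ α 0) v = D.η α γ := fun γ => by
    rw [pd_congr hF.isOpen (fun w hw => hθ.theta_zero w hw α) hv, pd_linear]
  have h2 : D.η * D.η⁻¹ = 1 := Matrix.mul_nonsing_inv _ (isUnit_iff_ne_zero.2 hF.nondegenerate)
  simp_rw [gradPair, h1]
  rw [Finset.sum_comm]
  simp_rw [← Finset.sum_mul, ← Matrix.mul_apply, h2]
  simp [Matrix.one_apply]

/-- The equations of the hierarchy follow from those for the second derivatives of `log τ`. -/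
theorem IsTau.of_twoPoint (hF : D.IsWDVV) (hθ : D.IsCalibration) (hΩ : TimesOpen Ω)
    (hv : TimesSmoothOn v Ω) (hl : TimesSmoothOn logτ Ω) (hm : ∀ t ∈ Ω, v t ∈ D.dom)
    (h : ∀ t ∈ Ω, ∀ α p β q, td (α, p) (td (β, q) logτ) t = D.twoPoint α p β q (v t)) :
    D.IsTau Ω v logτ := by
  have hx : ∀ t ∈ Ω, ∀ α p, td (D.unit, 0) (td (α, p) logτ) t = D.θ α p (v t) := by
    intro t ht α p
    rw [h t ht, (D.twoPoint_spec_zero hθ _ _ _ _ (hm t ht)).2,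
      hθ.gradPair_theta_zero hF (hm t ht), hθ.unit_deriv _ (hm t ht)]
  refine ⟨hΩ, hv, hl, hm, fun t ht α β q => ?_, hx, h⟩
  have hs : ∀ γ, TimesSmoothOn (td (D.unit, 0) (td (γ, 0) logτ)) Ω := fun γ =>
    (hl.td hΩ _).td hΩ _
  -- The solution is itself a second derivative of log τ. Its flow equations then follow by
  -- commuting third derivatives, since Ω_{γ,0;β,q} = ∂_γθ_{β,q+1}.
  have e : ∀ s ∈ Ω, v s α = ∑ γ, D.η⁻¹ α γ * td (D.unit, 0) (td (γ, 0) logτ) s := by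
    intro s hs
    have h2 : D.η⁻¹ * D.η = 1 := Matrix.nonsing_inv_mul _ (isUnit_iff_ne_zero.2 hF.nondegenerate)
    simp_rw [hx s hs, hθ.theta_zero _ (hm s hs), Finset.mul_sum]
    rw [Finset.sum_comm]
    simp_rw [← mul_assoc, ← Finset.sum_mul, ← Matrix.mul_apply, h2]
    simp [Matrix.one_apply]
  rw [td_congr hΩ e ht, td_sum _ hΩ (fun γ _ => (hs γ).comp
    (g := fun z : 𝕜 => D.η⁻¹ α γ * z) (U := Set.univ) (by fun_prop) (by simp)) ht]
  refine Finset.sum_congr rfl fun γ _ => ?_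
  rw [td_const_mul hΩ _ (hs γ) ht]
  congr 1
  rw [td_comm hΩ (hl.td hΩ _) ht]
  refine td_congr hΩ (fun s hs => ?_) ht _
  rw [td_comm hΩ hl hs, h s hs, (D.twoPoint_spec_zero hθ _ _ _ _ (hm s hs)).2,
    hθ.gradPair_theta_zero hF (hm s hs)]

end FrobeniusData

/-! ### The change of times as a Legendre transformation. -/

namespace FrobeniusData

variable {𝕜 : Type*} [RCLike 𝕜] {n : ℕ} [NeZero n] {Ω : Set (Times 𝕜 n)} {t : Times 𝕜 n}

/-- The signs in `t̂^i = ε_i t^{σ(i)}`. -/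
def type2Sign (𝕜 : Type*) [RCLike 𝕜] (i : Fin n × ℕ) : 𝕜 := lastSign 𝕜 i.1 * (-1) ^ i.2

/-- The permutation `σ` of indices in `t̂^i = ε_i t^{σ(i)}`, `i ≠ (1,0)`. -/
def type2Index (i : Fin n × ℕ) : Fin n × ℕ := (flip i.1, ((i.2 : ℤ) - delta i.1).toNat)

theorem type2Sign_mul_self (i : Fin n × ℕ) : type2Sign 𝕜 i * type2Sign 𝕜 i = 1 := by
  have h : ((-1 : 𝕜) ^ i.2) * (-1) ^ i.2 = 1 := by rw [← mul_pow]; simp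
  simp only [type2Sign]
  linear_combination (lastSign 𝕜 i.1 * lastSign 𝕜 i.1) * h + lastSign_mul_self (𝕜 := 𝕜) i.1

section Index

variable (hne : (Fin.rev 0 : Fin n) ≠ 0)
include hne

theorem type2Index_zero_succ (p : ℕ) : type2Index ((0 : Fin n), p + 1) = (Fin.rev 0, p) := by
  simp [type2Index, delta_zero hne, flip_zero]

theorem type2Index_last (p : ℕ) : type2Index ((Fin.rev 0 : Fin n), p) = (0, p + 1) := by
  rw [type2Index, delta_last hne, flip_last]
  congr 1

omit hne in
theorem type2Index_other {α : Fin n} (h0 : α ≠ 0) (h1 : α ≠ Fin.rev 0) (p : ℕ) :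
    type2Index (α, p) = (α, p) := by
  simp [type2Index, delta_other h0 h1, flip_other h0 h1]

/-- Away from (1,0) the change of times is its own inverse, signs included. -/
theorem type2Index_involution {i : Fin n × ℕ} (hi : i ≠ (0, 0)) :
    type2Index i ≠ (0, 0) ∧ type2Index (type2Index i) = i
      ∧ type2Sign 𝕜 (type2Index i) = type2Sign 𝕜 i := by
  obtain ⟨α, p⟩ := i
  by_cases h0 : α = 0
  · subst h0
    obtain ⟨q, rfl⟩ : ∃ q, p = q + 1 := Nat.exists_eq_succ_of_ne_zero fun e => hi (by rw [e])
    rw [type2Index_zero_succ hne, type2Index_last hne]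
    simp [hne, hne.symm, type2Sign, lastSign, pow_succ]
  by_cases h1 : α = Fin.rev 0
  · subst h1
    rw [type2Index_last hne, type2Index_zero_succ hne]
    simp [hne.symm, type2Sign, lastSign, pow_succ]
  · rw [type2Index_other h0 h1, type2Index_other h0 h1]
    simp [h0]

theorem type2Density_eq_index {D : FrobeniusData 𝕜 n} {i : Fin n × ℕ} (hi : i ≠ (0, 0))
    (v : Fin n → 𝕜) : D.type2Density i.1 i.2 v
      = type2Sign 𝕜 i * D.θ (type2Index i).1 (type2Index i).2 v := by
  have h : ¬(i.1 = 0 ∧ i.2 = 0) := fun h => hi (Prod.ext h.1 h.2)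
  obtain ⟨q, hq⟩ := exists_type2_index hne h
  rw [type2Density_eq h hq]
  simp [type2Sign, type2Index, ← hq]

end Index

/-- The linear part of the change of times. -/
def type2Linear (𝕜 : Type*) [RCLike 𝕜] (n : ℕ) [NeZero n] : Times 𝕜 n →ₗ[𝕜] Times 𝕜 n :=
  Finsupp.linearCombination 𝕜 fun i =>
    if i = (0, 0) then 0 else Finsupp.single (type2Index i) (type2Sign 𝕜 i)

theorem type2Linear_single_zero (c : 𝕜) :
    type2Linear 𝕜 n (Finsupp.single (0, 0) c) = 0 := by
  simp [type2Linear, Finsupp.linearCombination_single]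

theorem type2Linear_single {i : Fin n × ℕ} (hi : i ≠ (0, 0)) (c : 𝕜) :
    type2Linear 𝕜 n (Finsupp.single i c)
      = (c * type2Sign 𝕜 i) • Finsupp.single (type2Index i) 1 := by
  simp [type2Linear, Finsupp.linearCombination_single, hi]

section Linear

variable (hne : (Fin.rev 0 : Fin n) ≠ 0)
include hne

theorem type2Linear_apply (t : Times 𝕜 n) (j : Fin n × ℕ) :
    type2Linear 𝕜 n t j = if j = (0, 0) then 0 else type2Sign 𝕜 j * t (type2Index j) := by
  induction t using Finsupp.induction_linear with
  | zero => simp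
  | add f g hf hg =>
    rw [map_add, Finsupp.add_apply, hf, hg, Finsupp.add_apply]
    split_ifs <;> ring
  | single i c =>
    by_cases hi : i = (0, 0)
    · subst hi
      rw [type2Linear_single_zero, Finsupp.zero_apply]
      split_ifs with hj
      · rfl
      · rw [Finsupp.single_eq_of_ne (type2Index_involution (𝕜 := 𝕜) hne hj).1, mul_zero]
    · obtain ⟨h1, h2, h3⟩ := type2Index_involution (𝕜 := 𝕜) hne hi
      rw [type2Linear_single hi, Finsupp.smul_apply]
      split_ifs with hj
      · subst hj
        rw [Finsupp.single_eq_of_ne h1.symm, smul_zero]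
      · obtain ⟨-, h5, h6⟩ := type2Index_involution (𝕜 := 𝕜) hne hj
        by_cases e : type2Index i = j
        · subst e
          rw [h2, h3]
          simp [mul_comm]
        · rw [Finsupp.single_eq_of_ne (Ne.symm e), Finsupp.single_eq_of_ne
            (fun e' => e (by rw [← e', h5]))]
          simp

theorem type2Linear_type2Linear (t : Times 𝕜 n) :
    type2Linear 𝕜 n (type2Linear 𝕜 n t) = t - Finsupp.single (0, 0) (t (0, 0)) := by
  ext j
  rw [type2Linear_apply hne, Finsupp.sub_apply]
  split_ifs with hj
  · subst hj; simp
  · obtain ⟨h1, h2, h3⟩ := type2Index_involution (𝕜 := 𝕜) hne hj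
    rw [type2Linear_apply hne, if_neg h1, h2, h3, ← mul_assoc, type2Sign_mul_self,
      Finsupp.single_eq_of_ne hj]
    ring

theorem type2Time_eq (logτ : Times 𝕜 n → 𝕜) (t : Times 𝕜 n) :
    type2Time logτ t = type2Linear 𝕜 n t - Finsupp.single (0, 0) (td (0, 0) logτ t) := by
  ext ⟨α, p⟩
  rw [Finsupp.sub_apply, type2Linear_apply hne]
  change type2TimeFun logτ t (α, p) = _
  by_cases h0 : α = 0
  · subst h0
    cases p with
    | zero => simp [type2TimeFun]
    | succ p =>
      rw [if_neg (by simp), type2Index_zero_succ hne, Finsupp.single_eq_of_ne (by simp)]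
      simp [type2TimeFun, type2Sign, lastSign, hne.symm]
  by_cases h1 : α = Fin.rev 0
  · subst h1
    rw [if_neg (by simp [hne]), type2Index_last hne, Finsupp.single_eq_of_ne (by simp [hne])]
    simp [type2TimeFun, type2Sign, lastSign, hne, pow_succ]
  · rw [if_neg (by simp [h0]), type2Index_other h0 h1, Finsupp.single_eq_of_ne (by simp [h0])]
    simp [type2TimeFun, type2Sign, lastSign, h0, h1]

end Linear

/-- The change of times in which `t^{1,0}` is replaced by `-u(t)`. -/
def legendreTime (u : Times 𝕜 n → 𝕜) (t : Times 𝕜 n) : Times 𝕜 n :=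
  type2Linear 𝕜 n t - Finsupp.single (0, 0) (u t)

section Legendre

variable {u : Times 𝕜 n → 𝕜}

/-- Affine subspaces of the new times, thickened in the direction of `t̂^{1,0}`, correspond to
affine subspaces of the old times. -/
theorem exists_legendre_chart (hne : (Fin.rev 0 : Fin n) ≠ 0) (hΩ : TimesOpen Ω)
    (hu : TimesSmoothOn u Ω) (hx : ∀ t ∈ Ω, td (0, 0) u t ≠ 0)
    {k : ℕ} (t₀ : Times 𝕜 n) (φ : (Fin k → 𝕜) →ₗ[𝕜] Times 𝕜 n) {s₀ : Fin k → 𝕜}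
    (hs : t₀ + φ s₀ ∈ legendreTime u '' Ω) :
    ∃ (t₁ : Times 𝕜 n) (ψ : (Fin k → 𝕜) × 𝕜 →ₗ[𝕜] Times 𝕜 n) (G : (Fin k → 𝕜) × 𝕜 → 𝕜)
      (H' : ((Fin k → 𝕜) × 𝕜) ≃L[𝕜] ((Fin k → 𝕜) × 𝕜)),
      t₁ + ψ (s₀, 0) ∈ Ω ∧ G (s₀, 0) = 0 ∧
      ContDiffAt 𝕜 ∞ (fun p : (Fin k → 𝕜) × 𝕜 => (p.1, G p)) (s₀, 0) ∧
      HasFDerivAt (fun p : (Fin k → 𝕜) × 𝕜 => (p.1, G p))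
        (H' : ((Fin k → 𝕜) × 𝕜) →L[𝕜] ((Fin k → 𝕜) × 𝕜)) (s₀, 0) ∧
      ∀ p, legendreTime u (t₁ + ψ p) = t₀ + φ p.1 + Finsupp.single (0, 0) (G p) := by
  obtain ⟨t, ht, e⟩ := hs
  -- Up to the (1,0) component, the linear part of the change of times inverts itself, so it carries
  -- φ back to the old times; the added variable moves x = t^{1,0}.
  let t₁ : Times 𝕜 n := t - type2Linear 𝕜 n (φ s₀)
  let ψ : (Fin k → 𝕜) × 𝕜 →ₗ[𝕜] Times 𝕜 n :=
    (type2Linear 𝕜 n ∘ₗ φ).coprod (LinearMap.toSpanSingleton 𝕜 _ (Finsupp.single (0, 0) 1))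
  let l : (Fin k → 𝕜) × 𝕜 →L[𝕜] 𝕜 := LinearMap.toContinuousLinearMap
    (Finsupp.lapply (R := 𝕜) (0, 0) ∘ₗ φ ∘ₗ LinearMap.fst 𝕜 (Fin k → 𝕜) 𝕜)
  -- The distance, in direction t̂^{1,0}, between the image point and the given affine subspace.
  let G : (Fin k → 𝕜) × 𝕜 → 𝕜 := fun p =>
    u t - u (t₁ + ψ p) - l p + φ s₀ (0, 0)
  have hψ : t₁ + ψ (s₀, 0) = t := by simp [t₁, ψ]
  have hψ' : t₁ + ψ (s₀, 0) ∈ Ω := hψ ▸ ht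
  have hU : ContDiffAt 𝕜 ∞ (fun p => u (t₁ + ψ p)) (s₀, 0) := hu.contDiffAt hΩ t₁ ψ hψ'
  have hd := hU.differentiableAt (by simp)
  have hG : HasFDerivAt G (0 - fderiv 𝕜 (fun p => u (t₁ + ψ p)) (s₀, 0) - l) (s₀, 0) :=
    (((hasFDerivAt_const _ _).sub hd.hasFDerivAt).sub l.hasFDerivAt).add_const _
  let H : ((Fin k → 𝕜) × 𝕜) →L[𝕜] ((Fin k → 𝕜) × 𝕜) :=
    (ContinuousLinearMap.fst 𝕜 (Fin k → 𝕜) 𝕜).prod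
      (0 - fderiv 𝕜 (fun p => u (t₁ + ψ p)) (s₀, 0) - l)
  -- The derivative of G in the added variable is −∂u/∂x ≠ 0, so (s,x) ↦ (s,G) is a local
  -- diffeomorphism.
  have h01 : fderiv 𝕜 (fun p => u (t₁ + ψ p)) (s₀, 0) (0, 1) = td (0, 0) u t := by
    rw [← hd.lineDeriv_eq_fderiv, lineDeriv_affine, hψ]
    simp [ψ, td]
  have hH : Function.Injective (H : ((Fin k → 𝕜) × 𝕜) →ₗ[𝕜] ((Fin k → 𝕜) × 𝕜)) := by
    rw [← LinearMap.ker_eq_bot, LinearMap.ker_eq_bot']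
    rintro ⟨s, x⟩ hsx
    have h1 : s = 0 := congrArg Prod.fst hsx
    subst h1
    have h2 : (0 - fderiv 𝕜 (fun p => u (t₁ + ψ p)) (s₀, 0) - l) ((0 : Fin k → 𝕜), x) = 0 :=
      congrArg Prod.snd hsx
    have h3 : ((0 : Fin k → 𝕜), x) = x • ((0 : Fin k → 𝕜), (1 : 𝕜)) := by simp
    rw [h3, map_smul] at h2
    have h4 : l (0, 1) = 0 := by simp [l]
    rw [sub_apply, sub_apply, h4, sub_zero, zero_apply, zero_sub, smul_neg, neg_eq_zero,
      smul_eq_zero] at h2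
    have h5 : x = 0 := h2.resolve_right fun e => hx t ht (h01.symm.trans e)
    rw [h5]; rfl
  refine ⟨t₁, ψ, G, (LinearEquiv.ofInjectiveEndo _ hH).toContinuousLinearEquiv, hψ', ?_, ?_, ?_,
    fun p => ?_⟩
  · simp only [G, hψ]
    simp [l]
  · exact contDiffAt_fst.prodMk (((contDiffAt_const.sub hU).sub l.contDiff.contDiffAt).add
      contDiffAt_const)
  · have h1 : HasFDerivAt (fun p : (Fin k → 𝕜) × 𝕜 => (p.1, G p)) H (s₀, 0) :=
      hasFDerivAt_fst.prodMk hG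
    exact h1.congr_fderiv (by ext <;> rfl)
  · have e1 : t₀ = type2Linear 𝕜 n t - Finsupp.single (0, 0) (u t) - φ s₀ :=
      eq_sub_of_add_eq e.symm
    have e2 : ψ p = type2Linear 𝕜 n (φ p.1) + p.2 • Finsupp.single (0, 0) 1 := by simp [ψ]
    have e3 : G p = u t - u (t₁ + ψ p) - φ p.1 (0, 0) + φ s₀ (0, 0) := by simp [G, l]
    have e4 : type2Linear 𝕜 n (t₁ + ψ p)
        = type2Linear 𝕜 n t - (φ s₀ - Finsupp.single (0, 0) (φ s₀ (0, 0)))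
          + (φ p.1 - Finsupp.single (0, 0) (φ p.1 (0, 0))) := by
      rw [e2, map_add, map_add, map_smul, type2Linear_single_zero, smul_zero, add_zero, map_sub,
        type2Linear_type2Linear hne, type2Linear_type2Linear hne]
    rw [legendreTime, e4, e3, e1]
    simp only [Finsupp.single_add, Finsupp.single_sub]
    abel

/-- In the chart, (s,x) ↦ (s,G) is open; the slice G = 0 of its image gives a neighbourhood of the
given point in the affine subspace. -/
theorem timesOpen_legendre (hne : (Fin.rev 0 : Fin n) ≠ 0) (hΩ : TimesOpen Ω)
    (hu : TimesSmoothOn u Ω) (hx : ∀ t ∈ Ω, td (0, 0) u t ≠ 0) :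
    TimesOpen (legendreTime u '' Ω) := by
  intro k t₀ φ
  rw [isOpen_iff_mem_nhds]
  intro s₀ hs
  obtain ⟨t₁, ψ, G, H', h1, h2, h3, h4, h5⟩ := exists_legendre_chart hne hΩ hu hx t₀ φ hs
  have h6 := image_mem_nhds_of_equiv h3 h4 ((hΩ.isOpen_preimage t₁ ψ).mem_nhds h1)
  rw [h2] at h6
  have h7 : Continuous fun s : Fin k → 𝕜 => (s, (0 : 𝕜)) := by fun_prop
  filter_upwards [h7.continuousAt.preimage_mem_nhds h6] with s hs
  obtain ⟨p, hp, hps⟩ := hs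
  refine ⟨t₁ + ψ p, hp, ?_⟩
  rw [h5, show G p = 0 from congrArg Prod.snd hps, show p.1 = s from congrArg Prod.fst hps]
  simp

/-- The chart makes f smooth on the thickened subspace, and restriction to G = 0 gives the claim. -/
theorem timesSmoothOn_legendre {V : Type*} [NormedAddCommGroup V] [NormedSpace 𝕜 V]
    (hne : (Fin.rev 0 : Fin n) ≠ 0) (hΩ : TimesOpen Ω)
    (hu : TimesSmoothOn u Ω) (hx : ∀ t ∈ Ω, td (0, 0) u t ≠ 0) {f : Times 𝕜 n → V}
    (hf : TimesSmoothOn (fun t => f (legendreTime u t)) Ω) :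
    TimesSmoothOn f (legendreTime u '' Ω) := by
  intro k t₀ φ s₀ hs
  obtain ⟨t₁, ψ, G, H', h1, h2, h3, h4, h5⟩ := exists_legendre_chart hne hΩ hu hx t₀ φ hs
  have h6 := contDiffAt_of_comp_of_equiv h3 h4
    (g := fun p : (Fin k → 𝕜) × 𝕜 => f (t₀ + φ p.1 + Finsupp.single (0, 0) p.2))
    ((hf.contDiffAt hΩ t₁ ψ h1).congr_of_eventuallyEq
      (Filter.Eventually.of_forall fun p => by simp only [h5]))
  rw [h2] at h6
  have h7 := ContDiffAt.comp s₀ (f := fun s : Fin k → 𝕜 => (s, (0 : 𝕜))) h6 (by fun_prop)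
  refine ContDiffAt.contDiffWithinAt (h7.congr_of_eventuallyEq
    (Filter.Eventually.of_forall fun s => ?_))
  simp

/-- The chain rule for the change of times. -/
theorem td_comp_legendre (hΩ : TimesOpen Ω) (hu : TimesSmoothOn u Ω) {f : Times 𝕜 n → 𝕜}
    (hΩ' : TimesOpen (legendreTime u '' Ω)) (hf : TimesSmoothOn f (legendreTime u '' Ω))
    (ht : t ∈ Ω) (j : Fin n × ℕ) :
    td j (fun t => f (legendreTime u t)) t
      = lineDeriv 𝕜 f (legendreTime u t) (type2Linear 𝕜 n (Finsupp.single j 1))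
        - td j u t * td (0, 0) f (legendreTime u t) := by
  -- Along t + r e_j the image stays in a plane through t̂: it is affine in r up to a nonlinear
  -- displacement along t̂^{1,0}. The ordinary chain rule in two variables is enough.
  let χ : 𝕜 × 𝕜 →ₗ[𝕜] Times 𝕜 n :=
    (LinearMap.toSpanSingleton 𝕜 _ (type2Linear 𝕜 n (Finsupp.single j 1))).coprod
      (LinearMap.toSpanSingleton 𝕜 _ (Finsupp.single (0, 0) 1))
  have hχ : ∀ a b, χ (a, b) = a • type2Linear 𝕜 n (Finsupp.single j 1)
      + b • Finsupp.single (0, 0) 1 := fun a b => by simp [χ]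
  have hK : DifferentiableAt 𝕜 (fun p => f (legendreTime u t + χ p)) (0, 0) :=
    (hf.contDiffAt hΩ' _ χ (by
      rw [hχ]; simpa using Set.mem_image_of_mem _ ht)).differentiableAt (by simp)
  have hu' : HasDerivAt (fun r : 𝕜 => u (t + r • Finsupp.single j 1)) (td j u t) 0 :=
    ((hu.contDiffAt hΩ t (LinearMap.toSpanSingleton 𝕜 _ (Finsupp.single j 1)) (s := 0)
      (by simpa using ht)).differentiableAt (by simp)).hasDerivAt
  have hc : HasDerivAt (fun r : 𝕜 => (r, u t - u (t + r • Finsupp.single j 1)))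
      ((1 : 𝕜), -td j u t) 0 := by
    have := hu'.const_sub (u t)
    exact (hasDerivAt_id (0 : 𝕜)).prodMk this
  have h0 : ((0 : 𝕜), u t - u (t + (0 : 𝕜) • Finsupp.single j 1)) = (0, 0) := by simp
  have h1 := HasFDerivAt.comp_hasDerivAt (0 : 𝕜) (h0 ▸ hK.hasFDerivAt) hc
  have h2 : (fun r : 𝕜 => f (legendreTime u (t + r • Finsupp.single j 1)))
      = (fun p => f (legendreTime u t + χ p)) ∘
        fun r : 𝕜 => (r, u t - u (t + r • Finsupp.single j 1)) := by
    funext r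
    rw [Function.comp_apply, hχ, legendreTime, legendreTime, map_add, map_smul]
    congr 1
    simp only [Finsupp.smul_single, smul_eq_mul, mul_one, Finsupp.single_sub]
    abel
  rw [td, lineDeriv, h2, h1.deriv, h0]
  have h3 : ((1 : 𝕜), -td j u t) = (1, 0) + (-td j u t) • ((0 : 𝕜), (1 : 𝕜)) := by simp
  rw [h3, map_add, map_smul, ← hK.lineDeriv_eq_fderiv, ← hK.lineDeriv_eq_fderiv,
    lineDeriv_affine, lineDeriv_affine, hχ, hχ, hχ]
  simp [td, sub_eq_add_neg]

end Legendre

end FrobeniusData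

/-! ### Transformation of tau functions. -/

namespace FrobeniusData

variable {𝕜 : Type*} [RCLike 𝕜] {n : ℕ} [NeZero n] {D D' : FrobeniusData 𝕜 n}
  {Ω : Set (Times 𝕜 n)} {t : Times 𝕜 n} {v v' : Times 𝕜 n → Fin n → 𝕜} {logτ logτ' : Times 𝕜 n → 𝕜}

omit [NeZero n] in
theorem IsTau.type1 (hF : D.IsWDVV) (hθ : D.IsCalibration) {κ : Fin n} (h : D.IsType1 κ D')
    (hτ : D.IsTau Ω v logτ) : D'.IsTau Ω (fun t => D.type1Coord κ (v t)) logτ :=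
  IsTau.of_twoPoint (h.isWDVV hF) (h.isCalibration hF hθ) hτ.isOpen
    (hτ.smooth_v.comp (h.isCoordChange hF).smooth hτ.mapsTo) hτ.smooth_logτ
    (fun t ht => h.mem_dom (hτ.mapsTo t ht)) fun t ht α p β q => by
      rw [hτ.tau t ht, h.twoPoint_eq hF hθ (hτ.mapsTo t ht)]

namespace IsType2

variable (h : D.IsType2 D') (hN : D.IsType2Normalized) (hF : D.IsWDVV) (hθ : D.IsCalibration)
  (hτ : D.IsTau Ω v logτ)

section Legendre

include hN hθ hτ

/-- The assumption v^n ≠ 0 is thus the nondegeneracy of the Legendre transformation in x. -/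
theorem td_zero_td_zero (ht : t ∈ Ω) : td (0, 0) (td (0, 0) logτ) t = v t (Fin.rev 0) := by
  have := hτ.tau_x t ht 0 0
  rwa [hN.unit, hN.theta_zero hθ (hτ.mapsTo t ht)] at this

omit hθ in
theorem td_td_zero (ht : t ∈ Ω) (i : Fin n × ℕ) :
    td i (td (0, 0) logτ) t = D.θ i.1 i.2 (v t) := by
  have := hτ.tau_x t ht i.1 i.2
  rw [hN.unit] at this
  rw [td_comm hτ.isOpen hτ.smooth_logτ ht, this]

theorem td_zero_ne (t : Times 𝕜 n) (ht : t ∈ Ω) : td (0, 0) (td (0, 0) logτ) t ≠ 0 := by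
  rw [td_zero_td_zero hN hθ hτ ht]
  exact hN.last_ne_zero _ (hτ.mapsTo t ht)

theorem timesOpen_image : TimesOpen (type2Time logτ '' Ω) := by
  have e : type2Time logτ = legendreTime (td (0, 0) logτ) :=
    funext fun t => type2Time_eq hN.rev_zero_ne logτ t
  rw [e]
  exact timesOpen_legendre hN.rev_zero_ne hτ.isOpen (hτ.smooth_logτ.td hτ.isOpen _)
    (td_zero_ne hN hθ hτ)

theorem timesSmoothOn_image {V : Type*} [NormedAddCommGroup V] [NormedSpace 𝕜 V]
    {f : Times 𝕜 n → V} (hf : TimesSmoothOn (fun t => f (type2Time logτ t)) Ω) :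
    TimesSmoothOn f (type2Time logτ '' Ω) := by
  have e : type2Time logτ = legendreTime (td (0, 0) logτ) :=
    funext fun t => type2Time_eq hN.rev_zero_ne logτ t
  rw [e] at hf ⊢
  exact timesSmoothOn_legendre hN.rev_zero_ne hτ.isOpen (hτ.smooth_logτ.td hτ.isOpen _)
    (td_zero_ne hN hθ hτ) hf

variable {f g : Times 𝕜 n → 𝕜}

theorem td_comp (hf : TimesSmoothOn f (type2Time logτ '' Ω)) (ht : t ∈ Ω) (j : Fin n × ℕ) :
    td j (fun t => f (type2Time logτ t)) t
      = lineDeriv 𝕜 f (type2Time logτ t) (type2Linear 𝕜 n (Finsupp.single j 1))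
        - D.θ j.1 j.2 (v t) * td (0, 0) f (type2Time logτ t) := by
  have hΩ := timesOpen_image hN hθ hτ
  have e : type2Time logτ = legendreTime (td (0, 0) logτ) :=
    funext fun t => type2Time_eq hN.rev_zero_ne logτ t
  rw [e] at hf hΩ ⊢
  rw [td_comp_legendre hτ.isOpen (hτ.smooth_logτ.td hτ.isOpen _) hΩ hf ht,
    td_td_zero hN hτ ht]

/-- The derivative `∂/∂t̂^{1,0}` in terms of the old times. -/
theorem td_zero_image (hg : TimesSmoothOn g Ω) (e : ∀ t ∈ Ω, f (type2Time logτ t) = g t)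
    (ht : t ∈ Ω) : td (0, 0) f (type2Time logτ t) = -(td (0, 0) g t / v t (Fin.rev 0)) := by
  have hw := hN.last_ne_zero _ (hτ.mapsTo t ht)
  have hf : TimesSmoothOn f (type2Time logτ '' Ω) := timesSmoothOn_image hN hθ hτ fun k t φ =>
    (hg k t φ).congr fun s hs => e _ hs
  have h1 := td_comp hN hθ hτ hf ht (0, 0)
  rw [td_congr hτ.isOpen e ht, type2Linear_single_zero, hN.theta_zero hθ (hτ.mapsTo t ht)] at h1
  rw [h1]
  simp only [lineDeriv, smul_zero, add_zero, deriv_const]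
  field_simp
  ring

/-- The derivatives `∂/∂t̂^i`, `i ≠ (1,0)`, in terms of the old times. -/
theorem td_image (hg : TimesSmoothOn g Ω) (e : ∀ t ∈ Ω, f (type2Time logτ t) = g t)
    (ht : t ∈ Ω) {i : Fin n × ℕ} (hi : i ≠ (0, 0)) :
    td i f (type2Time logτ t) = type2Sign 𝕜 i * (td (type2Index i) g t
      - D.θ (type2Index i).1 (type2Index i).2 (v t) * td (0, 0) g t / v t (Fin.rev 0)) := by
  have hf : TimesSmoothOn f (type2Time logτ '' Ω) := timesSmoothOn_image hN hθ hτ fun k t φ =>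
    (hg k t φ).congr fun s hs => e _ hs
  obtain ⟨h1, h2, h3⟩ := type2Index_involution (𝕜 := 𝕜) hN.rev_zero_ne hi
  have h4 := td_comp hN hθ hτ hf ht (type2Index i)
  rw [td_congr hτ.isOpen e ht, type2Linear_single h1, h2, h3, one_mul,
    td_zero_image hN hθ hτ hg e ht, lineDeriv_smul, smul_eq_mul, ← td] at h4
  rw [h4]
  linear_combination (-td i f (type2Time logτ t)) * type2Sign_mul_self (𝕜 := 𝕜) i

section Tau

variable (hl : ∀ t ∈ Ω, logτ' (type2Time logτ t) = t (0, 0) * td (0, 0) logτ t - logτ t)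
include hl

omit hN hθ hl in
theorem timesSmoothOn_legendreTransform :
    TimesSmoothOn (fun t => t (0, 0) * td (0, 0) logτ t - logτ t) Ω := fun k t φ =>
  ((timesSmoothOn_coord (0, 0) Ω k t φ).mul (hτ.smooth_logτ.td hτ.isOpen (0, 0) k t φ)).sub
    (hτ.smooth_logτ k t φ)

omit hl hθ in
theorem td_legendreTransform (ht : t ∈ Ω) (i : Fin n × ℕ) :
    td i (fun t => t (0, 0) * td (0, 0) logτ t - logτ t) t
      = (if i = (0, 0) then 1 else 0) * td (0, 0) logτ t
        + t (0, 0) * D.θ i.1 i.2 (v t) - td i logτ t := by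
  have h1 := timesSmoothOn_coord (𝕜 := 𝕜) (n := n) (0, 0) Ω
  have h2 := hτ.smooth_logτ.td hτ.isOpen (0, 0)
  rw [td_sub hτ.isOpen (fun k t φ => (h1 k t φ).mul (h2 k t φ)) hτ.smooth_logτ ht,
    td_mul hτ.isOpen h1 h2 ht, td_coord, td_td_zero hN hτ ht]

/-- Legendre duality: x̂ = −∂log τ/∂x, and minus the old position is the new momentum. -/
theorem td_zero_logτ (ht : t ∈ Ω) : td (0, 0) logτ' (type2Time logτ t) = -t (0, 0) := by
  have hw := hN.last_ne_zero _ (hτ.mapsTo t ht)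
  rw [td_zero_image hN hθ hτ (timesSmoothOn_legendreTransform hτ) hl ht,
    td_legendreTransform hN hτ ht, hN.theta_zero hθ (hτ.mapsTo t ht), if_pos rfl]
  field_simp
  ring

/-- The contribution x θ_{σ(i)} from differentiating x ∂log τ/∂x cancels against the motion of x at
fixed x̂; only the derivative of −log τ is left. -/
theorem td_logτ (ht : t ∈ Ω) {i : Fin n × ℕ} (hi : i ≠ (0, 0)) :
    td i logτ' (type2Time logτ t) = -(type2Sign 𝕜 i * td (type2Index i) logτ t) := by
  have hw := hN.last_ne_zero _ (hτ.mapsTo t ht)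
  rw [td_image hN hθ hτ (timesSmoothOn_legendreTransform hτ) hl ht hi,
    td_legendreTransform hN hτ ht, td_legendreTransform hN hτ ht,
    hN.theta_zero hθ (hτ.mapsTo t ht), if_pos rfl,
    if_neg (type2Index_involution (𝕜 := 𝕜) hN.rev_zero_ne hi).1]
  field_simp
  ring

end Tau

end Legendre

include h hN hF hθ hτ

/-- Differentiating the Legendre first derivatives yields ΦΦ/v^n − εεΩ, exactly the expression found
for Ω̂. Indices (1,0) are treated apart since σ is not used there. -/
theorem td_td_logτ (hl : ∀ t ∈ Ω, logτ' (type2Time logτ t) = t (0, 0) * td (0, 0) logτ t - logτ t)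
    (ht : t ∈ Ω) (i j : Fin n × ℕ) :
    td i (td j logτ') (type2Time logτ t)
      = D'.twoPoint i.1 i.2 j.1 j.2 (D.type2Coord (v t)) := by
  have hne := hN.rev_zero_ne
  have hv := hτ.mapsTo t ht
  have hw := hN.last_ne_zero _ hv
  have hidx : ∀ i : Fin n × ℕ, i ≠ (0, 0) → ¬(i.1 = 0 ∧ i.2 = 0) := fun i hi e =>
    hi (Prod.ext e.1 e.2)
  by_cases hj : j = (0, 0)
  · subst hj
    have hg : TimesSmoothOn (fun t : Times 𝕜 n => -t (0, 0)) Ω := fun k t φ =>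
      (timesSmoothOn_coord (0, 0) Ω k t φ).neg
    have hd : ∀ i, td i (fun t : Times 𝕜 n => -t (0, 0)) t = if i = (0, 0) then -1 else 0 := by
      intro i
      have h1 := td_const_mul hτ.isOpen (-1) (timesSmoothOn_coord (𝕜 := 𝕜) (0, 0) Ω) ht i
      simpa [td_coord] using h1
    have e := fun t ht => td_zero_logτ hN hθ hτ hl (t := t) ht
    have h2 : D'.twoPoint i.1 i.2 0 0 (D.type2Coord (v t))
        = D.type2Density i.1 i.2 (v t) / v t (Fin.rev 0) := by
      rw [h.twoPoint_eq_sum hN hF hθ hv, type2Density_zero_zero, if_neg hne.symm]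
      simp [gradPair_const_right, type2Density_zero_zero]
    rw [h2]
    by_cases hi : i = (0, 0)
    · subst hi
      rw [td_zero_image hN hθ hτ hg e ht, hd, if_pos rfl, type2Density_zero_zero]
      field_simp
    · rw [td_image hN hθ hτ hg e ht hi, hd, hd, if_pos rfl,
        if_neg (type2Index_involution (𝕜 := 𝕜) hne hi).1, type2Density_eq_index hne hi]
      field_simp
      ring
  · have e := fun t ht => td_logτ hN hθ hτ hl (t := t) ht hj
    have hs := hτ.smooth_logτ.td hτ.isOpen (type2Index j)
    have hg : TimesSmoothOn (fun t => -(type2Sign 𝕜 j * td (type2Index j) logτ t)) Ω :=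
      fun k t φ => (contDiffOn_const.mul (hs k t φ)).neg
    have hd : ∀ i, td i (fun t => -(type2Sign 𝕜 j * td (type2Index j) logτ t)) t
        = -(type2Sign 𝕜 j * td i (td (type2Index j) logτ) t) := by
      intro i
      have h1 := td_const_mul hτ.isOpen (-type2Sign 𝕜 j) hs ht i
      simpa only [neg_mul] using h1
    have hx : td (0, 0) (td (type2Index j) logτ) t
        = D.θ (type2Index j).1 (type2Index j).2 (v t) := by
      rw [td_comm hτ.isOpen hτ.smooth_logτ ht, td_td_zero hN hτ ht]
    by_cases hi : i = (0, 0)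
    · subst hi
      have h2 := h.twoPoint_first_zero hN hF hθ hv j.1 j.2
      rw [type2Density_eq_index hne hj] at h2
      refine mul_left_cancel₀ hw ?_
      rw [td_zero_image hN hθ hτ hg e ht, hd, h2, hx]
      field_simp
    · obtain ⟨a, ha⟩ := exists_type2_index hne (hidx i hi)
      obtain ⟨b, hb⟩ := exists_type2_index hne (hidx j hj)
      have h3 : D.twoPoint (flip i.1) a (flip j.1) b (v t)
          = td (type2Index i) (td (type2Index j) logτ) t := by
        rw [← hτ.tau t ht]
        simp [type2Index, ← ha, ← hb]
      rw [h.twoPoint_eq hN hF hθ hv (hidx j hj) ha hb, h3,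
        type2Density_eq_index hne hi, type2Density_eq_index hne hj,
        td_image hN hθ hτ hg e ht hi, hd, hd, hx]
      simp only [type2Sign]
      field_simp
      ring

theorem isTau (hv' : ∀ t ∈ Ω, v' (type2Time logτ t) = D.type2Coord (v t))
    (hl : ∀ t ∈ Ω, logτ' (type2Time logτ t) = t (0, 0) * td (0, 0) logτ t - logτ t) :
    D'.IsTau (type2Time logτ '' Ω) v' logτ' := by
  refine IsTau.of_twoPoint (h.isWDVV hN hF) (h.isCalibration hN hF hθ)
    (timesOpen_image hN hθ hτ) (timesSmoothOn_image hN hθ hτ fun k t φ => ?_)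
    (timesSmoothOn_image hN hθ hτ fun k t φ => ?_) ?_ ?_
  · exact (hτ.smooth_v.comp (hN.isCoordChange hF).smooth hτ.mapsTo k t φ).congr
      fun s hs => hv' _ hs
  · exact (timesSmoothOn_legendreTransform hτ k t φ).congr fun s hs => hl _ hs
  · rintro _ ⟨t, ht, rfl⟩
    rw [hv' t ht]
    exact h.mem_dom (hτ.mapsTo t ht)
  · rintro _ ⟨t, ht, rfl⟩ α p β q
    rw [hv' t ht]
    exact h.td_td_logτ hN hF hθ hτ hl ht (α, p) (β, q)

end IsType2

end FrobeniusData

/-! ### The Virasoro forms. -/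

namespace FrobeniusData

variable {𝕜 : Type*} [RCLike 𝕜] {n : ℕ} {D D' : FrobeniusData 𝕜 n}

theorem IsType1.virasoroForm_eq {κ : Fin n} (h : D.IsType1 κ D') (m : ℤ) (t : Times 𝕜 n)
    (p : Fin n × ℕ → 𝕜) : D'.virasoroForm m t p = D.virasoroForm m t p := by
  have h1 : D'.mode = D.mode := by
    funext t p k α
    simp only [mode, h.η]
  have h2 : D'.totalR = D.totalR := by simp only [totalR, h.R]
  have h3 : D'.degPart = D.degPart := by
    funext q P
    simp only [degPart, h.μ]
  have h4 : D'.virP = D.virP := by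
    funext m k
    simp only [virP, h2, h.μ]
  simp only [virasoroForm, h1, h3, h4, h.η]

/-- By the grading at most one R_k contributes to a given entry. -/
theorem IsCalibration.totalR_eq_intR (hθ : D.IsCalibration) {q : ℤ} {α β : Fin n}
    (hq : D.μ α - D.μ β = q) : D.totalR α β = D.intR q α β := by
  have h0 : ∀ k : ℕ, (k : ℤ) ≠ q → D.R k α β = 0 := fun k hk => by
    by_contra h
    have := hθ.R_graded k α β h
    rw [hq] at this
    exact hk (by exact_mod_cast this.symm)
  rw [totalR, Matrix.of_apply]
  rcases lt_or_ge q 0 with h | h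
  · rw [intR_of_nonpos h.le, Matrix.zero_apply]
    exact finsum_eq_zero_of_forall_eq_zero fun k => h0 k (by omega)
  · lift q to ℕ using h
    rw [intR_natCast hθ]
    exact finsum_eq_single _ q fun k hk => h0 k (by exact_mod_cast hk)

theorem IsCalibration.totalR_eq_zero (hθ : D.IsCalibration) {α β : Fin n}
    (hq : ∀ q : ℤ, D.μ α - D.μ β ≠ q) : D.totalR α β = 0 :=
  finsum_eq_zero_of_forall_eq_zero fun k => by
    by_contra h
    exact hq k (by exact_mod_cast hθ.R_graded k α β h)

/-- For negative `k` of large absolute value the modes vanish. -/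
theorem exists_mode_eq_zero (D : FrobeniusData 𝕜 n) (t : Times 𝕜 n) (p : Fin n × ℕ → 𝕜) :
    ∃ K : ℤ, ∀ k < K, ∀ α, D.mode t p k α = 0 := by
  refine ⟨-(t.support.sup (fun i => i.2) : ℕ) - 1, fun k hk α => ?_⟩
  rw [mode, if_neg (by omega), Finsupp.notMem_support_iff.1, mul_zero]
  intro h
  have := Finset.le_sup (f := fun i : Fin n × ℕ => i.2) h
  simp only at this
  omega

open Classical in
/-- The contribution of a matrix entry to a term of the quadratic form of the Virasoro symmetry. -/
def virasoroTerm (D : FrobeniusData 𝕜 n) (m : ℤ) (t : Times 𝕜 n) (p : Fin n × ℕ → 𝕜)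
    (α β : Fin n) (kl : ℤ × ℤ) : 𝕜 :=
  if D.μ α - D.μ β = ((m - 1 - kl.2 - kl.1 : ℤ) : 𝕜) then
    1 / 2 * (-1) ^ (kl.1 + 1)
      * (D.mode t p kl.2 α.rev * D.virP m kl.1 α β * D.mode t p kl.1 β)
  else 0

/-- The grading fixes k + l for given α and β, and modes vanish for very negative index, so k and l
are bounded. This finiteness is what allows sums and `finsum` to be interchanged. -/
theorem finite_support_virasoroTerm (D : FrobeniusData 𝕜 n) (m : ℤ) (t : Times 𝕜 n)
    (p : Fin n × ℕ → 𝕜) (α β : Fin n) :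
    (Function.support (D.virasoroTerm m t p α β)).Finite := by
  obtain ⟨K, hK⟩ := D.exists_mode_eq_zero t p
  by_cases hq : ∃ q : ℤ, D.μ α - D.μ β = q
  · obtain ⟨q, hq⟩ := hq
    refine ((Set.finite_Icc K (m - 1 - q - K)).image fun k => (k, m - 1 - q - k)).subset ?_
    rintro ⟨k, l⟩ hkl
    rw [Function.mem_support, virasoroTerm, hq] at hkl
    have h1 : q = m - 1 - l - k := by
      by_contra h
      exact hkl (if_neg fun e => h (by exact_mod_cast e))
    have hk : K ≤ k := by
      by_contra h
      exact hkl (by simp [hK k (not_le.1 h)])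
    have hl : K ≤ l := by
      by_contra h
      exact hkl (by simp [hK l (not_le.1 h)])
    exact ⟨k, ⟨hk, by omega⟩, by ext <;> simp; omega⟩
  · convert Set.finite_empty
    ext kl
    simp only [Function.mem_support, Set.mem_empty_iff_false, iff_false, not_not]
    exact if_neg fun e => hq ⟨_, e⟩

theorem virasoroForm_eq_sum (hη : ∀ α β, D.η α β = if β = α.rev then 1 else 0) (m : ℤ)
    (t : Times 𝕜 n) (p : Fin n × ℕ → 𝕜) :
    D.virasoroForm m t p = ∑ α, ∑ β, ∑ᶠ kl, D.virasoroTerm m t p α β kl := by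
  have e : ∀ kl : ℤ × ℤ, 1 / 2 * (-1) ^ (kl.1 + 1) * (D.mode t p kl.2 ⬝ᵥ
      ((D.η * D.degPart (m - 1 - kl.2 - kl.1) (D.virP m kl.1)) *ᵥ D.mode t p kl.1))
      = ∑ α, ∑ β, D.virasoroTerm m t p α β kl := by
    intro kl
    have h1 : ∀ (P : Matrix (Fin n) (Fin n) 𝕜) γ β, (D.η * P) γ β = P γ.rev β := fun P γ β => by
      simp [Matrix.mul_apply, hη]
    simp only [dotProduct, Matrix.mulVec, h1]
    rw [← Equiv.sum_comp Fin.revPerm, Finset.mul_sum]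
    refine Finset.sum_congr rfl fun α _ => ?_
    rw [Fin.revPerm_apply, Fin.rev_rev, Finset.mul_sum, Finset.mul_sum]
    refine Finset.sum_congr rfl fun β _ => ?_
    simp only [degPart, Matrix.of_apply, virasoroTerm]
    split_ifs
    · ring
    · simp
  have hfin := D.finite_support_virasoroTerm m t p
  have hs : ∀ α, (Function.support fun kl => ∑ β, D.virasoroTerm m t p α β kl).Finite := fun α =>
    (Set.finite_iUnion fun β => hfin α β).subset fun kl hkl => by
      obtain ⟨β, -, hβ⟩ := Finset.exists_ne_zero_of_sum_ne_zero hkl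
      exact Set.mem_iUnion.2 ⟨β, hβ⟩
  rw [virasoroForm, finsum_congr e, finsum_sum_comm _ _ fun α _ => hs α]
  exact Finset.sum_congr rfl fun α _ => finsum_sum_comm _ _ fun β _ => hfin α β

variable [NeZero n]

namespace IsType2

section Modes

variable (h : D.IsType2 D') (hN : D.IsType2Normalized)
include h hN

/-- The change of the modes under the type-2 symmetry. -/
theorem mode_eq {t t' : Times 𝕜 n} {p p' : Fin n × ℕ → 𝕜} (ht0 : t' (0, 0) = -p (0, 0))
    (ht : ∀ i ≠ (0, 0), t' i = type2Sign 𝕜 i * t (type2Index i)) (hp0 : p' (0, 0) = -t (0, 0))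
    (hp : ∀ i ≠ (0, 0), p' i = -(type2Sign 𝕜 i * p (type2Index i))) (k : ℤ) (α : Fin n) :
    D'.mode t' p' k α
      = lastSign 𝕜 α.rev * (-1) ^ (k + 1) * D.mode t p (k + delta α) (flip α) := by
  have hne := hN.rev_zero_ne
  have hsum : ∀ (f : Fin n → 𝕜) α, ∑ β, D.η⁻¹ α β * f β = f α.rev := fun f α => by
    simp [hN.inv_eta, hN.η]
  simp only [mode, h.η, hsum]
  have h1 : (-1 : 𝕜) ≠ 0 := by simp
  have h2 : ∀ a : ℕ, ((-1 : 𝕜) ^ a) * (-1) ^ a = 1 := fun a => by rw [← mul_pow]; simp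
  by_cases a0 : α = 0
  · subst a0
    rw [delta_zero hne, flip_zero, Fin.rev_rev]
    rcases lt_trichotomy k (-1) with hk | rfl | hk
    · obtain ⟨j, rfl⟩ : ∃ j : ℕ, k = -(j : ℤ) - 2 := ⟨(-k - 2).toNat, by omega⟩
      rw [if_neg (by omega), if_neg (by omega),
        show (-(-(j : ℤ) - 2) - 1).toNat = j + 1 by omega,
        show (-(-(j : ℤ) - 2 + 1) - 1).toNat = j by omega, ht _ (by simp),
        type2Index_zero_succ hne, type2Sign]
      have h3 : ∀ j : ℕ, ((-1 : 𝕜) ^ j)⁻¹ = (-1) ^ j := fun j =>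
        (eq_inv_of_mul_eq_one_left (h2 j)).symm
      rw [show -(j : ℤ) - 2 + 1 + 1 = -(j : ℤ) by ring,
        show -(j : ℤ) - 2 + 1 = -((j + 1 : ℕ) : ℤ) by push_cast; ring]
      simp only [lastSign, hne.symm, if_false, if_true, zpow_neg, zpow_natCast, h3, pow_succ]
      ring
    -- At k = −1 a time becomes a derivative: t̂^{1,0} = −∂log τ/∂t^{1,0}.
    · simp [ht0, lastSign]
    · obtain ⟨j, rfl⟩ : ∃ j : ℕ, k = j := ⟨k.toNat, by omega⟩
      rw [if_pos (by omega), if_pos (by omega), hp _ (by simp [hne]), Int.toNat_natCast,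
        type2Index_last hne, type2Sign, show ((j : ℤ) + 1).toNat = j + 1 by omega,
        zpow_add₀ h1, zpow_natCast]
      simp [lastSign]
  by_cases a1 : α = Fin.rev 0
  · subst a1
    rw [delta_last hne, flip_last, Fin.rev_rev]
    rcases lt_trichotomy k 0 with hk | rfl | hk
    · obtain ⟨j, rfl⟩ : ∃ j : ℕ, k = -(j : ℤ) - 1 := ⟨(-k - 1).toNat, by omega⟩
      rw [if_neg (by omega), if_neg (by omega),
        show (-(-(j : ℤ) - 1) - 1).toNat = j by omega,
        show (-(-(j : ℤ) - 1 + -1) - 1).toNat = j + 1 by omega, ht _ (by simp [hne]),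
        type2Index_last hne, type2Sign]
      simp only [lastSign, hne.symm, if_false, if_true]
      rw [show -(j : ℤ) - 1 + 1 = -(j : ℤ) by ring,
        show -(j : ℤ) - 1 + -1 + 1 = -((j + 1 : ℕ) : ℤ) by push_cast; ring, zpow_neg, zpow_neg,
        zpow_natCast, zpow_natCast]
      have h3 : ∀ j : ℕ, ((-1 : 𝕜) ^ j)⁻¹ = (-1) ^ j := fun j =>
        (eq_inv_of_mul_eq_one_left (h2 j)).symm
      rw [h3, h3, pow_succ]
      ring
    -- At k = 0 the reverse exchange takes place: ∂log τ̂/∂t̂^{1,0} = −t^{1,0}.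
    · simp [hp0, lastSign, hne.symm]
    · obtain ⟨j, rfl⟩ : ∃ j : ℕ, k = (j : ℤ) + 1 := ⟨(k - 1).toNat, by omega⟩
      rw [if_pos (by omega), if_pos (by omega), show ((j : ℤ) + 1).toNat = j + 1 by omega,
        show ((j : ℤ) + 1 + -1).toNat = j by omega, hp _ (by simp), type2Index_zero_succ hne,
        type2Sign, show (j : ℤ) + 1 + 1 = ((j + 1 : ℕ) : ℤ) + 1 by push_cast; ring,
        zpow_add₀ h1, zpow_natCast]
      simp [lastSign, hne.symm]
  · have b0 := IsType2Normalized.rev_ne_zero a1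
    have b1 := IsType2Normalized.rev_ne_last a0
    rw [delta_other a0 a1, flip_other a0 a1, add_zero]
    split_ifs with hk
    · obtain ⟨j, rfl⟩ : ∃ j : ℕ, k = j := ⟨k.toNat, by omega⟩
      rw [Int.toNat_natCast, hp _ (by simp [b0]), type2Index_other b0 b1, type2Sign,
        zpow_add₀ h1, zpow_natCast]
      simp [lastSign]
    · obtain ⟨j, rfl⟩ : ∃ j : ℕ, k = -(j : ℤ) - 1 := ⟨(-k - 1).toNat, by omega⟩
      rw [show (-(-(j : ℤ) - 1) - 1).toNat = j by omega, ht _ (by simp [a0]),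
        type2Index_other a0 a1, type2Sign, show -(j : ℤ) - 1 + 1 = -(j : ℤ) by ring, zpow_neg,
        zpow_natCast]
      have h3 : ((-1 : 𝕜) ^ j)⁻¹ = (-1) ^ j := (eq_inv_of_mul_eq_one_left (h2 j)).symm
      rw [h3]
      simp [lastSign, a1, b1]

end Modes

variable (h : D.IsType2 D') (hN : D.IsType2Normalized) (hF : D.IsWDVV) (hθ : D.IsCalibration)
include h hN hF hθ

omit hN hF hθ in
theorem mu_sub_eq_iff (q : ℤ) (α β : Fin n) : D'.μ α - D'.μ β = q
    ↔ D.μ (flip α) - D.μ (flip β) = ((q + delta α - delta β : ℤ) : 𝕜) := by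
  rw [h.μ, h.μ]
  push_cast
  constructor <;> intro e <;> linear_combination e

theorem totalR_eq {q : ℤ} {α β : Fin n} (hq : D'.μ α - D'.μ β = q) :
    D'.totalR α β
      = (-1) ^ q * lastSign 𝕜 α * lastSign 𝕜 β * D.totalR (flip α) (flip β) := by
  rw [(h.isCalibration hN hF hθ).totalR_eq_intR hq,
    hθ.totalR_eq_intR ((h.mu_sub_eq_iff q α β).1 hq), h.intR_eq hN hF hθ]

/-- The sign (−1)^q is multiplicative in the degree q and the signs `lastSign` cancel at the
intermediate index, so the twisted conjugation respects products. -/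
theorem totalR_pow_eq (s : ℕ) {q : ℤ} {α β : Fin n} (hq : D'.μ α - D'.μ β = q) :
    (D'.totalR ^ s) α β
      = (-1) ^ q * lastSign 𝕜 α * lastSign 𝕜 β * (D.totalR ^ s) (flip α) (flip β) := by
  induction s generalizing q β with
  | zero =>
    rw [pow_zero, pow_zero, Matrix.one_apply, Matrix.one_apply]
    by_cases e : α = β
    · subst e
      have : q = 0 := by
        rw [sub_self] at hq
        exact_mod_cast hq.symm
      subst this
      simp [lastSign_mul_self]
    · rw [if_neg e, if_neg fun e' : flip α = flip β =>
        e ((Equiv.swap (0 : Fin n) (Fin.rev 0)).injective e'), mul_zero]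
  | succ s ih =>
    rw [pow_succ, pow_succ, Matrix.mul_apply, Matrix.mul_apply, Finset.mul_sum,
      ← Equiv.sum_comp (Equiv.swap (0 : Fin n) (Fin.rev 0)) (fun γ => (-1) ^ q * lastSign 𝕜 α
        * lastSign 𝕜 β * ((D.totalR ^ s) (flip α) γ * D.totalR γ (flip β)))]
    refine Finset.sum_congr rfl fun γ _ => ?_
    change _ = (-1) ^ q * lastSign 𝕜 α * lastSign 𝕜 β
      * ((D.totalR ^ s) (flip α) (flip γ) * D.totalR (flip γ) (flip β))
    by_cases hγ : ∃ r : ℤ, D'.μ γ - D'.μ β = r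
    · obtain ⟨r, hr⟩ := hγ
      have hr' : D'.μ α - D'.μ γ = ((q - r : ℤ) : 𝕜) := by
        push_cast
        linear_combination hq - hr
      rw [ih hr', h.totalR_eq hN hF hθ hr,
        show ((-1 : 𝕜) ^ q) = (-1) ^ (q - r) * (-1) ^ r by
          rw [← zpow_add₀ (by simp), sub_add_cancel]]
      linear_combination ((-1) ^ (q - r) * (-1) ^ r * lastSign 𝕜 α * lastSign 𝕜 β
        * (D.totalR ^ s) (flip α) (flip γ) * D.totalR (flip γ) (flip β))
        * lastSign_mul_self (𝕜 := 𝕜) γ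
    -- An intermediate index at non-integral distance contributes nothing to either product.
    · push Not at hγ
      rw [(h.isCalibration hN hF hθ).totalR_eq_zero hγ, hθ.totalR_eq_zero fun r hr => hγ
        (r - delta γ + delta β) ((h.mu_sub_eq_iff _ _ _).2 (by rw [hr]; congr 1; ring)),
        mul_zero, mul_zero, mul_zero]

omit h hN hF hθ [NeZero n] in
theorem virP_apply (D : FrobeniusData 𝕜 n) (m k : ℤ) (α β : Fin n) :
    D.virP m k α β = ∑ s ∈ Finset.range ((m + 1).toNat + 1), (D.totalR ^ s) α β *
      (∏ j ∈ Finset.range (m + 1).toNat,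
        (Polynomial.X + Polynomial.C (D.μ β - k + j - 1 / 2))).coeff s := by
  simp [virP, Matrix.sum_apply, Matrix.mul_diagonal]

/-- The polynomial depends on μ̂_β − k = μ_{flip β} − (k + δ(β)), so the change of μ is the same
shift of k as for the modes. -/
theorem virP_eq (m k : ℤ) {q : ℤ} {α β : Fin n} (hq : D'.μ α - D'.μ β = q) :
    D'.virP m k α β = (-1) ^ q * lastSign 𝕜 α * lastSign 𝕜 β
      * D.virP m (k + delta β) (flip α) (flip β) := by
  rw [virP_apply, virP_apply, Finset.mul_sum]
  refine Finset.sum_congr rfl fun s _ => ?_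
  have e : D'.μ β - k = D.μ (flip β) - ((k + delta β : ℤ) : 𝕜) := by
    rw [h.μ]; push_cast; ring
  rw [h.totalR_pow_eq hN hF hθ s hq, e]
  ring

section Form

variable {t t' : Times 𝕜 n} {p p' : Fin n × ℕ → 𝕜}
  (hmode : ∀ k α, D'.mode t' p' k α
    = lastSign 𝕜 α.rev * (-1) ^ (k + 1) * D.mode t p (k + delta α) (flip α))
include hmode

/-- The index l moves by −δ(α) rather than +δ(α), because a_l is contracted through η and carries
the reversed index. The signs of the two modes, of P_m and of the prefactor then combine to
(−1)^{m+1}. -/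
theorem virasoroTerm_eq (m : ℤ) (α β : Fin n) (kl : ℤ × ℤ) :
    D'.virasoroTerm m t' p' α β kl = (-1) ^ (m + 1)
      * D.virasoroTerm m t p (flip α) (flip β) (kl.1 + delta β, kl.2 - delta α) := by
  obtain ⟨k, l⟩ := kl
  have hne := hN.rev_zero_ne
  simp only [virasoroTerm]
  have hq' := h.mu_sub_eq_iff (m - 1 - l - k) α β
  rw [show m - 1 - l - k + delta α - delta β = m - 1 - (l - delta α) - (k + delta β) by ring] at hq'
  by_cases hq : D'.μ α - D'.μ β = ((m - 1 - l - k : ℤ) : 𝕜)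
  · rw [if_pos hq, if_pos (hq'.1 hq), h.virP_eq hN hF hθ m k hq, hmode, hmode, Fin.rev_rev,
      delta_rev, flip_rev, lastSign_rev hne, ← sub_eq_add_neg]
    have h1 : (-1 : 𝕜) ≠ 0 := by simp
    have h2 : ∀ a : ℤ, ((-1 : 𝕜) ^ a) * (-1) ^ a = 1 := fun a => by rw [← mul_zpow]; simp
    have hs : ((-1 : 𝕜) ^ (k + 1)) * (-1) ^ (l + 1) * (-1) ^ (m - 1 - l - k) * (-1) ^ delta β
        * (-1) ^ (k + 1) = (-1) ^ (m + 1) * (-1) ^ (k + delta β + 1) := by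
      simp only [← zpow_add₀ h1]
      rw [show k + 1 + (l + 1) + (m - 1 - l - k) + delta β + (k + 1)
        = m + 1 + (k + delta β + 1) by ring]
    linear_combination (1 / 2 * D.mode t p (l - delta α) (flip α).rev
        * D.virP m (k + delta β) (flip α) (flip β) * D.mode t p (k + delta β) (flip β))
      * (hs + (-1) ^ (k + 1) * (-1) ^ (l + 1) * (-1) ^ (m - 1 - l - k) * (-1) ^ delta β
        * (-1) ^ (k + 1) * (lastSign 𝕜 β * lastSign 𝕜 β * lastSign_mul_self (𝕜 := 𝕜) α
          + lastSign_mul_self (𝕜 := 𝕜) β))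
  · rw [if_neg hq, if_neg fun e => hq (hq'.2 e), mul_zero]

theorem virasoroForm_eq (m : ℤ) :
    D'.virasoroForm m t' p' = (-1) ^ (m + 1) * D.virasoroForm m t p := by
  rw [virasoroForm_eq_sum hN.η, virasoroForm_eq_sum (by rw [h.η]; exact hN.η), Finset.mul_sum,
    ← Equiv.sum_comp (Equiv.swap (0 : Fin n) (Fin.rev 0)) (fun α => (-1) ^ (m + 1)
      * ∑ β, ∑ᶠ kl, D.virasoroTerm m t p α β kl)]
  refine Finset.sum_congr rfl fun α _ => ?_
  rw [Finset.mul_sum, ← Equiv.sum_comp (Equiv.swap (0 : Fin n) (Fin.rev 0)) (fun β =>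
    (-1) ^ (m + 1) * ∑ᶠ kl, D.virasoroTerm m t p (Equiv.swap (0 : Fin n) (Fin.rev 0) α) β kl)]
  refine Finset.sum_congr rfl fun β _ => ?_
  change _ = (-1) ^ (m + 1) * ∑ᶠ kl, D.virasoroTerm m t p (flip α) (flip β) kl
  rw [finsum_congr (h.virasoroTerm_eq hN hF hθ hmode m α β), mul_finsum]
  -- For fixed α and β the shift of (k,l) is a bijection of ℤ × ℤ.
  exact finsum_comp_equiv ((Equiv.addRight (delta β)).prodCongr (Equiv.subRight (delta α)))
    (f := fun kl => (-1) ^ (m + 1) * D.virasoroTerm m t p (flip α) (flip β) kl)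

end Form

end IsType2

end FrobeniusData

/-! ### The Virasoro symmetries and constraints under type 2. -/

namespace FrobeniusData

variable {𝕜 : Type*} [RCLike 𝕜] {n : ℕ} [NeZero n] {D D' : FrobeniusData 𝕜 n}
  {Ω : Set (Times 𝕜 n)} {t : Times 𝕜 n} {v : Times 𝕜 n → Fin n → 𝕜} {logτ logτ' : Times 𝕜 n → 𝕜}

theorem type2Time_zero (hne : (Fin.rev 0 : Fin n) ≠ 0) (t : Times 𝕜 n) :
    type2Time logτ t (0, 0) = -td (0, 0) logτ t := by
  simp [type2Time_eq hne, type2Linear_apply hne]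

theorem type2Time_apply (hne : (Fin.rev 0 : Fin n) ≠ 0) (t : Times 𝕜 n) {i : Fin n × ℕ}
    (hi : i ≠ (0, 0)) : type2Time logτ t i = type2Sign 𝕜 i * t (type2Index i) := by
  rw [type2Time_eq hne, Finsupp.sub_apply, type2Linear_apply hne, if_neg hi,
    Finsupp.single_eq_of_ne hi, sub_zero]

/-- The time t^{1,1} reappears as −t̂^{n,0}. The index (1,0) is not shifted on either side. -/
theorem type2_shift (hne : (Fin.rev 0 : Fin n) ≠ 0) {i : Fin n × ℕ} (hi : i ≠ (0, 0)) :
    (-Finsupp.single (Fin.rev 0, 0) 1 : Times 𝕜 n) i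
      = type2Sign 𝕜 i * (Finsupp.single (0, 1) 1 : Times 𝕜 n) (type2Index i) := by
  rw [Finsupp.neg_apply]
  by_cases e : i = (Fin.rev 0, 0)
  · subst e
    rw [type2Index_last hne, zero_add, Finsupp.single_eq_same, Finsupp.single_eq_same]
    simp [type2Sign, lastSign]
  · rw [Finsupp.single_eq_of_ne e, Finsupp.single_eq_of_ne, neg_zero, mul_zero]
    intro e'
    have h1 := (type2Index_involution (𝕜 := 𝕜) hne hi).2.1
    rw [e', type2Index_zero_succ hne 0] at h1
    exact e h1.symm

namespace IsType2

variable (h : D.IsType2 D') (hN : D.IsType2Normalized) (hF : D.IsWDVV) (hθ : D.IsCalibration)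
  (hτ : D.IsTau Ω v logτ)
  (hl : ∀ t ∈ Ω, logτ' (type2Time logτ t) = t (0, 0) * td (0, 0) logτ t - logτ t)
include h hN hF hθ hτ hl

theorem virasoroA_eq (m : ℤ) (ht : t ∈ Ω) :
    D'.virasoroA m logτ' (type2Time logτ t) = (-1) ^ (m + 1) * D.virasoroA m logτ t := by
  have hne := hN.rev_zero_ne
  exact h.virasoroForm_eq hN hF hθ (h.mode_eq hN (type2Time_zero hne t)
    (fun i hi => type2Time_apply hne t hi) (td_zero_logτ hN hθ hτ hl ht)
    fun i hi => td_logτ hN hθ hτ hl ht hi) m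

/-- The transformation of the modes treats times and derivatives as independent arguments, so it
applies equally to the shifted times with the derivatives still taken at t. -/
theorem virasoroConstraints (hc : D.VirasoroConstraints (Finsupp.single (0, 1) 1) logτ Ω) :
    D'.VirasoroConstraints (-Finsupp.single (Fin.rev 0, 0) 1) logτ' (type2Time logτ '' Ω) := by
  have hne := hN.rev_zero_ne
  rintro m hm _ ⟨t, ht, rfl⟩
  rw [h.virasoroForm_eq hN hF hθ (t := t - Finsupp.single (0, 1) 1)
    (p := fun i => td i logτ t) (h.mode_eq hN ?_ ?_ ?_
    fun i hi => td_logτ hN hθ hτ hl ht hi) m, hc m hm t ht, mul_zero]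
  · rw [Finsupp.sub_apply, Finsupp.neg_apply, type2Time_zero hne,
      Finsupp.single_eq_of_ne (by simp [hne.symm])]
    ring
  · intro i hi
    rw [Finsupp.sub_apply, Finsupp.sub_apply, type2_shift hne hi, type2Time_apply hne t hi]
    ring
  · rw [td_zero_logτ hN hθ hτ hl ht, Finsupp.sub_apply, Finsupp.single_eq_of_ne (by simp),
      sub_zero]

end IsType2

end FrobeniusData

end

theorem mainTheorem4 {𝕜 : Type*} [RCLike 𝕜] {n : ℕ} [NeZero n]
    (D : FrobeniusData 𝕜 n) (hunit : D.unit = 0) (hF : D.IsWDVV) (hθ : D.IsCalibration)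
    (Ω : Set (Times 𝕜 n)) (v : Times 𝕜 n → Fin n → 𝕜) (logτ : Times 𝕜 n → 𝕜)
    (hτ : D.IsTau Ω v logτ) :
    -- type 1: the times and the tau function are unchanged, `x̂ = t^{κ,0}`
    (∀ (κ : Fin n) (D' : FrobeniusData 𝕜 n), D.IsType1 κ D' →
      D'.IsWDVV ∧ D'.IsCalibration ∧
      D'.IsTau Ω (fun t => D.type1Coord κ (v t)) logτ ∧
      (∀ m : ℤ, -1 ≤ m → ∀ t ∈ Ω, D'.virasoroA m logτ t = D.virasoroA m logτ t) ∧
      (D.VirasoroConstraints (Finsupp.single (0, 1) 1) logτ Ω →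
        D'.VirasoroConstraints (Finsupp.single (0, 1) 1) logτ Ω)) ∧
    -- type 2: the times are changed by `t ↦ t̂`, the tau function by a Legendre transformation
    (D.IsType2Normalized → ∀ D' : FrobeniusData 𝕜 n, D.IsType2 D' →
      D'.IsWDVV ∧ D'.IsCalibration ∧
      (Set.InjOn (FrobeniusData.type2Time logτ) Ω →
        ∀ (v' : Times 𝕜 n → Fin n → 𝕜) (logτ' : Times 𝕜 n → 𝕜),
        (∀ t ∈ Ω, v' (FrobeniusData.type2Time logτ t) = D.type2Coord (v t)) →
        (∀ t ∈ Ω, logτ' (FrobeniusData.type2Time logτ t)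
          = t (0, 0) * td (0, 0) logτ t - logτ t) →
        D'.IsTau (FrobeniusData.type2Time logτ '' Ω) v' logτ' ∧
        (∀ m : ℤ, -1 ≤ m → ∀ t ∈ Ω,
          D'.virasoroA m logτ' (FrobeniusData.type2Time logτ t)
            = (-1) ^ (m + 1) * D.virasoroA m logτ t) ∧
        (D.VirasoroConstraints (Finsupp.single (0, 1) 1) logτ Ω →
          D'.VirasoroConstraints (-Finsupp.single (Fin.rev 0, 0) 1) logτ'
            (FrobeniusData.type2Time logτ '' Ω)))) := by
  refine ⟨fun κ D' h => ⟨h.isWDVV hF, h.isCalibration hF hθ, hτ.type1 hF hθ h,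
    fun m _ t _ => h.virasoroForm_eq m t _, fun hc m hm t ht => ?_⟩,
    fun hN D' h => ⟨h.isWDVV hN hF, h.isCalibration hN hF hθ, fun _ v' logτ' hv' hl =>
      ⟨h.isTau hN hF hθ hτ hv' hl, fun m _ t ht => h.virasoroA_eq hN hF hθ hτ hl m ht,
        h.virasoroConstraints hN hF hθ hτ hl⟩⟩⟩
  rw [h.virasoroForm_eq]
  exact hc m hm t ht
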